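/- **Theorem 2.2.** Let $1\le d\le n$ be integers. Let $\mathcal H_n$ be the Hilbert space of analytic functions on the open unit ball $B^{2d}\subset\mathbb C^d$ that are square-integrable for $dV_n=\frac{n!}{(n-d)!\,\pi^d}(1-|z|^2)^{n-d}\,dV$ ($dV$ is Lebesgue measure), with $\langle f|g\rangle=\int f\overline g\,dV_n$; let $P_n:L^2(B^{2d},dV_n)\to\mathcal H_n$ be the orthogonal projection. For $\phi\in C(\overline{B}^{2d})$ let $T_{\phi,n}f=P_n(\phi f)$ on $\mathcal H_n$, and let $\mathcal T_n$ be the $C^*$-algebra generated by all $T_{\phi,n}$. Let $(e_j)_{j\ge1}$ be any enumeration of the orthonormal basis $e_{k,n}=\left(\frac{(|k|+n)!}{k!\,n!}\right)^{1/2}z^k$ ($k$ a multi-index) of $\mathcal H_n$. Let $\mathrm{Lip}(\mathscr K(\mathcal H_n))$ be the real vector space of self-adjoint compact operators $K$ on $\mathcal H_n$ such that all $\langle Ke_i|e_j\rangle$ are real and $$\tilde L_n(K)=\sup_{i,j\ge1}(i+j)^{n+2}\,|\langle Ke_i|e_j\rangle|<\infty .$$ Let $\sigma:C(S^{2d-1})\to\mathcal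 T_n$ be a unital positive linear splitting of the symbol map, that is, a positive linear map with $\sigma(1)=I$ such that for every $f\in C(S^{2d-1})$ we have $\sigma(f)=T_{\phi,n}+K$ for some $\phi\in C(\overline B^{2d})$ with $\phi|_{S^{2d-1}}=f$ and some compact $K$. Such a $\sigma$ exists, and for every such $\sigma$ the following hold. 1. $\mathrm{Lip}(\mathcal T_n)=\mathrm{Lip}(\mathscr K(\mathcal H_n))\oplus\{\sigma(f): f \text{ a real-valued Lipschitz function on } S^{2d-1}\}$ is a direct sum, is contained in $\mathcal T_n$, and consists of self-adjoint operators, among them $I$. 2. There is a well-defined seminorm $L_n$ on $\mathrm{Lip}(\mathcal T_n)$ with $L_n(\sigma(f)+K)=\tilde L_n(K)+\mathrm{Lip}(f)$ for every real-valued Lipschitz $f$ and every $K\in\mathrm{Lip}(\mathscr K(\mathcal H_n))$, where $\mathrm{Lip}(f)=\sup_{x\ne y}|f(x)-f(y)|/|x-y|$. 3. $(\mathrm{Lip}(\mathcal T_n),L_n)$ is a compact quantum metric space: $\mathrm{Lip}(\mathcal T_n)$, with the operator order and the unit $I$, is an order-unit space; $L_n(I)=0$; and on its state space $\mathcal S$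 (positive real-linear functionals $\mu$ with $\mu(I)=1$) the topology of the metric $\rho_{L_n}(\mu,\nu)=\sup\{|\mu(a)-\nu(a)|: a\in \mathrm{Lip}(\mathcal T_n),\ L_n(a)\le1\}$ coincides with the weak$^*$ topology. -/

import Mathlib

open MeasureTheory Metric Filter Topology
open scoped ENNReal NNReal

/-! ## Order-unit spaces, state spaces, Lip-norms -/

/-- `A` is an (Archimedean) order-unit space with order unit `e`. -/
structure IsOrderUnitSpace (A : Type*) [AddCommGroup A] [Module ℝ A] [PartialOrder A] (e : A) :
    Prop where
  add_le_add : ∀ a b c : A, a ≤ b → a + c ≤ b + c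
  smul_nonneg : ∀ (r : ℝ) (a : A), 0 ≤ r → 0 ≤ a → 0 ≤ r • a
  exists_le_smul : ∀ a : A, ∃ r : ℝ, a ≤ r • e
  archimedean : ∀ a : A, (∀ r : ℝ, 0 < r → a ≤ r • e) → a ≤ 0

/-- The states of `A`: positive linear functionals taking the value `1` at the order unit. -/
def StateSpace (A : Type*) [AddCommGroup A] [Module ℝ A] [PartialOrder A] (e : A) : Type _ :=
  {μ : A →ₗ[ℝ] ℝ // (∀ a : A, 0 ≤ a → 0 ≤ μ a) ∧ μ e = 1}

/-- The weak-* topology on the state space: pointwise convergence on `A`. -/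
abbrev weakStarTopology (A : Type*) [AddCommGroup A] [Module ℝ A] [PartialOrder A] (e : A) :
    TopologicalSpace (StateSpace A e) :=
  TopologicalSpace.induced (fun (μ : StateSpace A e) (a : A) => μ.1 a) Pi.topologicalSpace

/-- `ρ_L(μ, ν) = sup {|μ(a) - ν(a)| : L(a) ≤ 1}`, a supremum in `[0, ∞]`. -/
noncomputable def stateDist {A : Type*} [AddCommGroup A] [Module ℝ A] [PartialOrder A] {e : A}
    (L : Seminorm ℝ A) (μ ν : StateSpace A e) : ℝ≥0∞ :=
  ⨆ (a : A) (_ : L a ≤ 1), ENNReal.ofReal |μ.1 a - ν.1 a|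

/-- The state space with the (extended) metric `ρ_L`. -/
noncomputable abbrev stateMetric {A : Type*} [AddCommGroup A] [Module ℝ A] [PartialOrder A] (e : A)
    (L : Seminorm ℝ A) : PseudoEMetricSpace (StateSpace A e) where
  edist := stateDist L
  edist_self μ := by
    simp [stateDist]
  edist_comm μ ν := by
    simp only [stateDist, abs_sub_comm]
  edist_triangle μ ν κ := by
    refine iSup₂_le fun a ha => ?_
    refine le_trans (ENNReal.ofReal_le_ofReal (abs_sub_le _ (ν.1 a) _)) ?_
    rw [ENNReal.ofReal_add (abs_nonneg _) (abs_nonneg _)]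
    exact add_le_add (le_iSup₂_of_le a ha le_rfl) (le_iSup₂_of_le a ha le_rfl)

/-- `(A, L)` is a compact quantum metric space: `A` is an order-unit space with order unit `e`
and `L` is a Lip-norm on `A`, i.e. `L(e) = 0` and the topology of `ρ_L` on the state space is
the weak-* topology. -/
structure IsCompactQuantumMetricSpace (A : Type*) [AddCommGroup A] [Module ℝ A] [PartialOrder A]
    (e : A) (L : Seminorm ℝ A) : Prop where
  isOrderUnitSpace : IsOrderUnitSpace A e
  map_unit : L e = 0
  topology_eq : (stateMetric e L).toUniformSpace.toTopologicalSpace = weakStarTopology A e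

/-! ## Generalized Bergman spaces -/

/-- The measure `dV_n = n! / ((n - d)! π^d) (1 - |z|²)^(n - d) dV` on the open unit ball of `ℂ^d`
(used for `n ≥ d`), `dV` being Lebesgue measure. -/
noncomputable def bergmanMeasure (d n : ℕ) : Measure (EuclideanSpace ℂ (Fin d)) :=
  (volume.restrict (ball 0 1)).withDensity fun z =>
    ENNReal.ofReal ((n.factorial : ℝ) / ((n - d).factorial * Real.pi ^ d) * (1 - ‖z‖ ^ 2) ^ (n - d))

instance (d n : ℕ) : IsFiniteMeasure (bergmanMeasure d n) := by
  apply isFiniteMeasure_withDensity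
  refine ne_of_lt (lt_of_le_of_lt (setLIntegral_mono (g := fun _ =>
    ENNReal.ofReal ((n.factorial : ℝ) / ((n - d).factorial * Real.pi ^ d))) (by fun_prop) ?_) ?_)
  · intro z hz
    simp only [mem_ball, dist_zero_right] at hz
    apply ENNReal.ofReal_le_ofReal
    apply mul_le_of_le_one_right (by positivity)
    exact pow_le_one₀ (by nlinarith [norm_nonneg z]) (by nlinarith [norm_nonneg z])
  · rw [setLIntegral_const]
    exact ENNReal.mul_lt_top ENNReal.ofReal_lt_top measure_ball_lt_top

/-- Mean value property on balls for holomorphic functions of several variables. -/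
theorem holo_mean {d : ℕ} {g : EuclideanSpace ℂ (Fin d) → ℂ} {U : Set (EuclideanSpace ℂ (Fin d))}
    (hU : IsOpen U) (hg : DifferentiableOn ℂ g U) {z : EuclideanSpace ℂ (Fin d)} {r : ℝ}
    (hz : closedBall z r ⊆ U) :
    ∫ w in closedBall (0 : EuclideanSpace ℂ (Fin d)) r, g (z + w)
      = (volume.real (closedBall (0 : EuclideanSpace ℂ (Fin d)) r) : ℂ) * g z := by
  set B := closedBall (0 : EuclideanSpace ℂ (Fin d)) r
  have hmem : ∀ θ : ℝ, ∀ w ∈ B, z + circleMap 0 1 θ • w ∈ closedBall z r := by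
    intro θ w hw
    simp only [B, mem_closedBall, dist_zero_right] at hw
    simp [norm_smul, hw]
  have hc : ContinuousOn (Function.uncurry fun (θ : ℝ) (w : EuclideanSpace ℂ (Fin d)) =>
      g (z + circleMap 0 1 θ • w)) (Set.Icc 0 (2 * Real.pi) ×ˢ B) := by
    refine hg.continuousOn.comp (f := fun p : ℝ × EuclideanSpace ℂ (Fin d) =>
      z + circleMap 0 1 p.1 • p.2) ?_ ?_
    · have := continuous_circleMap 0 1
      fun_prop
    · rintro ⟨θ, w⟩ ⟨-, hw⟩
      exact hz (hmem θ w hw)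
  have hint : Integrable (Function.uncurry fun (θ : ℝ) (w : EuclideanSpace ℂ (Fin d)) =>
      g (z + circleMap 0 1 θ • w))
      ((volume.restrict (Set.Ioc 0 (2 * Real.pi))).prod (volume.restrict B)) := by
    rw [Measure.prod_restrict]
    exact (hc.integrableOn_compact (isCompact_Icc.prod (isCompact_closedBall _ _))).mono_set
      (Set.prod_mono Set.Ioc_subset_Icc_self le_rfl)
  have hswap := integral_integral_swap hint
  -- rotation invariance of Lebesgue measure
  have hrot : ∀ θ : ℝ, ∫ w in B, g (z + circleMap 0 1 θ • w) = ∫ w in B, g (z + w) := by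
    intro θ
    let c : Circle := Circle.exp θ
    have hcc : circleMap 0 1 θ = (c : ℂ) := by simp [c, circleMap, Circle.coe_exp]
    let e : EuclideanSpace ℂ (Fin d) ≃ₗᵢ[ℝ] EuclideanSpace ℂ (Fin d) :=
      { toLinearEquiv := ((LinearEquiv.smulOfUnit (R := ℂ) (M := EuclideanSpace ℂ (Fin d))
          (Circle.toUnits c))).restrictScalars ℝ
        norm_map' := by
          intro x
          change ‖(c : ℂ) • x‖ = ‖x‖
          rw [norm_smul, Circle.norm_coe, one_mul] }
    have he : ∀ x, e x = (c : ℂ) • x := fun x => rfl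
    have hmp := e.measurePreserving
    have := hmp.setIntegral_preimage_emb (e.toHomeomorph.measurableEmbedding)
      (fun w => g (z + w)) B
    have hpre : (⇑e) ⁻¹' B = B := by
      ext x
      simp [B]
    rw [hpre] at this
    simpa [he, hcc] using this
  have hcirc : ∀ w ∈ B, ∫ θ in Set.Ioc 0 (2 * Real.pi), g (z + circleMap 0 1 θ • w)
      = (2 * Real.pi : ℝ) • g z := by
    intro w hw
    have hd : DiffContOnCl ℂ (fun ζ : ℂ => g (z + ζ • w)) (ball 0 |1|) := by
      apply DifferentiableOn.diffContOnCl
      intro ζ hζ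
      have hζ' : z + ζ • w ∈ U := by
        apply hz
        rw [abs_one, closure_ball _ one_ne_zero] at hζ
        simp only [mem_closedBall, dist_zero_right, B] at hζ hw
        simp only [mem_closedBall, dist_self_add_left, norm_smul]
        nlinarith [norm_nonneg w, norm_nonneg ζ]
      have h1 : DifferentiableAt ℂ g (z + ζ • w) := hg.differentiableAt (hU.mem_nhds hζ')
      have h2 : DifferentiableAt ℂ (fun ζ : ℂ => z + ζ • w) ζ := by fun_prop
      exact (h1.comp ζ h2).differentiableWithinAt
    have := hd.circleAverage
    rw [Real.circleAverage_def, intervalIntegral.integral_of_le (by positivity)] at this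
    have h2 : (2 * Real.pi) ≠ 0 := by positivity
    rw [inv_smul_eq_iff₀ h2] at this
    simpa using this
  simp_rw [hrot] at hswap
  rw [setIntegral_congr_fun measurableSet_closedBall hcirc] at hswap
  simp only [integral_const, measureReal_restrict_apply_univ, smul_smul] at hswap
  have h0 : (Real.pi : ℂ) ≠ 0 := by exact_mod_cast Real.pi_ne_zero
  simp [measureReal_def, Complex.real_smul] at hswap
  rw [ENNReal.toReal_ofReal (by positivity)] at hswap
  have h3 : ((2:ℂ) * Real.pi) ≠ 0 := by simp [h0]
  apply mul_left_cancel₀ h3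
  rw [measureReal_def]
  linear_combination hswap

theorem smul_restrict_le_bergmanMeasure (d n : ℕ) {R : ℝ} (hR0 : 0 ≤ R) (hR : R < 1) :
    ∃ δ : ℝ≥0∞, δ ≠ 0 ∧ δ ≠ ∞ ∧
      δ • volume.restrict (closedBall (0 : EuclideanSpace ℂ (Fin d)) R) ≤ bergmanMeasure d n := by
  refine ⟨ENNReal.ofReal ((n.factorial : ℝ) / ((n - d).factorial * Real.pi ^ d) *
    (1 - R ^ 2) ^ (n - d)), ?_, ENNReal.ofReal_ne_top, ?_⟩
  · have : 0 < 1 - R ^ 2 := by nlinarith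
    simp only [ne_eq, ENNReal.ofReal_eq_zero, not_le]
    positivity
  · rw [← withDensity_const]
    rw [bergmanMeasure, ← Measure.restrict_restrict_of_subset
      (closedBall_subset_ball hR : closedBall (0 : EuclideanSpace ℂ (Fin d)) R ⊆ ball 0 1)]
    rw [← restrict_withDensity measurableSet_closedBall]
    refine le_trans ?_ (Measure.restrict_le_self (s := closedBall 0 R))
    rw [restrict_withDensity measurableSet_closedBall, restrict_withDensity measurableSet_closedBall]
    apply withDensity_mono
    filter_upwards [ae_restrict_mem measurableSet_closedBall] with z hz
    simp only [mem_closedBall, dist_zero_right] at hz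
    apply ENNReal.ofReal_le_ofReal
    have h1 : 0 ≤ 1 - R ^ 2 := by nlinarith
    have h2 : 1 - R ^ 2 ≤ 1 - ‖z‖ ^ 2 := by nlinarith [norm_nonneg z]
    gcongr

theorem bergman_eval_bound (d n : ℕ) {ρ : ℝ} (h0 : 0 ≤ ρ) (h1 : ρ < 1) :
    ∃ C : ℝ, 0 ≤ C ∧ ∀ g : EuclideanSpace ℂ (Fin d) → ℂ, DifferentiableOn ℂ g (ball 0 1) →
      MemLp g 2 (bergmanMeasure d n) → ∀ z ∈ closedBall (0 : EuclideanSpace ℂ (Fin d)) ρ,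
        ‖g z‖ ≤ C * (eLpNorm g 2 (bergmanMeasure d n)).toReal := by
  set r := (1 - ρ) / 2 with hr
  have hrpos : 0 < r := by rw [hr]; linarith
  obtain ⟨δ, hδ0, hδt, hδ⟩ := smul_restrict_le_bergmanMeasure d n (R := (1 + ρ) / 2)
    (by linarith) (by linarith)
  set V := volume (closedBall (0 : EuclideanSpace ℂ (Fin d)) r) with hV
  have hV0 : V ≠ 0 := (measure_closedBall_pos _ _ hrpos).ne'
  have hVt : V ≠ ∞ := measure_closedBall_lt_top.ne
  set M := bergmanMeasure d n Set.univ ^ (1 / (1 : ℝ≥0∞).toReal - 1 / (2 : ℝ≥0∞).toReal) with hM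
  have hMt : M ≠ ∞ := ENNReal.rpow_ne_top_of_nonneg (by norm_num) (measure_ne_top _ _)
  refine ⟨(V⁻¹ * δ⁻¹ * M).toReal, ENNReal.toReal_nonneg, fun g hg hgL z hz => ?_⟩
  have hsub : closedBall z r ⊆ closedBall 0 ((1 + ρ) / 2) := by
    apply closedBall_subset_closedBall'
    rw [mem_closedBall] at hz
    rw [hr]; linarith
  have hsub1 : closedBall z r ⊆ ball 0 1 := hsub.trans (closedBall_subset_ball (by linarith))
  have key : V * ‖g z‖ₑ ≤ δ⁻¹ * (eLpNorm g 2 (bergmanMeasure d n) * M) := by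
    have hm := holo_mean isOpen_ball hg hsub1
    calc V * ‖g z‖ₑ = ‖((volume.real (closedBall (0 : EuclideanSpace ℂ (Fin d)) r) : ℂ) * g z)‖ₑ := by
          rw [enorm_mul]
          congr 1
          rw [measureReal_def, ← ofReal_norm, Complex.norm_real, Real.norm_eq_abs,
            abs_of_nonneg ENNReal.toReal_nonneg, ENNReal.ofReal_toReal hVt]
      _ ≤ ∫⁻ w in closedBall (0 : EuclideanSpace ℂ (Fin d)) r, ‖g (z + w)‖ₑ := by
          rw [← hm]; exact enorm_integral_le_lintegral_enorm _
      _ = ∫⁻ w in closedBall z r, ‖g w‖ₑ := by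
          have := (measurePreserving_add_left volume z).setLIntegral_comp_preimage_emb
            (measurableEmbedding_addLeft z) (fun w => ‖g w‖ₑ) (closedBall z r)
          simpa using this
      _ ≤ ∫⁻ w in closedBall 0 ((1 + ρ) / 2), ‖g w‖ₑ := lintegral_mono_set hsub
      _ = δ⁻¹ * ∫⁻ w, ‖g w‖ₑ ∂(δ • volume.restrict (closedBall 0 ((1 + ρ) / 2))) := by
          rw [lintegral_smul_measure, smul_eq_mul, ← mul_assoc, ENNReal.inv_mul_cancel hδ0 hδt,
            one_mul]
      _ ≤ δ⁻¹ * ∫⁻ w, ‖g w‖ₑ ∂(bergmanMeasure d n) := by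
          gcongr
      _ = δ⁻¹ * eLpNorm g 1 (bergmanMeasure d n) := by rw [eLpNorm_one_eq_lintegral_enorm]
      _ ≤ _ := by
          gcongr
          exact eLpNorm_le_eLpNorm_mul_rpow_measure_univ (by norm_num) hgL.1
  have key2 : ‖g z‖ₑ ≤ (V⁻¹ * δ⁻¹ * M) * eLpNorm g 2 (bergmanMeasure d n) := by
    calc ‖g z‖ₑ = V⁻¹ * (V * ‖g z‖ₑ) := by
          rw [← mul_assoc, ENNReal.inv_mul_cancel hV0 hVt, one_mul]
      _ ≤ V⁻¹ * (δ⁻¹ * (eLpNorm g 2 (bergmanMeasure d n) * M)) := by gcongr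
      _ = _ := by ring
  rw [← ENNReal.toReal_mul, ← toReal_enorm]
  exact ENNReal.toReal_mono (ENNReal.mul_ne_top (ENNReal.mul_ne_top (ENNReal.mul_ne_top
    (ENNReal.inv_ne_top.2 hV0) (ENNReal.inv_ne_top.2 hδ0)) hMt) hgL.2.ne) key2

theorem bergman_fderiv_bound (d n : ℕ) {ρ : ℝ} (h0 : 0 ≤ ρ) (h1 : ρ < 1) :
    ∃ C : ℝ, 0 ≤ C ∧ ∀ g : EuclideanSpace ℂ (Fin d) → ℂ, DifferentiableOn ℂ g (ball 0 1) →
      MemLp g 2 (bergmanMeasure d n) → ∀ z ∈ closedBall (0 : EuclideanSpace ℂ (Fin d)) ρ,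
        ‖fderiv ℂ g z‖ ≤ C * (eLpNorm g 2 (bergmanMeasure d n)).toReal := by
  obtain ⟨C, hC, h⟩ := bergman_eval_bound d n (ρ := (1 + ρ) / 2) (by linarith) (by linarith)
  have hr : 0 < (1 - ρ) / 2 := by linarith
  refine ⟨2 * C / ((1 - ρ) / 2), by positivity, fun g hg hgL z hz => ?_⟩
  have hsub : ball z ((1 - ρ) / 2) ⊆ closedBall 0 ((1 + ρ) / 2) := by
    refine ball_subset_closedBall.trans (closedBall_subset_closedBall' ?_)
    rw [mem_closedBall] at hz
    linarith
  have hz' : z ∈ closedBall (0 : EuclideanSpace ℂ (Fin d)) ((1 + ρ) / 2) :=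
    closedBall_subset_closedBall (by linarith) hz
  have := Complex.norm_fderiv_le_div_of_mapsTo_ball (c := z) (f := g)
    (R₂ := 2 * C * (eLpNorm g 2 (bergmanMeasure d n)).toReal)
    (hg.mono (hsub.trans (closedBall_subset_ball (by linarith)))) ?_ hr
  · refine this.trans (le_of_eq ?_)
    ring
  · intro w hw
    rw [mem_closedBall, dist_eq_norm]
    have a := h g hg hgL w (hsub hw)
    have b := h g hg hgL z hz'
    have c := norm_sub_le (g w) (g z)
    linarith

/-- `H_n` as a subspace of `L²(dV_n)`: the (classes of) holomorphic functions on the open unit ball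
of `ℂ^d` that are square-integrable. -/
noncomputable def bergmanSubspace (d n : ℕ) : Submodule ℂ (Lp ℂ 2 (bergmanMeasure d n)) where
  carrier := {f | ∃ g : EuclideanSpace ℂ (Fin d) → ℂ,
    DifferentiableOn ℂ g (ball 0 1) ∧ f =ᵐ[bergmanMeasure d n] g}
  zero_mem' := ⟨0, differentiableOn_const 0, Lp.coeFn_zero _ _ _⟩
  add_mem' := by
    rintro f f' ⟨g, hg, hfg⟩ ⟨g', hg', hfg'⟩
    exact ⟨g + g', hg.add hg', (Lp.coeFn_add f f').trans (hfg.add hfg')⟩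
  smul_mem' := by
    rintro c f ⟨g, hg, hfg⟩
    exact ⟨c • g, hg.const_smul c, (Lp.coeFn_smul c f).trans (hfg.const_smul c)⟩

theorem exists_mem_closedBall_of_mem_ball {E : Type*} [NormedAddCommGroup E] {z : E}
    (hz : z ∈ ball (0 : E) 1) :
    ∃ ρ : ℝ, 0 ≤ ρ ∧ ρ < 1 ∧ closedBall (0 : E) ρ ∈ 𝓝 z := by
  rw [mem_ball, dist_zero_right] at hz
  refine ⟨(1 + ‖z‖) / 2, by positivity, by linarith, ?_⟩
  apply closedBall_mem_nhds_of_mem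
  rw [mem_ball, dist_zero_right]
  linarith

theorem isClosed_bergmanSubspace (d n : ℕ) :
    IsClosed (bergmanSubspace d n : Set (Lp ℂ 2 (bergmanMeasure d n))) := by
  apply IsSeqClosed.isClosed
  intro f f₀ hf hlim
  choose g hg hfg using hf
  have hLp : ∀ k, MemLp (g k) 2 (bergmanMeasure d n) := fun k => (memLp_congr_ae (hfg k)).1
    (Lp.memLp (f k))
  have hnorm : ∀ k l, (eLpNorm (g k - g l) 2 (bergmanMeasure d n)).toReal = dist (f k) (f l) := by
    intro k l
    rw [Lp.dist_def, eLpNorm_congr_ae ((hfg k).sub (hfg l))]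
  have hcau := hlim.cauchySeq
  rw [Metric.cauchySeq_iff] at hcau
  have hU : ∀ ρ : ℝ, 0 ≤ ρ → ρ < 1 →
      UniformCauchySeqOn g atTop (closedBall (0 : EuclideanSpace ℂ (Fin d)) ρ) := by
    intro ρ h0 h1
    obtain ⟨C, hC, h⟩ := bergman_eval_bound d n h0 h1
    rw [Metric.uniformCauchySeqOn_iff]
    intro ε hε
    obtain ⟨N, hN⟩ := hcau (ε / (C + 1)) (by positivity)
    refine ⟨N, fun k hk l hl z hz => ?_⟩
    have a := h (g k - g l) ((hg k).sub (hg l)) ((hLp k).sub (hLp l)) z hz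
    rw [hnorm] at a
    have b := hN k hk l hl
    rw [lt_div_iff₀ (by positivity)] at b
    rw [dist_eq_norm]
    have c : (0:ℝ) ≤ dist (f k) (f l) := dist_nonneg
    simp only [Pi.sub_apply] at a
    nlinarith
  have hU' : ∀ ρ : ℝ, 0 ≤ ρ → ρ < 1 →
      UniformCauchySeqOn (fun k => fderiv ℂ (g k)) atTop
        (closedBall (0 : EuclideanSpace ℂ (Fin d)) ρ) := by
    intro ρ h0 h1
    obtain ⟨C, hC, h⟩ := bergman_fderiv_bound d n h0 h1
    rw [Metric.uniformCauchySeqOn_iff]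
    intro ε hε
    obtain ⟨N, hN⟩ := hcau (ε / (C + 1)) (by positivity)
    refine ⟨N, fun k hk l hl z hz => ?_⟩
    have a := h (g k - g l) ((hg k).sub (hg l)) ((hLp k).sub (hLp l)) z hz
    have hz1 : ball (0 : EuclideanSpace ℂ (Fin d)) 1 ∈ 𝓝 z :=
      isOpen_ball.mem_nhds (closedBall_subset_ball h1 hz)
    rw [hnorm, fderiv_sub ((hg k).differentiableAt hz1) ((hg l).differentiableAt hz1)] at a
    have b := hN k hk l hl
    rw [lt_div_iff₀ (by positivity)] at b
    rw [dist_eq_norm]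
    have c : (0:ℝ) ≤ dist (f k) (f l) := dist_nonneg
    nlinarith
  have hpt : ∀ z : EuclideanSpace ℂ (Fin d), ∃ w : ℂ, z ∈ ball 0 1 →
      Tendsto (fun k => g k z) atTop (𝓝 w) := by
    intro z
    by_cases hz : z ∈ ball 0 1
    · obtain ⟨ρ, h0, h1, h2⟩ := exists_mem_closedBall_of_mem_ball hz
      obtain ⟨w, hw⟩ := cauchySeq_tendsto_of_complete ((hU ρ h0 h1).cauchySeq (mem_of_mem_nhds h2))
      exact ⟨w, fun _ => hw⟩
    · exact ⟨0, fun h => absurd h hz⟩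
  have hpt' : ∀ z : EuclideanSpace ℂ (Fin d), ∃ w : EuclideanSpace ℂ (Fin d) →L[ℂ] ℂ,
      z ∈ ball 0 1 → Tendsto (fun k => fderiv ℂ (g k) z) atTop (𝓝 w) := by
    intro z
    by_cases hz : z ∈ ball 0 1
    · obtain ⟨ρ, h0, h1, h2⟩ := exists_mem_closedBall_of_mem_ball hz
      obtain ⟨w, hw⟩ := cauchySeq_tendsto_of_complete ((hU' ρ h0 h1).cauchySeq (mem_of_mem_nhds h2))
      exact ⟨w, fun _ => hw⟩
    · exact ⟨0, fun h => absurd h hz⟩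
  choose G hG using hpt
  choose G' hG' using hpt'
  have hloc : TendstoLocallyUniformlyOn (fun k => fderiv ℂ (g k)) G' atTop (ball 0 1) := by
    intro u hu z hz
    obtain ⟨ρ, h0, h1, h2⟩ := exists_mem_closedBall_of_mem_ball hz
    exact ⟨_, mem_nhdsWithin_of_mem_nhds h2, (hU' ρ h0 h1).tendstoUniformlyOn_of_tendsto
      (fun w hw => hG' w (closedBall_subset_ball h1 hw)) u hu⟩
  refine ⟨G, fun z hz => ?_, ?_⟩
  · exact (hasFDerivAt_of_tendstoLocallyUniformlyOn isOpen_ball hloc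
      (fun k w hw => ((hg k).differentiableAt (isOpen_ball.mem_nhds hw)).hasFDerivAt)
      (fun w hw => hG w hw) hz).differentiableAt.differentiableWithinAt
  · obtain ⟨ns, hns, hae⟩ := (tendstoInMeasure_of_tendsto_Lp hlim).exists_seq_tendsto_ae
    have hball : ∀ᵐ z ∂(bergmanMeasure d n), z ∈ ball (0 : EuclideanSpace ℂ (Fin d)) 1 :=
      (withDensity_absolutelyContinuous _ _).ae_le (ae_restrict_mem measurableSet_ball)
    filter_upwards [hae, hball, ae_all_iff.2 hfg] with z h1 h2 h3
    have h4 := (hG z h2).comp hns.tendsto_atTop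
    refine tendsto_nhds_unique h1 (h4.congr fun k => ?_)
    simp [h3]

instance (d n : ℕ) : CompleteSpace (bergmanSubspace d n) :=
  (isClosed_bergmanSubspace d n).completeSpace_coe

/-- The Hilbert space `H_n`, with the inner product of `L²(dV_n)`. -/
def BergmanSpace (d n : ℕ) : Type :=
  bergmanSubspace d n

noncomputable instance (d n : ℕ) : NormedAddCommGroup (BergmanSpace d n) :=
  inferInstanceAs (NormedAddCommGroup (bergmanSubspace d n))

noncomputable instance (d n : ℕ) : InnerProductSpace ℂ (BergmanSpace d n) :=
  inferInstanceAs (InnerProductSpace ℂ (bergmanSubspace d n))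

instance (d n : ℕ) : CompleteSpace (BergmanSpace d n) :=
  inferInstanceAs (CompleteSpace (bergmanSubspace d n))

/-- The inclusion `H_n → L²(dV_n)`. -/
noncomputable def bergmanInclusion (d n : ℕ) :
    BergmanSpace d n →L[ℂ] Lp ℂ 2 (bergmanMeasure d n) :=
  (bergmanSubspace d n).subtypeL

/-- The orthogonal projection `P_n : L²(dV_n) → H_n`. -/
noncomputable def bergmanProjection (d n : ℕ) :
    Lp ℂ 2 (bergmanMeasure d n) →L[ℂ] BergmanSpace d n :=
  (bergmanSubspace d n).orthogonalProjectionOnto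

/-! ## The orthonormal basis and Toeplitz operators -/

theorem ae_mem_ball_bergmanMeasure (d n : ℕ) :
    ∀ᵐ z ∂(bergmanMeasure d n), z ∈ ball (0 : EuclideanSpace ℂ (Fin d)) 1 :=
  (withDensity_absolutelyContinuous _ _).ae_le (ae_restrict_mem measurableSet_ball)

/-- `e_{k,n}(z) = ((|k| + n)! / (k! n!))^{1/2} z^k` for a multi-index `k`. -/
noncomputable def monomialFun (d n : ℕ) (k : Fin d → ℕ) (z : EuclideanSpace ℂ (Fin d)) : ℂ :=
  (Real.sqrt (((∑ i, k i) + n).factorial / ((∏ i, (k i).factorial) * n.factorial)) : ℂ) *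
    ∏ i, z i ^ k i

theorem differentiable_monomialFun (d n : ℕ) (k : Fin d → ℕ) :
    Differentiable ℂ (monomialFun d n k) := by
  unfold monomialFun
  fun_prop

theorem memLp_monomialFun (d n : ℕ) (k : Fin d → ℕ) :
    MemLp (monomialFun d n k) 2 (bergmanMeasure d n) := by
  have hc := (differentiable_monomialFun d n k).continuous
  obtain ⟨C, hC⟩ := (isCompact_closedBall (0 : EuclideanSpace ℂ (Fin d)) 1).exists_bound_of_continuousOn
    hc.continuousOn
  refine MemLp.of_bound hc.aestronglyMeasurable C ?_
  filter_upwards [ae_mem_ball_bergmanMeasure d n] with z hz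
  exact hC z (ball_subset_closedBall hz)

/-- `e_{k,n}` as an element of `H_n`. -/
noncomputable def bergmanMonomial (d n : ℕ) (k : Fin d → ℕ) : BergmanSpace d n :=
  ⟨(memLp_monomialFun d n k).toLp, monomialFun d n k,
    (differentiable_monomialFun d n k).differentiableOn, MemLp.coeFn_toLp _⟩

/-- A continuous function on the closed unit ball, extended by `0` to all of `ℂ^d`. -/
noncomputable def extendZero {d : ℕ} (φ : C(closedBall (0 : EuclideanSpace ℂ (Fin d)) 1, ℂ)) :
    EuclideanSpace ℂ (Fin d) → ℂ :=
  Function.extend Subtype.val φ 0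

theorem norm_extendZero_le {d : ℕ} (φ : C(closedBall (0 : EuclideanSpace ℂ (Fin d)) 1, ℂ))
    (z : EuclideanSpace ℂ (Fin d)) : ‖extendZero φ z‖ ≤ ‖φ‖ := by
  by_cases hz : z ∈ closedBall (0 : EuclideanSpace ℂ (Fin d)) 1
  · have : extendZero φ z = φ ⟨z, hz⟩ :=
      Subtype.val_injective.extend_apply (⇑φ) 0 (⟨z, hz⟩ : closedBall _ 1)
    rw [this]
    exact φ.norm_coe_le_norm _
  · have : extendZero φ z = 0 :=
      Function.extend_apply' _ _ _ (by rintro ⟨w, rfl⟩; exact hz w.2)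
    rw [this, norm_zero]
    exact norm_nonneg _

theorem memLp_mul {d n : ℕ} (φ : C(closedBall (0 : EuclideanSpace ℂ (Fin d)) 1, ℂ))
    (f : Lp ℂ 2 (bergmanMeasure d n)) :
    MemLp (fun z => extendZero φ z * f z) 2 (bergmanMeasure d n) := by
  have hm : Measurable (extendZero φ) :=
    (MeasurableEmbedding.subtype_coe measurableSet_closedBall).measurable_extend
      φ.continuous.measurable measurable_const
  refine MemLp.of_le_mul (c := ‖φ‖) (Lp.memLp f)
    (hm.aestronglyMeasurable.mul (Lp.aestronglyMeasurable f)) (Eventually.of_forall fun z => ?_)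
  rw [norm_mul]
  gcongr
  exact norm_extendZero_le φ z

/-- Multiplication by `φ` on `L²(dV_n)`. -/
noncomputable def mulOperator {d : ℕ} (n : ℕ)
    (φ : C(closedBall (0 : EuclideanSpace ℂ (Fin d)) 1, ℂ)) :
    Lp ℂ 2 (bergmanMeasure d n) →L[ℂ] Lp ℂ 2 (bergmanMeasure d n) :=
  LinearMap.mkContinuous
    { toFun := fun f => (memLp_mul φ f).toLp
      map_add' := by
        intro f g
        rw [← MemLp.toLp_add, MemLp.toLp_eq_toLp_iff]
        filter_upwards [Lp.coeFn_add f g] with z hz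
        rw [hz, Pi.add_apply, Pi.add_apply, mul_add]
      map_smul' := by
        intro c f
        rw [RingHom.id_apply, ← MemLp.toLp_const_smul, MemLp.toLp_eq_toLp_iff]
        filter_upwards [Lp.coeFn_smul c f] with z hz
        rw [hz, Pi.smul_apply, Pi.smul_apply, smul_eq_mul, smul_eq_mul, mul_left_comm] }
    ‖φ‖ (by
      intro f
      refine Lp.norm_le_mul_norm_of_ae_le_mul ?_
      filter_upwards [(memLp_mul φ f).coeFn_toLp] with z hz
      simp only [LinearMap.coe_mk, AddHom.coe_mk, hz, norm_mul]
      gcongr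
      exact norm_extendZero_le φ z)

/-- The Toeplitz operator `T_φ f = P_n(φ f)` on `H_n`. -/
noncomputable def toeplitz {d : ℕ} (n : ℕ)
    (φ : C(closedBall (0 : EuclideanSpace ℂ (Fin d)) 1, ℂ)) :
    BergmanSpace d n →L[ℂ] BergmanSpace d n :=
  bergmanProjection d n ∘L mulOperator n φ ∘L bergmanInclusion d n

/-- The Toeplitz algebra `T_n`: the C*-algebra generated by the Toeplitz operators on `H_n`. -/
noncomputable def toeplitzAlgebra (d n : ℕ) :
    StarSubalgebra ℂ (BergmanSpace d n →L[ℂ] BergmanSpace d n) :=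
  (StarAlgebra.adjoin ℂ (Set.range (toeplitz (d := d) n))).topologicalClosure

/-! ## Splittings of the symbol map -/

/-- A real-valued continuous function on the sphere `S^{2d-1}`, regarded as complex-valued. -/
noncomputable def complexify (d : ℕ) :
    C(sphere (0 : EuclideanSpace ℂ (Fin d)) 1, ℝ) →ₗ[ℝ]
      C(sphere (0 : EuclideanSpace ℂ (Fin d)) 1, ℂ) :=
  (Complex.ofRealCLM.compLeftContinuous ℝ (sphere (0 : EuclideanSpace ℂ (Fin d)) 1)).toLinearMap

/-- `T` has symbol `f`: `T = T_φ + K` with `K` compact and `φ` restricting to `f` on the sphere. -/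
def HasSymbol {d n : ℕ} (T : BergmanSpace d n →L[ℂ] BergmanSpace d n)
    (f : C(sphere (0 : EuclideanSpace ℂ (Fin d)) 1, ℂ)) : Prop :=
  ∃ φ : C(closedBall (0 : EuclideanSpace ℂ (Fin d)) 1, ℂ),
    (∀ x : sphere (0 : EuclideanSpace ℂ (Fin d)) 1,
      φ ⟨x, sphere_subset_closedBall x.2⟩ = f x) ∧
    IsCompactOperator (T - toeplitz n φ)

/-- `σ : C(S^{2d-1}) → T_n` is a unital positive linear splitting of the symbol map
`T_φ + K ↦ φ|_{S^{2d-1}}`. -/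
structure IsPositiveUnitalSplitting {d n : ℕ}
    (σ : C(sphere (0 : EuclideanSpace ℂ (Fin d)) 1, ℂ) →ₗ[ℂ] toeplitzAlgebra d n) : Prop where
  map_one : σ 1 = 1
  positive : ∀ f : C(sphere (0 : EuclideanSpace ℂ (Fin d)) 1, ℝ), (∀ x, 0 ≤ f x) →
    (σ (complexify d f) : BergmanSpace d n →L[ℂ] BergmanSpace d n).IsPositive
  hasSymbol : ∀ f : C(sphere (0 : EuclideanSpace ℂ (Fin d)) 1, ℂ),
    HasSymbol (σ f : BergmanSpace d n →L[ℂ] BergmanSpace d n) f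

/-! ## The Lipschitz spaces and seminorms -/

/-- The real-valued Lipschitz functions on `S^{2d-1}` (for the Euclidean distance). -/
def lipFunctions (d : ℕ) : Submodule ℝ C(sphere (0 : EuclideanSpace ℂ (Fin d)) 1, ℝ) where
  carrier := {f | ∃ C : ℝ≥0, LipschitzWith C f}
  zero_mem' := ⟨0, LipschitzWith.const 0⟩
  add_mem' := by
    rintro f g ⟨C, hf⟩ ⟨D, hg⟩
    exact ⟨C + D, hf.add hg⟩
  smul_mem' := by
    rintro c f ⟨C, hf⟩
    refine ⟨‖c‖₊ * C, ?_⟩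
    exact (lipschitzWith_smul c).comp hf

/-- The Lipschitz constant `sup_{x ≠ y} |f(x) - f(y)| / d(x, y)`
(pairs with `x = y` contribute `0`). -/
noncomputable def lipConstant {d : ℕ}
    (f : C(sphere (0 : EuclideanSpace ℂ (Fin d)) 1, ℝ)) : ℝ :=
  ⨆ p : sphere (0 : EuclideanSpace ℂ (Fin d)) 1 × sphere (0 : EuclideanSpace ℂ (Fin d)) 1,
    |f p.1 - f p.2| / dist p.1 p.2

/-- `⟨T e_i | e_j⟩` (linear in `T e_i`), where the enumeration of the basis is
`e_{i+1} = e_{ν(i), n}` for `i = 0, 1, 2, …`. -/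
noncomputable def matrixCoeff {d n : ℕ} (ν : ℕ ≃ (Fin d → ℕ))
    (T : BergmanSpace d n →L[ℂ] BergmanSpace d n) (i j : ℕ) : ℂ :=
  inner ℂ (bergmanMonomial d n (ν j)) (T (bergmanMonomial d n (ν i)))

/-- `(i + j)^{n+2} |⟨T e_i | e_j⟩|`, with basis indices starting from `1`. -/
noncomputable def weightedCoeff {d n : ℕ} (ν : ℕ ≃ (Fin d → ℕ))
    (T : BergmanSpace d n →L[ℂ] BergmanSpace d n) (p : ℕ × ℕ) : ℝ :=
  (((p.1 + 1) + (p.2 + 1) : ℕ) : ℝ) ^ (n + 2) * ‖matrixCoeff ν T p.1 p.2‖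

/-- `Lip(K(H_n))`: the self-adjoint compact operators with real matrix entries for which
`sup_{i,j} (i + j)^{n+2} |⟨T e_i | e_j⟩|` is finite. -/
noncomputable def lipCompacts {d : ℕ} (n : ℕ) (ν : ℕ ≃ (Fin d → ℕ)) :
    Submodule ℝ (BergmanSpace d n →L[ℂ] BergmanSpace d n) where
  carrier := {T | IsCompactOperator T ∧ IsSelfAdjoint T ∧ (∀ i j, (matrixCoeff ν T i j).im = 0) ∧
    BddAbove (Set.range (weightedCoeff ν T))}
  zero_mem' := by
    refine ⟨isCompactOperator_zero, IsSelfAdjoint.zero _, ?_, ⟨0, ?_⟩⟩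
    · simp [matrixCoeff]
    · rintro _ ⟨p, rfl⟩
      simp [weightedCoeff, matrixCoeff]
  add_mem' := by
    rintro S T ⟨h1, h2, h3, C, hC⟩ ⟨k1, k2, k3, D, hD⟩
    have hadd : ∀ i j, matrixCoeff ν (S + T) i j = matrixCoeff ν S i j + matrixCoeff ν T i j := by
      intro i j
      simp [matrixCoeff]
    refine ⟨h1.add k1, h2.add k2, ?_, ⟨C + D, ?_⟩⟩
    · intro i j
      rw [hadd, Complex.add_im, h3, k3, add_zero]
    · rintro _ ⟨p, rfl⟩
      have a := hC ⟨p, rfl⟩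
      have b := hD ⟨p, rfl⟩
      refine le_trans ?_ (add_le_add a b)
      simp only [weightedCoeff, hadd]
      rw [← mul_add]
      gcongr
      exact norm_add_le _ _
  smul_mem' := by
    rintro c T ⟨h1, h2, h3, C, hC⟩
    have hsm : ∀ i j, matrixCoeff ν (c • T) i j = (c : ℂ) * matrixCoeff ν T i j := by
      intro i j
      have : c • T = (c : ℂ) • T := rfl
      rw [this]
      simp [matrixCoeff]
    refine ⟨h1.smul c, (IsSelfAdjoint.all c).smul h2, ?_, ⟨|c| * C, ?_⟩⟩
    · intro i j
      simp [hsm, h3]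
    · rintro _ ⟨p, rfl⟩
      have a := mul_le_mul_of_nonneg_left (hC ⟨p, rfl⟩) (abs_nonneg c)
      refine le_trans (le_of_eq ?_) a
      simp only [weightedCoeff, hsm, norm_mul, Complex.norm_real, Real.norm_eq_abs]
      ring

/-- `L̃_n(K) = sup_{i,j} (i + j)^{n+2} |⟨K e_i | e_j⟩|`. -/
noncomputable def lipNormCompacts {d n : ℕ} (ν : ℕ ≃ (Fin d → ℕ))
    (K : BergmanSpace d n →L[ℂ] BergmanSpace d n) : ℝ :=
  ⨆ p : ℕ × ℕ, weightedCoeff ν K p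

/-- `f ↦ σ(f)` on real-valued functions, as a real-linear map into the operators on `H_n`. -/
noncomputable def realLift {d n : ℕ}
    (σ : C(sphere (0 : EuclideanSpace ℂ (Fin d)) 1, ℂ) →ₗ[ℂ] toeplitzAlgebra d n) :
    C(sphere (0 : EuclideanSpace ℂ (Fin d)) 1, ℝ) →ₗ[ℝ]
      (BergmanSpace d n →L[ℂ] BergmanSpace d n) where
  toFun f := (σ (complexify d f) : BergmanSpace d n →L[ℂ] BergmanSpace d n)
  map_add' f g := by simp
  map_smul' c f := by
    have : complexify d (c • f) = (c : ℂ) • complexify d f := by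
      rw [map_smul]
      rfl
    rw [this, map_smul]
    rfl

/-- The operators `σ(f)`, `f` a real-valued Lipschitz function on `S^{2d-1}`. -/
noncomputable def lipSection {d n : ℕ}
    (σ : C(sphere (0 : EuclideanSpace ℂ (Fin d)) 1, ℂ) →ₗ[ℂ] toeplitzAlgebra d n) :
    Submodule ℝ (BergmanSpace d n →L[ℂ] BergmanSpace d n) :=
  (lipFunctions d).map (realLift σ)

/-- `Lip(T_n)`, the sum of `Lip(K(H_n))` and `{σ(f)}`; its order is that of self-adjoint
operators. -/
noncomputable def lipToeplitz {d n : ℕ} (ν : ℕ ≃ (Fin d → ℕ))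
    (σ : C(sphere (0 : EuclideanSpace ℂ (Fin d)) 1, ℂ) →ₗ[ℂ] toeplitzAlgebra d n) :
    Submodule ℝ (BergmanSpace d n →L[ℂ] BergmanSpace d n) :=
  lipCompacts n ν ⊔ lipSection σ

/-!
The Lip-norm property rests on Rieffel's criterion (`stateMetric_topology_eq`): if `L` vanishes on
the order unit and its unit ball is totally bounded modulo the multiples of the unit, then `ρ_L`
induces the weak-* topology on the states. An element of the unit ball is `σ(f) + K` with
`Lip(f) ≤ 1` and `L̃_n(K) ≤ 1`. After subtracting the scalar `f(x₀)` the functions `f` are totally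
bounded in the uniform norm by the Arzelà–Ascoli theorem (`exists_finite_net_lipFunctions`), and `σ`,
being positive and unital, carries `|g| ≤ ε` to `-ε ≤ σ(g) ≤ ε`. For the compact part, the weights
`(i + j)^{-(n + 2)}` are summable over pairs of indices since `n + 2 ≥ 3`. The operator norm is at
most the sum of the moduli of the matrix entries, so up to a uniformly small error only finitely many
bounded entries matter (`exists_finite_net_lipCompacts`).

The same summability writes `K` as a norm-convergent sum of multiples of the rank-one operators
`e_k ⊗ e_l`, and these lie in the Toeplitz algebra: `T_{1 - |z|²}` is diagonal in the monomial basis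
and its largest eigenvalue occurs only at the constants, so the powers of a multiple of it converge
to the projection onto the constants. Multiplying by `T_{z^k}` on the left and `T_{z^l}^*` on the
right gives the others (`rankOne_mem_toeplitzAlgebra`).

That the sum of the two spaces is direct, and hence that `L` is well defined, follows from the fact
that a compact Toeplitz operator has zero boundary symbol
(`eq_zero_of_isCompactOperator_toeplitz`). At a boundary point `ζ` the normalized powers of
`(1 + ⟨z, ζ⟩) / 2` tend weakly to zero, so the quadratic form of a compact operator tends to zero
along them, whereas the quadratic form of `T_φ` tends to `φ(ζ)` because the mass concentrates at `ζ`.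

All of this uses that the normalized monomials form a Hilbert basis (`monomialBasis`). Their norms
come from comparing integrals over the ball with Gaussian integrals, orthogonality from rotations of
the coordinates, and completeness from the expansion of a holomorphic function into homogeneous
polynomials. A positive unital splitting is obtained as `f ↦ T_{Ef}`, with `E` a positive linear
extension operator from the sphere to the ball that preserves constants.
-/

/-! ### Integrals of monomials over the unit ball -/

/-- Polar coordinates: the integral of a positively homogeneous function times a radial function
splits into an integral over the unit sphere and a one-dimensional integral. -/
theorem integral_homogeneous_mul_fun_norm {E : Type*} [NormedAddCommGroup E] [NormedSpace ℝ E]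
    [MeasurableSpace E] [BorelSpace E] [FiniteDimensional ℝ E] [Nontrivial E] (μ : Measure E)
    [μ.IsAddHaarMeasure] {h : E → ℝ} {p : ℕ}
    (hh : ∀ r : ℝ, 0 < r → ∀ x, h (r • x) = r ^ p * h x) (g : ℝ → ℝ) :
    ∫ x, h x * g ‖x‖ ∂μ = (∫ y : sphere (0 : E) 1, h y ∂μ.toSphere) *
      ∫ r in Set.Ioi (0 : ℝ), r ^ (Module.finrank ℝ E - 1) * (r ^ p * g r) := by
  calc
    ∫ x, h x * g ‖x‖ ∂μ = ∫ x : ({(0)}ᶜ : Set E), h x.1 * g ‖x.1‖ ∂(μ.comap (↑)) := by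
      rw [integral_subtype_comap (measurableSet_singleton _).compl fun x ↦ h x * g ‖x‖,
        restrict_compl_singleton]
    _ = ∫ x : sphere (0 : E) 1 × Set.Ioi (0 : ℝ), h x.1 * ((x.2 : ℝ) ^ p * g x.2)
          ∂μ.toSphere.prod (.volumeIoiPow (Module.finrank ℝ E - 1)) := by
      rw [← μ.measurePreserving_homeomorphUnitSphereProd.integral_comp
        (Homeomorph.measurableEmbedding _)]
      refine integral_congr_ae (Eventually.of_forall fun x => ?_)
      have hx : 0 < ‖x.1‖ := norm_pos_iff.2 x.2
      have h1 : h x.1 = ‖x.1‖ ^ p * h (‖x.1‖⁻¹ • x.1) := by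
        rw [← hh _ hx, smul_inv_smul₀ hx.ne']
      simp only [homeomorphUnitSphereProd_apply_snd_coe, homeomorphUnitSphereProd_apply_fst_coe]
      rw [h1]
      ring
    _ = (∫ y : sphere (0 : E) 1, h y ∂μ.toSphere) *
          ∫ r : Set.Ioi (0 : ℝ), (r : ℝ) ^ p * g r ∂.volumeIoiPow (Module.finrank ℝ E - 1) :=
      integral_prod_mul (fun y : sphere (0 : E) 1 => h y)
        (fun r : Set.Ioi (0 : ℝ) => (r : ℝ) ^ p * g r)
    _ = _ := by
      congr 1
      simp only [Measure.volumeIoiPow, ENNReal.ofReal]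
      rw [integral_withDensity_eq_integral_smul,
        integral_subtype_comap measurableSet_Ioi fun a ↦
          Real.toNNReal (a ^ (Module.finrank ℝ E - 1)) • (a ^ p * g a),
        setIntegral_congr_fun measurableSet_Ioi fun x hx ↦ ?_]
      · rw [NNReal.smul_def, Real.coe_toNNReal _ (pow_nonneg hx.out.le _), smul_eq_mul]
      · exact (measurable_subtype_coe.pow_const _).real_toNNReal

theorem intervalIntegral_pow_mul_one_sub_sq_pow (N m : ℕ) :
    ∫ r in (0 : ℝ)..1, r ^ (2 * N + 1) * (1 - r ^ 2) ^ m
      = (N.factorial * m.factorial : ℝ) / (2 * (N + m + 1).factorial) := by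
  induction m generalizing N with
  | zero =>
    simp only [pow_zero, mul_one, integral_pow, Nat.factorial_succ, add_zero, Nat.factorial_zero]
    have := N.factorial_ne_zero
    push_cast
    field_simp
    simp
    ring
  | succ m ih =>
    have h1 : ∀ r : ℝ, r ^ (2 * N + 1) * (1 - r ^ 2) ^ (m + 1)
        = r ^ (2 * N + 1) * (1 - r ^ 2) ^ m - r ^ (2 * (N + 1) + 1) * (1 - r ^ 2) ^ m := by
      intro r
      ring
    simp_rw [h1]
    rw [intervalIntegral.integral_sub (Continuous.intervalIntegrable (by fun_prop) _ _)
      (Continuous.intervalIntegrable (by fun_prop) _ _), ih, ih,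
      show N + 1 + m + 1 = (N + m + 1) + 1 by ring, show N + (m + 1) + 1 = (N + m + 1) + 1 by ring,
      Nat.factorial_succ (N + m + 1), Nat.factorial_succ N, Nat.factorial_succ m]
    have := (N + m + 1).factorial_ne_zero
    push_cast
    field_simp
    ring

theorem integral_Ioi_pow_mul_exp_neg_sq (N : ℕ) :
    ∫ r in Set.Ioi (0 : ℝ), r ^ (2 * N + 1) * Real.exp (-r ^ 2) = (N.factorial : ℝ) / 2 := by
  have := integral_rpow_mul_exp_neg_rpow (p := 2) (q := ((2 * N + 1 : ℕ) : ℝ)) (by norm_num)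
    (by have : (0 : ℝ) ≤ ((2 * N + 1 : ℕ) : ℝ) := Nat.cast_nonneg _
        linarith)
  have h2 : (((2 * N + 1 : ℕ) : ℝ) + 1) / 2 = N + 1 := by push_cast; ring
  rw [h2, Real.Gamma_nat_eq_factorial] at this
  simp only [Real.rpow_natCast, Real.rpow_ofNat] at this
  rw [this]
  ring

theorem integral_complex_norm_pow_mul_exp (k : ℕ) :
    ∫ z : ℂ, ‖z‖ ^ (2 * k) * Real.exp (-‖z‖ ^ 2) = Real.pi * k.factorial := by
  have := Complex.integral_rpow_mul_exp_neg_rpow (p := 2) (q := ((2 * k : ℕ) : ℝ)) (by norm_num)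
    (by have : (0 : ℝ) ≤ ((2 * k : ℕ) : ℝ) := Nat.cast_nonneg _
        linarith)
  have h2 : (((2 * k : ℕ) : ℝ) + 2) / 2 = k + 1 := by push_cast; ring
  rw [h2, Real.Gamma_nat_eq_factorial] at this
  simp only [Real.rpow_natCast, Real.rpow_ofNat] at this
  rw [this]
  ring

/-- Gaussian moments, up to a constant `c` that compares Lebesgue measure on `EuclideanSpace` with
the product measure. -/
theorem exists_integral_monomial_mul_exp (d : ℕ) :
    ∃ c : ℝ, ∀ k : Fin d → ℕ,
      ∫ z : EuclideanSpace ℂ (Fin d), (∏ i, ‖z i‖ ^ (2 * k i)) * Real.exp (-‖z‖ ^ 2)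
        = c * ∏ i, ((k i).factorial : ℝ) := by
  let e : EuclideanSpace ℂ (Fin d) ≃L[ℝ] (Fin d → ℂ) :=
    (PiLp.continuousLinearEquiv 2 ℝ (fun _ : Fin d => ℂ))
  have hH := e.symm.isAddHaarMeasure_map (volume : Measure (Fin d → ℂ))
  have hv := Measure.isAddLeftInvariant_eq_smul (volume : Measure (EuclideanSpace ℂ (Fin d)))
    (Measure.map e.symm (volume : Measure (Fin d → ℂ)))
  generalize Measure.addHaarScalarFactor (volume : Measure (EuclideanSpace ℂ (Fin d)))
    (Measure.map e.symm (volume : Measure (Fin d → ℂ))) = a at hv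
  refine ⟨(a : ℝ) * Real.pi ^ d, fun k => ?_⟩
  rw [hv, integral_smul_nnreal_measure, show ⇑e.symm = ⇑e.symm.toHomeomorph from rfl,
    e.symm.toHomeomorph.measurableEmbedding.integral_map (μ := volume)]
  have h1 : ∀ x : Fin d → ℂ, (∏ i, ‖(e.symm.toHomeomorph x) i‖ ^ (2 * k i)) *
      Real.exp (-‖e.symm.toHomeomorph x‖ ^ 2)
      = ∏ i, (‖x i‖ ^ (2 * k i) * Real.exp (-‖x i‖ ^ 2)) := by
    intro x
    have h2 : ‖e.symm.toHomeomorph x‖ ^ 2 = ∑ i, ‖x i‖ ^ 2 := by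
      rw [EuclideanSpace.norm_sq_eq]
      rfl
    rw [h2, ← Finset.sum_neg_distrib, Real.exp_sum, ← Finset.prod_mul_distrib]
    rfl
  have h3 := integral_fintype_prod_eq_prod (𝕜 := ℝ) (μ := fun _ : Fin d => (volume : Measure ℂ))
    (fun i (x : ℂ) => ‖x‖ ^ (2 * k i) * Real.exp (-‖x‖ ^ 2))
  simp only [integral_complex_norm_pow_mul_exp, Finset.prod_mul_distrib, Finset.prod_const,
    Finset.card_univ, Fintype.card_fin] at h3
  simp_rw [h1, Finset.prod_mul_distrib]
  rw [volume_pi, h3, NNReal.smul_def, smul_eq_mul]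
  ring

theorem finrank_real_euclideanSpace_complex (d : ℕ) :
    Module.finrank ℝ (EuclideanSpace ℂ (Fin d)) = 2 * d := by
  rw [← Module.finrank_mul_finrank ℝ ℂ (EuclideanSpace ℂ (Fin d)), Complex.finrank_real_complex,
    finrank_euclideanSpace_fin]

/-- The integral of a monomial over the unit ball against a power of `1 - ‖z‖ ^ 2`.  The spherical
part is eliminated by comparing with the Gaussian integral of the same monomial. -/
theorem integral_ball_monomial {d : ℕ} (hd : 1 ≤ d) (k : Fin d → ℕ) (m : ℕ) :
    ∫ z in ball (0 : EuclideanSpace ℂ (Fin d)) 1, (∏ i, ‖z i‖ ^ (2 * k i)) * (1 - ‖z‖ ^ 2) ^ m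
      = Real.pi ^ d * (∏ i, ((k i).factorial : ℝ)) * m.factorial /
        ((∑ i, k i) + d + m).factorial := by
  have : NeZero d := ⟨by omega⟩
  have hhom : ∀ k : Fin d → ℕ, ∀ r : ℝ, 0 < r → ∀ z : EuclideanSpace ℂ (Fin d),
      (∏ i, ‖(r • z) i‖ ^ (2 * k i)) = r ^ (2 * ∑ i, k i) * ∏ i, ‖z i‖ ^ (2 * k i) := by
    intro k r hr z
    simp only [PiLp.smul_apply, norm_smul, mul_pow, Finset.prod_mul_distrib, Finset.prod_pow_eq_pow_sum,
      Real.norm_eq_abs, abs_of_pos hr, Finset.mul_sum]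
  obtain ⟨N, hN⟩ : ∃ N : (Fin d → ℕ) → ℕ, ∀ k, (∑ i, k i) + d = N k + 1 :=
    ⟨fun k => (∑ i, k i) + d - 1, fun k => by simp only; omega⟩
  obtain ⟨c, hc⟩ := exists_integral_monomial_mul_exp d
  set S : (Fin d → ℕ) → ℝ := fun k => ∫ y : sphere (0 : EuclideanSpace ℂ (Fin d)) 1,
    (∏ i, ‖y.1 i‖ ^ (2 * k i)) ∂(volume : Measure (EuclideanSpace ℂ (Fin d))).toSphere with hS
  have hpow : ∀ k : Fin d → ℕ, ∀ r g : ℝ,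
      r ^ (2 * d - 1) * (r ^ (2 * ∑ i, k i) * g) = r ^ (2 * N k + 1) * g := by
    intro k r g
    rw [← mul_assoc, ← pow_add]
    congr 2
    have := hN k
    omega
  -- the Gaussian integral, computed in Cartesian and in polar coordinates, gives the spherical one
  have hSk : ∀ k, S k * ((N k).factorial / 2) = c * ∏ i, ((k i).factorial : ℝ) := by
    intro k
    rw [← hc, integral_homogeneous_mul_fun_norm volume (hhom k) (fun r => Real.exp (-r ^ 2)),
      finrank_real_euclideanSpace_complex]
    simp_rw [hpow, integral_Ioi_pow_mul_exp_neg_sq]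
    rfl
  have hball : ∀ k : Fin d → ℕ, ∀ m : ℕ,
      ∫ z in ball (0 : EuclideanSpace ℂ (Fin d)) 1, (∏ i, ‖z i‖ ^ (2 * k i)) * (1 - ‖z‖ ^ 2) ^ m
      = S k * (((N k).factorial * m.factorial : ℝ) / (2 * (N k + m + 1).factorial)) := by
    intro k m
    rw [← intervalIntegral_pow_mul_one_sub_sq_pow, ← integral_indicator measurableSet_ball,
      intervalIntegral.integral_of_le zero_le_one, integral_Ioc_eq_integral_Ioo]
    have h1 : ∀ z : EuclideanSpace ℂ (Fin d), (ball (0 : EuclideanSpace ℂ (Fin d)) 1).indicator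
        (fun z => (∏ i, ‖z i‖ ^ (2 * k i)) * (1 - ‖z‖ ^ 2) ^ m) z = (∏ i, ‖z i‖ ^ (2 * k i)) *
          (Set.Iio (1 : ℝ)).indicator (fun r => (1 - r ^ 2) ^ m) ‖z‖ := by
      intro z
      by_cases hz : ‖z‖ < 1 <;> simp [Set.indicator, hz]
    simp_rw [h1]
    rw [integral_homogeneous_mul_fun_norm volume (hhom k)
      ((Set.Iio (1 : ℝ)).indicator (fun r => (1 - r ^ 2) ^ m)),
      finrank_real_euclideanSpace_complex]
    simp_rw [hpow]
    congr 1
    have h2 : ∀ r : ℝ, r ^ (2 * N k + 1) * (Set.Iio (1 : ℝ)).indicator (fun r => (1 - r ^ 2) ^ m) r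
        = (Set.Iio (1 : ℝ)).indicator (fun r => r ^ (2 * N k + 1) * (1 - r ^ 2) ^ m) r := by
      intro r
      by_cases hr : r < 1 <;> simp [Set.indicator, hr]
    simp_rw [h2]
    rw [setIntegral_indicator measurableSet_Iio, Set.Ioi_inter_Iio]
  -- `k = 0`, `m = 0` gives the volume of the ball, which determines `c`
  have hcval : c = Real.pi ^ d := by
    have h0 := hball 0 0
    have h1 := hSk 0
    have h2 := InnerProductSpace.volume_ball_of_dim_even (finrank_real_euclideanSpace_complex d)
      (0 : EuclideanSpace ℂ (Fin d)) 1
    have hN0 := hN 0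
    simp only [Pi.zero_apply, Finset.sum_const_zero, zero_add] at hN0
    simp only [Pi.zero_apply, mul_zero, pow_zero, Finset.prod_const_one, mul_one, integral_const,
      smul_eq_mul, Measure.real, Measure.restrict_apply_univ, h2, ENNReal.ofReal_one, one_pow,
      one_mul, Nat.factorial_zero, Nat.cast_one, add_zero] at h0 h1
    rw [ENNReal.toReal_ofReal (by positivity), ← hN0] at h0
    have := (N 0).factorial_ne_zero
    have := d.factorial_ne_zero
    field_simp at h0 h1
    linarith
  have h1 := hSk k
  have := (N k).factorial_ne_zero
  have := (N k + m + 1).factorial_ne_zero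
  rw [hball, show (∑ i, k i) + d + m = N k + m + 1 by rw [hN]; ring, ← hcval, ← h1]
  field_simp

theorem integral_bergmanMeasure {d n : ℕ} (f : EuclideanSpace ℂ (Fin d) → ℝ) :
    ∫ z, f z ∂bergmanMeasure d n = (n.factorial : ℝ) / ((n - d).factorial * Real.pi ^ d) *
      ∫ z in ball (0 : EuclideanSpace ℂ (Fin d)) 1, f z * (1 - ‖z‖ ^ 2) ^ (n - d) := by
  rw [bergmanMeasure, integral_withDensity_eq_integral_toReal_smul (by fun_prop) (by simp),
    ← integral_const_mul]
  refine setIntegral_congr_fun measurableSet_ball fun z hz => ?_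
  simp only [mem_ball, dist_zero_right] at hz
  have : 0 ≤ 1 - ‖z‖ ^ 2 := by nlinarith [norm_nonneg z]
  simp only [smul_eq_mul]
  rw [ENNReal.toReal_ofReal (by positivity)]
  ring

/-- For `j = 0` this is the norm of a normalized monomial, for `j = 1` the diagonal entry of
`T_{1 - ‖z‖²}` at it. -/
theorem integral_norm_monomialFun_sq_mul {d n : ℕ} (hd : 1 ≤ d) (hn : d ≤ n) (k : Fin d → ℕ)
    (j : ℕ) :
    ∫ z, ‖monomialFun d n k z‖ ^ 2 * (1 - ‖z‖ ^ 2) ^ j ∂bergmanMeasure d n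
      = (((∑ i, k i) + n).factorial * (n - d + j).factorial : ℝ) /
        ((n - d).factorial * ((∑ i, k i) + n + j).factorial) := by
  have h1 : ∀ z : EuclideanSpace ℂ (Fin d), ‖monomialFun d n k z‖ ^ 2
      = (((∑ i, k i) + n).factorial / ((∏ i, (k i).factorial : ℕ) * n.factorial) : ℝ) *
        ∏ i, ‖z i‖ ^ (2 * k i) := by
    intro z
    rw [monomialFun, norm_mul, mul_pow, Complex.norm_real, Real.norm_eq_abs, sq_abs,
      Real.sq_sqrt (by positivity), norm_prod, ← Finset.prod_pow]
    simp only [norm_pow, ← pow_mul, mul_comm 2]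
  rw [integral_bergmanMeasure]
  have h2 : ∀ z : EuclideanSpace ℂ (Fin d),
      ‖monomialFun d n k z‖ ^ 2 * (1 - ‖z‖ ^ 2) ^ j * (1 - ‖z‖ ^ 2) ^ (n - d)
      = (((∑ i, k i) + n).factorial / ((∏ i, (k i).factorial : ℕ) * n.factorial) : ℝ) *
        ((∏ i, ‖z i‖ ^ (2 * k i)) * (1 - ‖z‖ ^ 2) ^ (n - d + j)) := by
    intro z
    rw [h1, pow_add]
    ring
  simp_rw [h2]
  rw [integral_const_mul, integral_ball_monomial hd,
    show (∑ i, k i) + d + (n - d + j) = (∑ i, k i) + n + j by omega]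
  have a1 : (n.factorial : ℝ) ≠ 0 := by exact_mod_cast n.factorial_ne_zero
  have a2 : ((n - d).factorial : ℝ) ≠ 0 := by exact_mod_cast (n - d).factorial_ne_zero
  have a3 : (((∑ i, k i) + n + j).factorial : ℝ) ≠ 0 := by exact_mod_cast Nat.factorial_ne_zero _
  have a4 : (∏ i, ((k i).factorial : ℝ)) ≠ 0 :=
    Finset.prod_ne_zero_iff.2 fun i _ => by exact_mod_cast Nat.factorial_ne_zero _
  have a5 := Real.pi_ne_zero
  push_cast
  field_simp

/-- `dV_n` is invariant under all real-linear isometries. -/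
theorem measurePreserving_bergmanMeasure {d : ℕ} (n : ℕ)
    (e : EuclideanSpace ℂ (Fin d) ≃ₗᵢ[ℝ] EuclideanSpace ℂ (Fin d)) :
    MeasurePreserving e (bergmanMeasure d n) (bergmanMeasure d n) := by
  refine ⟨e.continuous.measurable, ?_⟩
  ext s hs
  rw [Measure.map_apply e.continuous.measurable hs, bergmanMeasure,
    withDensity_apply _ (e.continuous.measurable hs), withDensity_apply _ hs,
    Measure.restrict_restrict (e.continuous.measurable hs), Measure.restrict_restrict hs]
  have h1 : e ⁻¹' s ∩ ball 0 1 = e ⁻¹' (s ∩ ball 0 1) := by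
    ext z
    simp
  rw [h1]
  simpa using e.measurePreserving.setLIntegral_comp_preimage_emb
    e.toHomeomorph.measurableEmbedding (fun z => ENNReal.ofReal ((n.factorial : ℝ) /
      ((n - d).factorial * Real.pi ^ d) * (1 - ‖z‖ ^ 2) ^ (n - d))) (s ∩ ball 0 1)

/-- The rotation `z ↦ (c i * z i)` of the coordinates. -/
noncomputable def coordRotation {d : ℕ} (c : Fin d → Circle) :
    EuclideanSpace ℂ (Fin d) ≃ₗᵢ[ℝ] EuclideanSpace ℂ (Fin d) :=
  LinearIsometryEquiv.piLpCongrRight 2 fun i => rotation (c i)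

theorem coordRotation_apply {d : ℕ} (c : Fin d → Circle) (z : EuclideanSpace ℂ (Fin d))
    (i : Fin d) : coordRotation c z i = c i * z i := rfl

theorem monomialFun_coordRotation {d : ℕ} (n : ℕ) (k : Fin d → ℕ) (c : Fin d → Circle)
    (z : EuclideanSpace ℂ (Fin d)) :
    monomialFun d n k (coordRotation c z) = (∏ i, (c i : ℂ) ^ k i) * monomialFun d n k z := by
  simp only [monomialFun, coordRotation_apply, mul_pow, Finset.prod_mul_distrib]
  ring

/-- Distinct monomials are orthogonal for every rotation invariant weight: rotating a coordinate
in which the exponents differ multiplies the integral by `-1`. -/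
theorem integral_conj_monomialFun_mul_of_ne {d n : ℕ} {k l : Fin d → ℕ} (hkl : k ≠ l) (g : ℝ → ℂ) :
    ∫ z, (starRingEnd ℂ) (monomialFun d n k z) * monomialFun d n l z * g ‖z‖ ∂bergmanMeasure d n
      = 0 := by
  obtain ⟨i, hi⟩ := Function.ne_iff.1 hkl
  have hi' : (l i : ℝ) - k i ≠ 0 := sub_ne_zero.2 (by exact_mod_cast hi.symm)
  let c : Fin d → Circle := Function.update 1 i (Circle.exp (Real.pi / (l i - k i)))
  have h := (measurePreserving_bergmanMeasure n (coordRotation c)).integral_comp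
    (coordRotation c).toHomeomorph.measurableEmbedding
    (fun z => (starRingEnd ℂ) (monomialFun d n k z) * monomialFun d n l z * g ‖z‖)
  have hc : ∀ m : Fin d → ℕ, ∏ j, (c j : ℂ) ^ m j
      = Complex.exp (m i * (Real.pi / (l i - k i) : ℝ) * Complex.I) := by
    intro m
    rw [Finset.prod_eq_single i]
    · simp only [c, Function.update_self, Circle.coe_exp, ← Complex.exp_nat_mul]
      congr 1
      ring
    · intro j _ hj
      simp [c, Function.update_of_ne hj]
    · simp
  have hprod : (starRingEnd ℂ) (∏ j, (c j : ℂ) ^ k j) * ∏ j, (c j : ℂ) ^ l j = -1 := by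
    rw [hc, hc, ← Complex.exp_conj, ← Complex.exp_add, ← Complex.exp_pi_mul_I]
    congr 1
    have : ((l i : ℂ) - k i) ≠ 0 := by exact_mod_cast hi'
    simp only [map_mul, map_natCast, Complex.conj_ofReal, Complex.conj_I]
    push_cast
    field_simp
    ring
  have h2 : ∀ z, (starRingEnd ℂ) (monomialFun d n k (coordRotation c z)) *
      monomialFun d n l (coordRotation c z) * g ‖coordRotation c z‖
      = -((starRingEnd ℂ) (monomialFun d n k z) * monomialFun d n l z * g ‖z‖) := by
    intro z
    rw [monomialFun_coordRotation, monomialFun_coordRotation, map_mul,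
      LinearIsometryEquiv.norm_map]
    linear_combination ((starRingEnd ℂ) (monomialFun d n k z) * monomialFun d n l z * g ‖z‖) * hprod
  simp_rw [h2] at h
  rw [integral_neg] at h
  exact self_eq_neg.1 h.symm

theorem inner_bergmanSpace {d n : ℕ} (f g : BergmanSpace d n) :
    inner ℂ f g = ∫ z, (starRingEnd ℂ) (bergmanInclusion d n f z) * bergmanInclusion d n g z
      ∂bergmanMeasure d n := by
  change inner ℂ (bergmanInclusion d n f) (bergmanInclusion d n g) = _
  rw [L2.inner_def]
  simp only [RCLike.inner_apply, mul_comm]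

theorem coeFn_bergmanMonomial (d n : ℕ) (k : Fin d → ℕ) :
    bergmanInclusion d n (bergmanMonomial d n k) =ᵐ[bergmanMeasure d n] monomialFun d n k :=
  (memLp_monomialFun d n k).coeFn_toLp

theorem orthonormal_bergmanMonomial {d n : ℕ} (hd : 1 ≤ d) (hn : d ≤ n) :
    Orthonormal ℂ (bergmanMonomial d n) := by
  rw [orthonormal_iff_ite]
  intro k l
  have h1 : inner ℂ (bergmanMonomial d n k) (bergmanMonomial d n l)
      = ∫ z, (starRingEnd ℂ) (monomialFun d n k z) * monomialFun d n l z ∂bergmanMeasure d n := by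
    rw [inner_bergmanSpace]
    refine integral_congr_ae ?_
    filter_upwards [coeFn_bergmanMonomial d n k, coeFn_bergmanMonomial d n l] with z hz hz'
    rw [hz, hz']
  rw [h1]
  split_ifs with h
  · subst h
    have h2 := integral_norm_monomialFun_sq_mul hd hn k 0
    simp only [pow_zero, mul_one, add_zero] at h2
    rw [mul_comm (((∑ i, k i) + n).factorial : ℝ), div_self (by positivity)] at h2
    simp_rw [Complex.conj_mul', ← Complex.ofReal_pow]
    exact integral_ofReal.trans (congrArg Complex.ofReal h2)
  · simpa using integral_conj_monomialFun_mul_of_ne (n := n) h (fun _ => 1)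

/-! ### Completeness of the monomials -/

/-- Averages of a holomorphic function over a continuous family of affine substitutions are
holomorphic. -/
theorem differentiableAt_integral_comp_affine {d : ℕ} {g : EuclideanSpace ℂ (Fin d) → ℂ}
    {U : Set (EuclideanSpace ℂ (Fin d))} (hU : IsOpen U) (hg : DifferentiableOn ℂ g U)
    {b : ℝ → ℂ} {a : ℝ → ℂ} {w : ℝ → EuclideanSpace ℂ (Fin d)} (hb : Continuous b)
    (ha : Continuous a) (hw : Continuous w) {s : ℝ} {z₀ : EuclideanSpace ℂ (Fin d)}
    (hz₀ : ∀ θ ∈ Set.Icc 0 s, a θ • z₀ + w θ ∈ U) :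
    DifferentiableAt ℂ (fun z => ∫ θ in Set.Icc 0 s, b θ * g (a θ • z + w θ)) z₀ := by
  set K : Set (EuclideanSpace ℂ (Fin d)) := (fun θ => a θ • z₀ + w θ) '' Set.Icc 0 s with hK
  have hKc : IsCompact K := isCompact_Icc.image (by fun_prop)
  have hKU : K ⊆ U := by
    rintro _ ⟨θ, hθ, rfl⟩
    exact hz₀ θ hθ
  obtain ⟨δ, hδ, hδU⟩ := hKc.exists_cthickening_subset_open hU hKU
  obtain ⟨M, hM⟩ := isCompact_Icc.exists_bound_of_continuousOn (s := Set.Icc 0 s) ha.continuousOn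
  obtain ⟨B, hB⟩ := isCompact_Icc.exists_bound_of_continuousOn (s := Set.Icc 0 s) hb.continuousOn
  obtain ⟨C, hC⟩ := (hKc.cthickening (r := δ)).exists_bound_of_continuousOn
    (hg.continuousOn.mono hδU)
  set M' := max M 1 with hM'
  have hM'1 : 1 ≤ M' := le_max_right _ _
  have hr : 0 < δ / (2 * M') := by positivity
  have hnear : ∀ θ ∈ Set.Icc 0 s, ∀ z ∈ ball z₀ (δ / (2 * M')),
      ball (a θ • z + w θ) (δ / 2) ⊆ cthickening δ K := by
    intro θ hθ z hz y hy
    refine mem_cthickening_of_dist_le y (a θ • z₀ + w θ) δ K ⟨θ, hθ, rfl⟩ ?_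
    rw [mem_ball] at hy hz
    have h1 : dist (a θ • z + w θ) (a θ • z₀ + w θ) ≤ δ / 2 := by
      rw [dist_add_right, dist_smul₀]
      calc ‖a θ‖ * dist z z₀ ≤ M' * (δ / (2 * M')) := by
            gcongr
            exact (hM θ hθ).trans (le_max_left _ _)
        _ = δ / 2 := by field_simp
    linarith [dist_triangle y (a θ • z + w θ) (a θ • z₀ + w θ)]
  have hmem : ∀ θ ∈ Set.Icc 0 s, ∀ z ∈ ball z₀ (δ / (2 * M')), a θ • z + w θ ∈ U :=
    fun θ hθ z hz => hδU (hnear θ hθ z hz (mem_ball_self (by positivity)))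
  -- Cauchy's estimate, uniformly near the compact curve
  have hfd : ∀ θ ∈ Set.Icc 0 s, ∀ z ∈ ball z₀ (δ / (2 * M')),
      ‖fderiv ℂ g (a θ • z + w θ)‖ ≤ (2 * C) / (δ / 2) := by
    intro θ hθ z hz
    have hsub := hnear θ hθ z hz
    refine Complex.norm_fderiv_le_div_of_mapsTo_ball (hg.mono (hsub.trans hδU)) ?_ (by positivity)
    intro y hy
    rw [mem_closedBall, dist_eq_norm]
    have h1 := hC y (hsub hy)
    have h2 := hC _ (hsub (mem_ball_self (by positivity)))
    linarith [norm_sub_le (g y) (g (a θ • z + w θ))]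
  have hcont : ∀ z ∈ ball z₀ (δ / (2 * M')),
      ContinuousOn (fun θ => b θ * g (a θ • z + w θ)) (Set.Icc 0 s) := by
    intro z hz
    refine hb.continuousOn.mul (hg.continuousOn.comp (f := fun θ => a θ • z + w θ) (by fun_prop) ?_)
    exact fun θ hθ => hmem θ hθ z hz
  have hmain := hasFDerivAt_integral_of_dominated_of_fderiv_le
    (μ := volume.restrict (Set.Icc 0 s)) (x₀ := z₀) (s := ball z₀ (δ / (2 * M')))
    (F := fun z θ => b θ * g (a θ • z + w θ))
    (F' := fun z θ => b θ • a θ • fderiv ℂ g (a θ • z + w θ))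
    (bound := fun _ => B * (M * ((2 * C) / (δ / 2)))) (ball_mem_nhds _ hr) ?_ ?_ ?_ ?_ ?_ ?_
  · exact hmain.differentiableAt
  · filter_upwards [ball_mem_nhds z₀ hr] with z hz
    exact (hcont z hz).aestronglyMeasurable measurableSet_Icc
  · exact (hcont z₀ (mem_ball_self hr)).integrableOn_compact isCompact_Icc
  · have h1 : Measurable fun θ => fderiv ℂ g (a θ • z₀ + w θ) :=
      (measurable_fderiv ℂ g).comp (by fun_prop)
    exact (hb.measurable.smul (ha.measurable.smul h1)).aestronglyMeasurable
  · filter_upwards [ae_restrict_mem measurableSet_Icc] with θ hθ z hz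
    rw [norm_smul, norm_smul]
    have h1 := hM θ hθ
    have h2 := hB θ hθ
    have h3 := hfd θ hθ z hz
    have : 0 ≤ M := (norm_nonneg _).trans h1
    have : 0 ≤ B := (norm_nonneg _).trans h2
    gcongr
  · exact integrable_const _
  · filter_upwards [ae_restrict_mem measurableSet_Icc] with θ hθ z hz
    have h1 : HasFDerivAt g (fderiv ℂ g (a θ • z + w θ)) (a θ • z + w θ) :=
      (hg.differentiableAt (hU.mem_nhds (hmem θ hθ z hz))).hasFDerivAt
    have h2 : HasFDerivAt (fun z => a θ • z + w θ)
        (a θ • ContinuousLinearMap.id ℂ (EuclideanSpace ℂ (Fin d))) z :=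
      ((hasFDerivAt_id z).const_smul (a θ)).add_const _
    have h3 := (h1.comp z h2).const_mul (b θ)
    have h4 : b θ • a θ • fderiv ℂ g (a θ • z + w θ) = b θ • (fderiv ℂ g (a θ • z + w θ)).comp
        (a θ • ContinuousLinearMap.id ℂ (EuclideanSpace ℂ (Fin d))) := by
      ext v
      simp
    rw [h4]
    exact h3

/-- Directional derivatives of holomorphic functions of several variables are holomorphic. -/
theorem differentiableOn_fderiv_apply {d : ℕ} {g : EuclideanSpace ℂ (Fin d) → ℂ}
    {U : Set (EuclideanSpace ℂ (Fin d))} (hU : IsOpen U) (hg : DifferentiableOn ℂ g U)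
    (v : EuclideanSpace ℂ (Fin d)) : DifferentiableOn ℂ (fun z => fderiv ℂ g z v) U := by
  intro z₀ hz₀
  obtain ⟨ε, hε, hεU⟩ := Metric.isOpen_iff.1 hU z₀ hz₀
  set ρ := ε / (2 * (‖v‖ + 1)) with hρ
  have hρ0 : 0 < ρ := by positivity
  have hρv : ρ * ‖v‖ ≤ ε / 2 := by
    rw [hρ, div_mul_eq_mul_div, div_le_div_iff₀ (by positivity) (by positivity)]
    nlinarith [norm_nonneg v]
  have hmem : ∀ z ∈ ball z₀ (ε / 2), ∀ ζ : ℂ, ‖ζ‖ ≤ ρ → z + ζ • v ∈ U := by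
    intro z hz ζ hζ
    apply hεU
    rw [mem_ball] at hz ⊢
    have h1 : dist (z + ζ • v) z ≤ ε / 2 := by
      rw [dist_self_add_left, norm_smul]
      exact (mul_le_mul_of_nonneg_right hζ (norm_nonneg v)).trans hρv
    linarith [dist_triangle (z + ζ • v) z z₀]
  -- Cauchy's formula for the derivative of the slice `ζ ↦ g (z + ζ v)` at `0`
  have hformula : ∀ z ∈ ball z₀ (ε / 2), fderiv ℂ g z v
      = ∫ θ in Set.Icc 0 (2 * Real.pi), ((2 * Real.pi * Complex.I)⁻¹ *
          ((circleMap 0 ρ θ * Complex.I) * ((circleMap 0 ρ θ) ^ 2)⁻¹)) *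
            g ((1 : ℂ) • z + circleMap 0 ρ θ • v) := by
    intro z hz
    set V : Set ℂ := (fun ζ : ℂ => z + ζ • v) ⁻¹' U with hV
    have hVo : IsOpen V := hU.preimage (by fun_prop)
    have hd : DifferentiableOn ℂ (fun ζ : ℂ => g (z + ζ • v)) V := by
      intro ζ hζ
      have h1 : DifferentiableAt ℂ g (z + ζ • v) := hg.differentiableAt (hU.mem_nhds hζ)
      have h2 : DifferentiableAt ℂ (fun ζ : ℂ => z + ζ • v) ζ := by fun_prop
      exact (h1.comp ζ h2).differentiableWithinAt
    have hsub : closedBall (0 : ℂ) ρ ⊆ V := by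
      intro ζ hζ
      rw [mem_closedBall, dist_zero_right] at hζ
      exact hmem z hz ζ hζ
    have h := Complex.two_pi_I_inv_smul_circleIntegral_sub_sq_inv_smul_of_differentiable hVo hsub hd
      (mem_ball_self hρ0)
    have h0 : HasDerivAt (fun ζ : ℂ => g (z + ζ • v)) (fderiv ℂ g z v) 0 := by
      have h1 : HasFDerivAt g (fderiv ℂ g z) (z + (0 : ℂ) • v) := by
        rw [zero_smul, add_zero]
        have := hmem z hz 0 (by simpa using hρ0.le)
        rw [zero_smul, add_zero] at this
        exact (hg.differentiableAt (hU.mem_nhds this)).hasFDerivAt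
      have h2 : HasDerivAt (fun ζ : ℂ => z + ζ • v) v 0 := by
        simpa using ((hasDerivAt_id (0 : ℂ)).smul_const v).const_add z
      exact h1.comp_hasDerivAt 0 h2
    rw [h0.deriv] at h
    rw [← h, circleIntegral, intervalIntegral.integral_of_le (by positivity),
      ← integral_Icc_eq_integral_Ioc, smul_eq_mul, ← integral_const_mul]
    refine setIntegral_congr_fun measurableSet_Icc fun θ _ => ?_
    simp only [deriv_circleMap, sub_zero, smul_eq_mul, one_smul]
    ring
  have hdiff := differentiableAt_integral_comp_affine hU hg (z₀ := z₀) (s := 2 * Real.pi)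
    (b := fun θ => (2 * Real.pi * Complex.I)⁻¹ *
          ((circleMap 0 ρ θ * Complex.I) * ((circleMap 0 ρ θ) ^ 2)⁻¹))
    (a := fun _ => 1) (w := fun θ => circleMap 0 ρ θ • v) ?_ continuous_const ?_ ?_
  · refine (hdiff.congr_of_eventuallyEq ?_).differentiableWithinAt
    filter_upwards [ball_mem_nhds z₀ (half_pos hε)] with z hz
    exact hformula z hz
  · have h1 := continuous_circleMap 0 ρ
    refine continuous_const.mul ((h1.mul continuous_const).mul ((h1.pow 2).inv₀ fun θ => ?_))
    exact pow_ne_zero 2 (circleMap_ne_center hρ0.ne')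
  · have h1 := continuous_circleMap 0 ρ
    fun_prop
  · intro θ _
    rw [one_smul]
    exact hmem z₀ (mem_ball_self (half_pos hε)) _ (by simp [abs_of_pos hρ0])

/-- A holomorphic function on the unit ball that is homogeneous under rotations by scalars of
modulus one is a polynomial.  Euler's identity `m p(z) = ∑ zᵢ ∂ᵢ p(z)` reduces the degree. -/
theorem exists_mvPolynomial_of_homogeneous {d : ℕ} (m : ℕ) {p : EuclideanSpace ℂ (Fin d) → ℂ}
    (hp : DifferentiableOn ℂ p (ball 0 1))
    (hhom : ∀ z ∈ ball (0 : EuclideanSpace ℂ (Fin d)) 1, ∀ t : ℝ,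
      p (circleMap 0 1 t • z) = circleMap 0 1 t ^ m * p z) :
    ∃ q : MvPolynomial (Fin d) ℂ, ∀ z ∈ ball (0 : EuclideanSpace ℂ (Fin d)) 1,
      p z = MvPolynomial.eval (fun i => z i) q := by
  have hrot : ∀ z ∈ ball (0 : EuclideanSpace ℂ (Fin d)) 1, ∀ t : ℝ,
      circleMap 0 1 t • z ∈ ball (0 : EuclideanSpace ℂ (Fin d)) 1 := by
    intro z hz t
    simpa [norm_smul] using hz
  induction m generalizing p with
  | zero =>
    refine ⟨MvPolynomial.C (p 0), fun z hz => ?_⟩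
    rw [MvPolynomial.eval_C]
    have hd : DiffContOnCl ℂ (fun ζ : ℂ => p (ζ • z)) (ball 0 |1|) := by
      apply DifferentiableOn.diffContOnCl
      intro ζ hζ
      have hζ' : ζ • z ∈ ball (0 : EuclideanSpace ℂ (Fin d)) 1 := by
        rw [abs_one, closure_ball _ one_ne_zero] at hζ
        simp only [mem_closedBall, mem_ball, dist_zero_right] at hζ hz ⊢
        rw [norm_smul]
        nlinarith [norm_nonneg z, norm_nonneg ζ]
      have h1 : DifferentiableAt ℂ p (ζ • z) := hp.differentiableAt (isOpen_ball.mem_nhds hζ')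
      have h2 : DifferentiableAt ℂ (fun ζ : ℂ => ζ • z) ζ := by fun_prop
      exact (h1.comp ζ h2).differentiableWithinAt
    have h := hd.circleAverage
    rw [Real.circleAverage_def] at h
    simp only [hhom z hz, pow_zero, one_mul, zero_smul] at h
    rw [← h]
    have := Real.pi_ne_zero
    simp only [intervalIntegral.integral_const, sub_zero, smul_smul]
    rw [inv_mul_cancel₀ (by positivity), one_smul]
  | succ m ih =>
    have hdv := fun v => differentiableOn_fderiv_apply isOpen_ball hp v
    have hda : ∀ z ∈ ball (0 : EuclideanSpace ℂ (Fin d)) 1, HasFDerivAt p (fderiv ℂ p z) z :=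
      fun z hz => (hp.differentiableAt (isOpen_ball.mem_nhds hz)).hasFDerivAt
    have hdh : ∀ v, ∀ z ∈ ball (0 : EuclideanSpace ℂ (Fin d)) 1, ∀ t : ℝ,
        fderiv ℂ p (circleMap 0 1 t • z) v = circleMap 0 1 t ^ m * fderiv ℂ p z v := by
      intro v z hz t
      have h1 : HasFDerivAt (fun z => p (circleMap 0 1 t • z))
          ((fderiv ℂ p (circleMap 0 1 t • z)).comp
            (circleMap 0 1 t • ContinuousLinearMap.id ℂ (EuclideanSpace ℂ (Fin d)))) z :=
        HasFDerivAt.comp z (hda _ (hrot z hz t)) ((hasFDerivAt_id z).const_smul (circleMap 0 1 t))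
      have h2 : HasFDerivAt (fun z => circleMap 0 1 t ^ (m + 1) * p z)
          (circleMap 0 1 t ^ (m + 1) • fderiv ℂ p z) z := (hda z hz).const_mul _
      have h3 : (fun z => p (circleMap 0 1 t • z)) =ᶠ[𝓝 z]
          fun z => circleMap 0 1 t ^ (m + 1) * p z := by
        filter_upwards [isOpen_ball.mem_nhds hz] with y hy
        exact hhom y hy t
      have h4 := (h1.congr_of_eventuallyEq h3.symm).unique h2
      have h5 := congrArg (fun L => L v) h4
      simp only [ContinuousLinearMap.comp_apply, smul_apply,
        ContinuousLinearMap.id_apply, map_smul, smul_eq_mul, pow_succ'] at h5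
      refine mul_left_cancel₀ (circleMap_ne_center one_ne_zero : circleMap 0 1 t ≠ 0) ?_
      rw [h5]
      ring
    -- differentiate the homogeneity relation in `t` at `t = 0`
    have heuler : ∀ z ∈ ball (0 : EuclideanSpace ℂ (Fin d)) 1,
        fderiv ℂ p z z = (m + 1 : ℕ) * p z := by
      intro z hz
      have h1 : HasDerivAt (fun t : ℝ => circleMap 0 1 t) (circleMap 0 1 0 * Complex.I) 0 :=
        hasDerivAt_circleMap 0 1 0
      have hz' : circleMap 0 1 0 • z ∈ ball (0 : EuclideanSpace ℂ (Fin d)) 1 := hrot z hz 0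
      have h2 : HasDerivAt (fun t : ℝ => p (circleMap 0 1 t • z))
          (fderiv ℂ p (circleMap 0 1 0 • z) ((circleMap 0 1 0 * Complex.I) • z)) 0 :=
        HasFDerivAt.comp_hasDerivAt (f := fun t : ℝ => circleMap 0 1 t • z) (0 : ℝ)
          ((hda _ hz').restrictScalars ℝ) (h1.smul_const z)
      have h3 := (h1.pow (m + 1)).mul_const (p z)
      have h4 : (fun t : ℝ => p (circleMap 0 1 t • z))
          = fun t : ℝ => circleMap 0 1 t ^ (m + 1) * p z := funext fun t => hhom z hz t
      rw [h4] at h2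
      have h5 := h2.unique h3
      have h6 : circleMap 0 1 0 = 1 := by simp [circleMap]
      rw [h6] at h5
      simp only [one_mul, one_smul, map_smul, smul_eq_mul, one_pow, mul_one] at h5
      refine mul_left_cancel₀ Complex.I_ne_zero ?_
      rw [h5]
      ring
    choose q hq using fun i => ih (hdv (EuclideanSpace.single i 1)) (hdh (EuclideanSpace.single i 1))
    refine ⟨MvPolynomial.C ((m + 1 : ℕ) : ℂ)⁻¹ * ∑ i, MvPolynomial.X i * q i, fun z hz => ?_⟩
    have h0 : ((m + 1 : ℕ) : ℂ) ≠ 0 := by exact_mod_cast Nat.succ_ne_zero m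
    have hexp : fderiv ℂ p z z = ∑ i, z i * fderiv ℂ p z (EuclideanSpace.single i 1) := by
      have h1 : z = ∑ i, z i • EuclideanSpace.single i (1 : ℂ) := by
        ext j
        simp [Finset.sum_apply, Pi.single_apply]
      have h2 := congrArg (fderiv ℂ p z) h1
      rw [map_sum] at h2
      simpa only [map_smul, smul_eq_mul] using h2
    simp only [map_mul, MvPolynomial.eval_C, map_sum, MvPolynomial.eval_X]
    rw [eq_inv_mul_iff_mul_eq₀ h0, ← heuler z hz, hexp]
    exact Finset.sum_congr rfl fun i _ => by rw [hq i z hz]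

/-- The `m`-th Fourier coefficient (up to the factor `2π`) of `θ ↦ g (e^{iθ} z)`, i.e. the
homogeneous part of degree `m` of a holomorphic function `g`. -/
noncomputable def homogeneousPart {d : ℕ} (g : EuclideanSpace ℂ (Fin d) → ℂ) (m : ℕ)
    (z : EuclideanSpace ℂ (Fin d)) : ℂ :=
  ∫ θ in Set.Icc 0 (2 * Real.pi), (circleMap 0 1 θ ^ m)⁻¹ * g (circleMap 0 1 θ • z)

theorem circleMap_zero_one_add (s t : ℝ) :
    circleMap 0 1 (s + t) = circleMap 0 1 s * circleMap 0 1 t := by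
  simp [circleMap, add_mul, Complex.exp_add]

theorem homogeneousPart_rotate {d : ℕ} (g : EuclideanSpace ℂ (Fin d) → ℂ) (m : ℕ)
    (z : EuclideanSpace ℂ (Fin d)) (t : ℝ) :
    homogeneousPart g m (circleMap 0 1 t • z) = circleMap 0 1 t ^ m * homogeneousPart g m z := by
  have ht : circleMap 0 1 t ≠ 0 := circleMap_ne_center one_ne_zero
  have hper : Function.Periodic
      (fun θ => (circleMap 0 1 θ ^ m)⁻¹ * g (circleMap 0 1 θ • z)) (2 * Real.pi) := by
    intro θ
    simp only [(periodic_circleMap 0 1) θ]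
  have h1 := hper.intervalIntegral_add_eq t 0
  have h2 : ∀ θ, (circleMap 0 1 θ ^ m)⁻¹ * g (circleMap 0 1 θ • circleMap 0 1 t • z)
      = circleMap 0 1 t ^ m *
        ((circleMap 0 1 (θ + t) ^ m)⁻¹ * g (circleMap 0 1 (θ + t) • z)) := by
    intro θ
    rw [circleMap_zero_one_add, mul_pow, mul_inv, smul_smul]
    field_simp
  have h3 : ∀ f : ℝ → ℂ, ∫ θ in Set.Icc 0 (2 * Real.pi), f θ = ∫ θ in (0)..(2 * Real.pi), f θ := by
    intro f
    rw [intervalIntegral.integral_of_le (by positivity), integral_Icc_eq_integral_Ioc]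
  simp only [homogeneousPart, h2]
  rw [integral_const_mul, h3, h3, intervalIntegral.integral_comp_add_right
    (fun θ => (circleMap 0 1 θ ^ m)⁻¹ * g (circleMap 0 1 θ • z)) t]
  rw [zero_add, add_comm (2 * Real.pi), h1, zero_add]

theorem differentiableOn_homogeneousPart {d : ℕ} {g : EuclideanSpace ℂ (Fin d) → ℂ}
    (hg : DifferentiableOn ℂ g (ball 0 1)) (m : ℕ) :
    DifferentiableOn ℂ (homogeneousPart g m) (ball 0 1) := by
  intro z hz
  have h1 := continuous_circleMap 0 1
  have h := differentiableAt_integral_comp_affine isOpen_ball hg (z₀ := z) (s := 2 * Real.pi)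
    (b := fun θ => (circleMap 0 1 θ ^ m)⁻¹) (a := fun θ => circleMap 0 1 θ) (w := fun _ => 0)
    ((h1.pow m).inv₀ fun θ => pow_ne_zero m (circleMap_ne_center one_ne_zero)) h1
    continuous_const (fun θ _ => by simpa [norm_smul] using hz)
  simp only [add_zero] at h
  exact h.differentiableWithinAt

/-- A holomorphic function whose homogeneous parts vanish is zero. -/
theorem eq_zero_of_homogeneousPart_eq_zero {d : ℕ} {g : EuclideanSpace ℂ (Fin d) → ℂ}
    (hg : DifferentiableOn ℂ g (ball 0 1))
    (h : ∀ m, ∀ z ∈ ball (0 : EuclideanSpace ℂ (Fin d)) 1, homogeneousPart g m z = 0)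
    {z : EuclideanSpace ℂ (Fin d)} (hz : z ∈ ball (0 : EuclideanSpace ℂ (Fin d)) 1) : g z = 0 := by
  rw [mem_ball, dist_zero_right] at hz
  set r : ℝ := (1 + ‖z‖) / 2 with hr
  have hr0 : 0 < r := by positivity
  have hr1 : r < 1 := by rw [hr]; linarith
  have hzr : ‖z‖ < r := by rw [hr]; linarith
  have hrc : (r : ℂ) ≠ 0 := by exact_mod_cast hr0.ne'
  -- `z` lies in the open disc of radius `r` on which the slice through `z₁ = z / r` is expanded
  set z₁ : EuclideanSpace ℂ (Fin d) := (r : ℂ)⁻¹ • z with hz₁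
  have hz₁n : ‖z₁‖ < 1 := by
    rw [hz₁, norm_smul, norm_inv, Complex.norm_real, Real.norm_eq_abs, abs_of_pos hr0,
      inv_mul_lt_iff₀ hr0]
    linarith
  have hd : DifferentiableOn ℂ (fun ζ : ℂ => g (ζ • z₁)) (closedBall 0 (1 : ℝ≥0)) := by
    intro ζ hζ
    have hζ' : ζ • z₁ ∈ ball (0 : EuclideanSpace ℂ (Fin d)) 1 := by
      simp only [mem_closedBall, mem_ball, dist_zero_right, NNReal.coe_one] at hζ ⊢
      rw [norm_smul]
      nlinarith [norm_nonneg z₁, norm_nonneg ζ]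
    have h1 : DifferentiableAt ℂ g (ζ • z₁) := hg.differentiableAt (isOpen_ball.mem_nhds hζ')
    have h2 : DifferentiableAt ℂ (fun ζ : ℂ => ζ • z₁) ζ := by fun_prop
    exact (h1.comp ζ h2).differentiableWithinAt
  have hps := hd.hasFPowerSeriesOnBall (by norm_num)
  have hcoef : ∀ m, (cauchyPowerSeries (fun ζ : ℂ => g (ζ • z₁)) 0 ((1 : ℝ≥0) : ℝ) m)
      (fun _ => (r : ℂ)) = 0 := by
    intro m
    rw [cauchyPowerSeries_apply, circleIntegral, intervalIntegral.integral_of_le (by positivity),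
      ← integral_Icc_eq_integral_Ioc]
    have h1 : ∀ θ, deriv (circleMap 0 ((1 : ℝ≥0) : ℝ)) θ •
        ((r : ℂ) / (circleMap 0 ((1 : ℝ≥0) : ℝ) θ - 0)) ^ m •
        (circleMap 0 ((1 : ℝ≥0) : ℝ) θ - 0)⁻¹ • g (circleMap 0 ((1 : ℝ≥0) : ℝ) θ • z₁)
        = ((r : ℂ) ^ m * Complex.I) *
          ((circleMap 0 1 θ ^ m)⁻¹ * g (circleMap 0 1 θ • z₁)) := by
      intro θ
      have : circleMap 0 1 θ ≠ 0 := circleMap_ne_center one_ne_zero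
      simp only [NNReal.coe_one, deriv_circleMap, sub_zero, smul_eq_mul, div_pow]
      field_simp
    simp_rw [h1]
    rw [integral_const_mul]
    have h2 := h m z₁ (by simpa using hz₁n)
    rw [homogeneousPart] at h2
    rw [h2, mul_zero, smul_zero]
  have hsum := hps.hasSum (y := (r : ℂ)) (by
    simp only [ENNReal.coe_one, mem_eball, edist_zero_right]
    rw [← ofReal_norm, Complex.norm_real, Real.norm_eq_abs, abs_of_pos hr0]
    simpa using hr1)
  simp_rw [hcoef] at hsum
  have h3 := hsum.unique hasSum_zero
  rw [zero_add, hz₁, smul_inv_smul₀ hrc] at h3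
  exact h3

theorem ae_restrict_of_ae_bergmanMeasure {d n : ℕ} {p : EuclideanSpace ℂ (Fin d) → Prop}
    (h : ∀ᵐ z ∂bergmanMeasure d n, p z) :
    ∀ᵐ z ∂(volume.restrict (ball (0 : EuclideanSpace ℂ (Fin d)) 1)), p z := by
  rw [bergmanMeasure, ae_withDensity_iff (by fun_prop)] at h
  filter_upwards [h, ae_restrict_mem measurableSet_ball] with z hz hz'
  apply hz
  rw [mem_ball, dist_zero_right] at hz'
  have : 0 < 1 - ‖z‖ ^ 2 := by nlinarith [norm_nonneg z]
  simp only [ne_eq, ENNReal.ofReal_eq_zero, not_le]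
  positivity

/-- A square-integrable holomorphic function orthogonal to all monomials is zero: integrating over
rotations shows that it is orthogonal to its homogeneous parts, with inner product the squared norm
of that part. -/
theorem eq_zero_of_integral_conj_monomial_eq_zero {d n : ℕ} {g : EuclideanSpace ℂ (Fin d) → ℂ}
    (hg : DifferentiableOn ℂ g (ball 0 1)) (hgL : MemLp g 2 (bergmanMeasure d n))
    (h : ∀ k : Fin d → ℕ,
      ∫ z, (starRingEnd ℂ) (∏ i, z i ^ k i) * g z ∂bergmanMeasure d n = 0) :
    ∀ z ∈ ball (0 : EuclideanSpace ℂ (Fin d)) 1, g z = 0 := by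
  have hgi : Integrable g (bergmanMeasure d n) := hgL.integrable (by norm_num)
  refine fun z hz => eq_zero_of_homogeneousPart_eq_zero hg (fun m => ?_) hz
  have hpd := differentiableOn_homogeneousPart hg m
  obtain ⟨q, hq⟩ := exists_mvPolynomial_of_homogeneous m hpd
    fun z _ t => homogeneousPart_rotate g m z t
  have hqc : Continuous fun z : EuclideanSpace ℂ (Fin d) => MvPolynomial.eval (fun i => z i) q := by
    have := MvPolynomial.continuous_eval q
    exact this.comp (by fun_prop)
  obtain ⟨C, hC⟩ := (isCompact_closedBall (0 : EuclideanSpace ℂ (Fin d)) 1).exists_bound_of_continuousOn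
    hqc.continuousOn
  have hmulint : ∀ f : EuclideanSpace ℂ (Fin d) → ℂ, Continuous f →
      Integrable (fun z => (starRingEnd ℂ) (f z) * g z) (bergmanMeasure d n) := by
    intro f hf
    obtain ⟨C, hC⟩ :=
      (isCompact_closedBall (0 : EuclideanSpace ℂ (Fin d)) 1).exists_bound_of_continuousOn
        hf.continuousOn
    refine hgi.bdd_mul (c := C) (Complex.continuous_conj.comp hf).aestronglyMeasurable ?_
    filter_upwards [ae_mem_ball_bergmanMeasure d n] with z hz
    simpa using hC z (ball_subset_closedBall hz)
  set G : EuclideanSpace ℂ (Fin d) → ℂ := fun z =>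
    (starRingEnd ℂ) (MvPolynomial.eval (fun i => z i) q) * g z with hG
  have hGi : Integrable G (bergmanMeasure d n) := hmulint _ hqc
  have hG0 : ∫ z, G z ∂bergmanMeasure d n = 0 := by
    simp only [hG, MvPolynomial.eval_eq', map_sum, map_mul, Finset.sum_mul]
    rw [integral_finsetSum]
    · refine Finset.sum_eq_zero fun k _ => ?_
      simp_rw [mul_assoc]
      rw [integral_const_mul]
      rw [show (∫ z : EuclideanSpace ℂ (Fin d), (starRingEnd ℂ) (∏ i, z i ^ k i) * g z
        ∂bergmanMeasure d n) = 0 from h k, mul_zero]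
    · intro k _
      simp_rw [mul_assoc]
      exact (hmulint (fun z => ∏ i, z i ^ k i) (by fun_prop)).const_mul _
  -- rotation by a scalar of modulus one
  let c : ℝ → Fin d → Circle := fun θ _ => Circle.exp θ
  have hc : ∀ θ z, coordRotation (c θ) z = circleMap 0 1 θ • z := by
    intro θ z
    ext i
    simp [coordRotation_apply, c, circleMap, Circle.coe_exp]
  have hmp : MeasurePreserving
      (fun x : ℝ × EuclideanSpace ℂ (Fin d) => (x.1, circleMap 0 1 x.1 • x.2))
      ((volume.restrict (Set.Icc 0 (2 * Real.pi))).prod (bergmanMeasure d n))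
      ((volume.restrict (Set.Icc 0 (2 * Real.pi))).prod (bergmanMeasure d n)) := by
    refine (MeasurePreserving.id _).skew_product (g := fun θ z => circleMap 0 1 θ • z) ?_ ?_
    · have := continuous_circleMap 0 1
      exact (by fun_prop : Continuous
        (fun x : ℝ × EuclideanSpace ℂ (Fin d) => circleMap 0 1 x.1 • x.2)).measurable
    · refine Eventually.of_forall fun θ => ?_
      simp_rw [← hc]
      exact (measurePreserving_bergmanMeasure n (coordRotation (c θ))).map_eq
  -- `∫ G` vanishes; averaging `G` over rotations and exchanging the integrals turns it into the
  -- integral of `‖homogeneousPart g m z‖ ^ 2`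
  have hint : Integrable (Function.uncurry fun θ z => G (circleMap 0 1 θ • z))
      ((volume.restrict (Set.Icc 0 (2 * Real.pi))).prod (bergmanMeasure d n)) :=
    (hmp.integrable_comp (hGi.comp_snd _).aestronglyMeasurable).2 (hGi.comp_snd _)
  have hswap := integral_integral_swap hint
  have hleft : ∀ θ, ∫ z, G (circleMap 0 1 θ • z) ∂bergmanMeasure d n = 0 := by
    intro θ
    have h1 := (measurePreserving_bergmanMeasure n (coordRotation (c θ))).integral_comp
      (coordRotation (c θ)).toHomeomorph.measurableEmbedding G
    simp_rw [hc] at h1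
    rw [h1, hG0]
  have hright : ∀ z ∈ ball (0 : EuclideanSpace ℂ (Fin d)) 1,
      ∫ θ in Set.Icc 0 (2 * Real.pi), G (circleMap 0 1 θ • z)
        = ((‖homogeneousPart g m z‖ ^ 2 : ℝ) : ℂ) := by
    intro z hz
    have h1 : ∀ θ, G (circleMap 0 1 θ • z) = (starRingEnd ℂ) (homogeneousPart g m z) *
        ((circleMap 0 1 θ ^ m)⁻¹ * g (circleMap 0 1 θ • z)) := by
      intro θ
      have hz' : circleMap 0 1 θ • z ∈ ball (0 : EuclideanSpace ℂ (Fin d)) 1 := by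
        simpa [norm_smul] using hz
      simp only [hG]
      rw [← hq _ hz', homogeneousPart_rotate, map_mul, map_pow]
      have h2 : (starRingEnd ℂ) (circleMap 0 1 θ) = (circleMap 0 1 θ)⁻¹ := by
        rw [Complex.inv_def, Complex.normSq_eq_norm_sq]
        simp
      rw [h2, inv_pow]
      ring
    simp_rw [h1]
    rw [integral_const_mul, ← homogeneousPart, Complex.conj_mul']
    push_cast
    rfl
  have hzero : ∫ z, ‖homogeneousPart g m z‖ ^ 2 ∂bergmanMeasure d n = 0 := by
    have h1 : ∫ z, (∫ θ in Set.Icc 0 (2 * Real.pi), G (circleMap 0 1 θ • z)) ∂bergmanMeasure d n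
        = ∫ z, ((‖homogeneousPart g m z‖ ^ 2 : ℝ) : ℂ) ∂bergmanMeasure d n := by
      refine integral_congr_ae ?_
      filter_upwards [ae_mem_ball_bergmanMeasure d n] with z hz using hright z hz
    rw [← hswap] at h1
    simp only [hleft, integral_zero] at h1
    have h2 := h1.symm.trans (by simp : (0 : ℂ) = ((0 : ℝ) : ℂ))
    rw [integral_complex_ofReal] at h2
    exact_mod_cast h2
  have hae : homogeneousPart g m =ᵐ[bergmanMeasure d n]
      fun z => MvPolynomial.eval (fun i => z i) q := by
    filter_upwards [ae_mem_ball_bergmanMeasure d n] with z hz using hq z hz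
  have hbdd : Integrable (fun z => ‖homogeneousPart g m z‖ ^ 2) (bergmanMeasure d n) := by
    refine Integrable.of_bound ((hqc.aestronglyMeasurable.congr hae.symm).norm.pow 2) (C ^ 2) ?_
    filter_upwards [ae_mem_ball_bergmanMeasure d n] with z hz
    have h1 := hC z (ball_subset_closedBall hz)
    rw [← hq z hz] at h1
    rw [norm_pow, norm_norm]
    gcongr
  rw [integral_eq_zero_iff_of_nonneg (fun z => by positivity) hbdd] at hzero
  have h1 := ae_restrict_of_ae_bergmanMeasure hzero
  have h2 : homogeneousPart g m =ᵐ[volume.restrict (ball 0 1)] fun _ => 0 := by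
    filter_upwards [h1] with z hz
    simpa using hz
  exact Measure.eqOn_open_of_ae_eq h2 isOpen_ball hpd.continuousOn continuousOn_const

theorem exists_holomorphic_representative {d n : ℕ} (f : BergmanSpace d n) :
    ∃ g : EuclideanSpace ℂ (Fin d) → ℂ, DifferentiableOn ℂ g (ball 0 1) ∧
      bergmanInclusion d n f =ᵐ[bergmanMeasure d n] g :=
  f.2

/-- The normalized monomials as a Hilbert basis of the Bergman space. -/
noncomputable def monomialBasis {d n : ℕ} (hd : 1 ≤ d) (hn : d ≤ n) :
    HilbertBasis (Fin d → ℕ) ℂ (BergmanSpace d n) :=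
  HilbertBasis.mkOfOrthogonalEqBot (orthonormal_bergmanMonomial hd hn) <| by
    rw [Submodule.eq_bot_iff]
    intro f hf
    obtain ⟨g, hg, hfg⟩ := exists_holomorphic_representative f
    have hgL : MemLp g 2 (bergmanMeasure d n) := (memLp_congr_ae hfg).1 (Lp.memLp _)
    have h0 := eq_zero_of_integral_conj_monomial_eq_zero hg hgL fun k => by
      have h1 : inner ℂ (bergmanMonomial d n k) f = 0 :=
        (Submodule.mem_orthogonal _ f).1 hf _ (Submodule.subset_span ⟨k, rfl⟩)
      rw [inner_bergmanSpace] at h1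
      set a : ℝ := Real.sqrt (((∑ i, k i) + n).factorial / ((∏ i, (k i).factorial) * n.factorial))
        with ha
      have ha0 : (a : ℂ) ≠ 0 := by
        have h2 : 0 < ∏ i, ((k i).factorial : ℝ) :=
          Finset.prod_pos fun i _ => by exact_mod_cast (k i).factorial_pos
        have : 0 < a := Real.sqrt_pos.2 (by positivity)
        exact_mod_cast this.ne'
      have h2 : (∫ z, (starRingEnd ℂ) (bergmanInclusion d n (bergmanMonomial d n k) z) *
          bergmanInclusion d n f z ∂bergmanMeasure d n)
          = ∫ z, (a : ℂ) * ((starRingEnd ℂ) (∏ i, z i ^ k i) * g z) ∂bergmanMeasure d n := by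
        refine integral_congr_ae ?_
        filter_upwards [coeFn_bergmanMonomial d n k, hfg] with z hz hz'
        rw [hz, hz', monomialFun, map_mul, Complex.conj_ofReal, mul_assoc]
      rw [h2, integral_const_mul] at h1
      exact (mul_eq_zero.1 h1).resolve_left ha0
    have h1 : bergmanInclusion d n f = 0 := by
      rw [Lp.eq_zero_iff_ae_eq_zero]
      filter_upwards [hfg, ae_mem_ball_bergmanMeasure d n] with z hz hz'
      rw [hz, h0 z hz']
      rfl
    exact Subtype.ext h1

theorem coe_monomialBasis {d n : ℕ} (hd : 1 ≤ d) (hn : d ≤ n) :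
    ⇑(monomialBasis hd hn) = bergmanMonomial d n :=
  HilbertBasis.coe_mkOfOrthogonalEqBot _ _

/-! ### Matrices of operators in a Hilbert basis -/

namespace HilbertBasis

variable {ι H : Type*} [NormedAddCommGroup H] [InnerProductSpace ℂ H]

theorem hasSum_norm_inner_sq (b : HilbertBasis ι ℂ H) (x : H) :
    HasSum (fun i => ‖inner ℂ (b i) x‖ ^ 2) (‖x‖ ^ 2) := by
  have h := (Complex.hasSum_re (b.hasSum_inner_mul_inner x x))
  convert h using 1
  · funext i
    rw [← inner_conj_symm x (b i), Complex.conj_mul', ← Complex.ofReal_pow, Complex.ofReal_re]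
  · rw [inner_self_eq_norm_sq_to_K, ← RCLike.ofReal_pow]
    rfl

theorem ext_inner (b : HilbertBasis ι ℂ H) {x y : H}
    (h : ∀ i, inner ℂ (b i) x = inner ℂ (b i) y) : x = y := by
  refine b.repr.injective ?_
  ext i
  rw [b.repr_apply_apply, b.repr_apply_apply, h]

theorem ext_matrix (b : HilbertBasis ι ℂ H) {S T : H →L[ℂ] H}
    (h : ∀ i j, inner ℂ (b j) (S (b i)) = inner ℂ (b j) (T (b i))) : S = T := by
  have h1 : ∀ i, S (b i) = T (b i) := fun i => b.ext_inner (h i)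
  refine ContinuousLinearMap.ext_on
    (Submodule.dense_iff_topologicalClosure_eq_top.2 b.dense_span) ?_
  rintro _ ⟨i, rfl⟩
  exact h1 i

/-- The orthogonal projection onto the span of finitely many basis vectors. -/
noncomputable def truncation (b : HilbertBasis ι ℂ H) (s : Finset ι) : H →L[ℂ] H :=
  ∑ i ∈ s, InnerProductSpace.rankOne ℂ (b i) (b i)

theorem truncation_apply (b : HilbertBasis ι ℂ H) (s : Finset ι) (x : H) :
    b.truncation s x = ∑ i ∈ s, inner ℂ (b i) x • b i := by
  simp [truncation]

theorem tendsto_truncation_apply (b : HilbertBasis ι ℂ H) (x : H) :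
    Tendsto (fun s => b.truncation s x) atTop (𝓝 x) := by
  have h := b.hasSum_repr x
  simp only [b.repr_apply_apply] at h
  simp only [truncation_apply]
  exact h

variable [CompleteSpace H]

/-- The norm of an operator that is diagonal in an orthonormal basis is at most the supremum of its
entries. -/
theorem norm_le_of_diagonal (b : HilbertBasis ι ℂ H) {D : H →L[ℂ] H} {a : ι → ℂ} {c : ℝ}
    (hc : 0 ≤ c) (hD : ∀ i, D (b i) = a i • b i) (ha : ∀ i, ‖a i‖ ≤ c) : ‖D‖ ≤ c := by
  classical
  have hon := orthonormal_iff_ite.1 b.orthonormal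
  have hadj : ∀ i, ContinuousLinearMap.adjoint D (b i) = (starRingEnd ℂ) (a i) • b i := by
    intro i
    refine b.ext_inner fun j => ?_
    rw [ContinuousLinearMap.adjoint_inner_right, hD, inner_smul_left, inner_smul_right, hon]
    split_ifs with h
    · rw [h]
    · simp
  refine D.opNorm_le_bound hc fun x => ?_
  have h1 : ∀ i, inner ℂ (b i) (D x) = a i * inner ℂ (b i) x := by
    intro i
    rw [← ContinuousLinearMap.adjoint_inner_left, hadj, inner_smul_left, Complex.conj_conj]
  have h2 : ‖D x‖ ^ 2 ≤ c ^ 2 * ‖x‖ ^ 2 := by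
    refine hasSum_le (fun i => ?_) (b.hasSum_norm_inner_sq (D x))
      ((b.hasSum_norm_inner_sq x).mul_left (c ^ 2))
    rw [h1, norm_mul, mul_pow]
    gcongr
    exact ha i
  rw [← mul_pow] at h2
  exact (pow_le_pow_iff_left₀ (norm_nonneg _) (by positivity) two_ne_zero).1 h2

theorem norm_one_sub_truncation_le (b : HilbertBasis ι ℂ H) (s : Finset ι) :
    ‖(1 : H →L[ℂ] H) - b.truncation s‖ ≤ 1 := by
  classical
  refine b.norm_le_of_diagonal (a := fun i => if i ∈ s then 0 else 1) zero_le_one (fun i => ?_)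
    (fun i => by split_ifs <;> simp)
  rw [sub_apply, truncation_apply, one_apply_eq_self]
  simp only [orthonormal_iff_ite.1 b.orthonormal, ite_smul, one_smul, zero_smul,
    Finset.sum_ite_eq']
  split_ifs <;> simp

/-- A compact operator is a norm limit of its finite-rank truncations. -/
theorem exists_norm_sub_truncation_comp_le (b : HilbertBasis ι ℂ H) {T : H →L[ℂ] H}
    (hT : IsCompactOperator T) {ε : ℝ} (hε : 0 < ε) :
    ∃ s : Finset ι, ‖T - b.truncation s ∘L T‖ ≤ ε := by
  have hK : TotallyBounded (T '' closedBall 0 1) :=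
    (hT.isCompact_closure_image_closedBall 1).totallyBounded.subset subset_closure
  obtain ⟨t, htf, hcov⟩ := Metric.totallyBounded_iff.1 hK (ε / 2) (half_pos hε)
  have hev : ∀ᶠ s in (atTop : Filter (Finset ι)), ∀ y ∈ t, dist (b.truncation s y) y < ε / 2 :=
    (Filter.eventually_all_finite htf).2 fun y _ =>
      Metric.tendsto_nhds.1 (b.tendsto_truncation_apply y) _ (half_pos hε)
  obtain ⟨s, hs⟩ := hev.exists
  refine ⟨s, ContinuousLinearMap.opNorm_le_of_unit_norm hε.le fun x hx => ?_⟩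
  obtain ⟨y, hyt, hy⟩ := Set.mem_iUnion₂.1 (hcov ⟨x, by simp [hx], rfl⟩)
  have h1 : (T - b.truncation s ∘L T) x
      = ((1 : H →L[ℂ] H) - b.truncation s) (T x - y) + (y - b.truncation s y) := by
    simp only [sub_apply, ContinuousLinearMap.comp_apply, one_apply_eq_self, map_sub]
    abel
  rw [h1]
  refine (norm_add_le _ _).trans ?_
  have h2 := ((1 : H →L[ℂ] H) - b.truncation s).le_of_opNorm_le (b.norm_one_sub_truncation_le s)
    (T x - y)
  have h3 := hs y hyt
  rw [dist_comm, dist_eq_norm] at h3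
  rw [mem_ball, dist_eq_norm] at hy
  linarith

/-- Quadratic forms of compact operators vanish along bounded weakly null sequences. -/
theorem tendsto_inner_compact (b : HilbertBasis ι ℂ H) {T : H →L[ℂ] H}
    (hT : IsCompactOperator T) {x : ℕ → H} (hx : ∀ m, ‖x m‖ ≤ 1)
    (hw : ∀ i, Tendsto (fun m => inner ℂ (b i) (x m)) atTop (𝓝 0)) :
    Tendsto (fun m => inner ℂ (x m) (T (x m))) atTop (𝓝 0) := by
  rw [Metric.tendsto_nhds]
  intro ε hε
  obtain ⟨s, hs⟩ := b.exists_norm_sub_truncation_comp_le hT (half_pos hε)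
  have hfin : Tendsto (fun m => ∑ i ∈ s, ‖inner ℂ (b i) (x m)‖ * ‖T‖) atTop (𝓝 0) := by
    have : Tendsto (fun m => ∑ i ∈ s, ‖inner ℂ (b i) (x m)‖ * ‖T‖) atTop
        (𝓝 (∑ i ∈ s, ‖(0 : ℂ)‖ * ‖T‖)) :=
      tendsto_finsetSum _ fun i _ => ((hw i).norm).mul_const _
    simpa using this
  filter_upwards [hfin.eventually (gt_mem_nhds (half_pos hε))] with m hm
  rw [dist_zero_right]
  have h1 : inner ℂ (x m) (T (x m)) = inner ℂ (x m) ((T - b.truncation s ∘L T) (x m)) +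
      ∑ i ∈ s, inner ℂ (b i) (T (x m)) * inner ℂ (x m) (b i) := by
    simp only [sub_apply, ContinuousLinearMap.comp_apply, inner_sub_right, truncation_apply,
      inner_sum, inner_smul_right]
    ring
  have h2 : ‖inner ℂ (x m) ((T - b.truncation s ∘L T) (x m))‖ ≤ ε / 2 := by
    refine (norm_inner_le_norm _ _).trans ?_
    have h3 := (T - b.truncation s ∘L T).le_of_opNorm_le hs (x m)
    nlinarith [hx m, norm_nonneg (x m), norm_nonneg ((T - b.truncation s ∘L T) (x m))]
  have h3 : ‖∑ i ∈ s, inner ℂ (b i) (T (x m)) * inner ℂ (x m) (b i)‖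
      ≤ ∑ i ∈ s, ‖inner ℂ (b i) (x m)‖ * ‖T‖ := by
    refine (norm_sum_le _ _).trans (Finset.sum_le_sum fun i _ => ?_)
    rw [norm_mul, norm_inner_symm (x m), mul_comm]
    gcongr
    refine (norm_inner_le_norm _ _).trans ?_
    rw [b.orthonormal.1 i, one_mul]
    refine (T.le_opNorm _).trans ?_
    nlinarith [hx m, norm_nonneg T]
  rw [h1]
  linarith [norm_add_le (inner ℂ (x m) ((T - b.truncation s ∘L T) (x m)))
    (∑ i ∈ s, inner ℂ (b i) (T (x m)) * inner ℂ (x m) (b i))]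

/-- An operator with absolutely summable matrix entries is the norm-convergent sum of the
corresponding multiples of the matrix units. -/
theorem hasSum_matrix_smul_rankOne (b : HilbertBasis ι ℂ H) {T : H →L[ℂ] H}
    (hT : Summable fun p : ι × ι => ‖inner ℂ (b p.2) (T (b p.1))‖) :
    HasSum (fun p : ι × ι => inner ℂ (b p.2) (T (b p.1)) •
      InnerProductSpace.rankOne ℂ (b p.2) (b p.1)) T := by
  classical
  have hon := orthonormal_iff_ite.1 b.orthonormal
  have hs : Summable fun p : ι × ι => inner ℂ (b p.2) (T (b p.1)) •
      InnerProductSpace.rankOne ℂ (b p.2) (b p.1) := by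
    refine Summable.of_norm (hT.congr fun p => ?_)
    rw [norm_smul, InnerProductSpace.norm_rankOne, b.orthonormal.1, b.orthonormal.1]
    ring
  have h1 : (∑' p : ι × ι, inner ℂ (b p.2) (T (b p.1)) •
      InnerProductSpace.rankOne ℂ (b p.2) (b p.1)) = T := by
    refine b.ext_matrix fun i j => ?_
    let Φ : (H →L[ℂ] H) →L[ℂ] ℂ :=
      (innerSL ℂ (b j)).comp (ContinuousLinearMap.apply ℂ H (b i))
    have h2 := hs.hasSum.mapL Φ
    have h3 : ∀ p : ι × ι, Φ (inner ℂ (b p.2) (T (b p.1)) •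
        InnerProductSpace.rankOne ℂ (b p.2) (b p.1))
        = if p = (i, j) then inner ℂ (b j) (T (b i)) else 0 := by
      rintro ⟨k, l⟩
      simp only [Φ, ContinuousLinearMap.comp_apply, ContinuousLinearMap.apply_apply,
        smul_apply, InnerProductSpace.rankOne_apply, innerSL_apply_apply, inner_smul_right, hon,
        Prod.mk.injEq]
      by_cases hk : k = i <;> by_cases hl : j = l <;> simp [hk, hl, eq_comm]
    simp_rw [h3] at h2
    exact h2.unique (hasSum_ite_eq (i, j) _)
  have h2 := hs.hasSum
  rwa [h1] at h2

theorem norm_le_tsum_matrix (b : HilbertBasis ι ℂ H) {T : H →L[ℂ] H}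
    (hT : Summable fun p : ι × ι => ‖inner ℂ (b p.2) (T (b p.1))‖) :
    ‖T‖ ≤ ∑' p : ι × ι, ‖inner ℂ (b p.2) (T (b p.1))‖ := by
  have h := b.hasSum_matrix_smul_rankOne hT
  have h1 : ∀ p : ι × ι, ‖inner ℂ (b p.2) (T (b p.1)) •
      InnerProductSpace.rankOne ℂ (b p.2) (b p.1)‖ = ‖inner ℂ (b p.2) (T (b p.1))‖ := by
    intro p
    rw [norm_smul, InnerProductSpace.norm_rankOne, b.orthonormal.1, b.orthonormal.1]
    ring
  have h2 := norm_tsum_le_tsum_norm (f := fun p : ι × ι => inner ℂ (b p.2) (T (b p.1)) •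
      InnerProductSpace.rankOne ℂ (b p.2) (b p.1)) (hT.congr fun p => (h1 p).symm)
  rw [h.tsum_eq] at h2
  simpa only [h1] using h2

end HilbertBasis

/-! ### Toeplitz operators and a positive splitting -/

theorem extendZero_apply {d : ℕ} (φ : C(closedBall (0 : EuclideanSpace ℂ (Fin d)) 1, ℂ))
    {z : EuclideanSpace ℂ (Fin d)} (hz : z ∈ closedBall (0 : EuclideanSpace ℂ (Fin d)) 1) :
    extendZero φ z = φ ⟨z, hz⟩ :=
  Subtype.val_injective.extend_apply (⇑φ) 0 (⟨z, hz⟩ : closedBall _ 1)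

theorem coeFn_mulOperator {d n : ℕ} (φ : C(closedBall (0 : EuclideanSpace ℂ (Fin d)) 1, ℂ))
    (f : Lp ℂ 2 (bergmanMeasure d n)) :
    mulOperator n φ f =ᵐ[bergmanMeasure d n] fun z => extendZero φ z * f z :=
  (memLp_mul φ f).coeFn_toLp

theorem inner_toeplitz {d n : ℕ} (φ : C(closedBall (0 : EuclideanSpace ℂ (Fin d)) 1, ℂ))
    (f g : BergmanSpace d n) :
    inner ℂ f (toeplitz n φ g) = ∫ z, (starRingEnd ℂ) (bergmanInclusion d n f z) *
      (extendZero φ z * bergmanInclusion d n g z) ∂bergmanMeasure d n := by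
  have h1 : inner ℂ f (toeplitz n φ g)
      = inner ℂ (bergmanInclusion d n f) (mulOperator n φ (bergmanInclusion d n g)) :=
    (bergmanSubspace d n).inner_orthogonalProjectionOnto_eq_of_mem_left f _
  rw [h1, L2.inner_def]
  refine integral_congr_ae ?_
  filter_upwards [coeFn_mulOperator φ (bergmanInclusion d n g)] with z hz
  rw [hz, RCLike.inner_apply, mul_comm]

theorem bergmanInclusion_toeplitz_of_mem {d n : ℕ}
    (φ : C(closedBall (0 : EuclideanSpace ℂ (Fin d)) 1, ℂ)) (f g : BergmanSpace d n)
    (h : bergmanInclusion d n g =ᵐ[bergmanMeasure d n]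
      fun z => extendZero φ z * bergmanInclusion d n f z) :
    toeplitz n φ f = g := by
  have h1 : mulOperator n φ (bergmanInclusion d n f) = bergmanInclusion d n g := by
    refine Lp.ext ?_
    exact (coeFn_mulOperator φ _).trans h.symm
  change bergmanProjection d n (mulOperator n φ (bergmanInclusion d n f)) = g
  rw [h1]
  exact (bergmanSubspace d n).orthogonalProjectionOnto_mem_subspace_eq_self g

theorem toeplitz_add {d : ℕ} (n : ℕ) (φ ψ : C(closedBall (0 : EuclideanSpace ℂ (Fin d)) 1, ℂ)) :
    toeplitz n (φ + ψ) = toeplitz n φ + toeplitz n ψ := by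
  have h : mulOperator n (φ + ψ) = mulOperator n φ + mulOperator n ψ := by
    ext1 f
    refine Lp.ext ?_
    rw [add_apply]
    filter_upwards [coeFn_mulOperator (φ + ψ) f, coeFn_mulOperator φ f, coeFn_mulOperator ψ f,
      Lp.coeFn_add (mulOperator n φ f) (mulOperator n ψ f), ae_mem_ball_bergmanMeasure d n]
      with z h1 h2 h3 h4 h5
    have h6 := ball_subset_closedBall h5
    rw [h4, Pi.add_apply, h1, h2, h3, extendZero_apply _ h6, extendZero_apply _ h6,
      extendZero_apply _ h6, ContinuousMap.add_apply, add_mul]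
  rw [toeplitz, h, ContinuousLinearMap.add_comp, ContinuousLinearMap.comp_add]
  rfl

theorem toeplitz_smul {d : ℕ} (n : ℕ) (c : ℂ)
    (φ : C(closedBall (0 : EuclideanSpace ℂ (Fin d)) 1, ℂ)) :
    toeplitz n (c • φ) = c • toeplitz n φ := by
  have h : mulOperator n (c • φ) = c • mulOperator n φ := by
    ext1 f
    refine Lp.ext ?_
    rw [smul_apply]
    filter_upwards [coeFn_mulOperator (c • φ) f, coeFn_mulOperator φ f,
      Lp.coeFn_smul c (mulOperator n φ f), ae_mem_ball_bergmanMeasure d n] with z h1 h2 h3 h4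
    have h5 := ball_subset_closedBall h4
    rw [h3, Pi.smul_apply, h1, h2, extendZero_apply _ h5, extendZero_apply _ h5,
      ContinuousMap.smul_apply, smul_eq_mul, smul_eq_mul, mul_assoc]
  rw [toeplitz, h, ContinuousLinearMap.smul_comp, ContinuousLinearMap.comp_smul]
  rfl

theorem toeplitz_one (d n : ℕ) :
    toeplitz n (1 : C(closedBall (0 : EuclideanSpace ℂ (Fin d)) 1, ℂ)) = 1 := by
  ext1 f
  refine bergmanInclusion_toeplitz_of_mem 1 f f ?_
  filter_upwards [ae_mem_ball_bergmanMeasure d n] with z hz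
  rw [extendZero_apply _ (ball_subset_closedBall hz), ContinuousMap.one_apply, one_mul]

theorem toeplitz_isPositive {d : ℕ} (n : ℕ)
    {φ : C(closedBall (0 : EuclideanSpace ℂ (Fin d)) 1, ℂ)}
    (hφ : ∀ z, ∃ r : ℝ, 0 ≤ r ∧ φ z = r) : (toeplitz n φ).IsPositive := by
  rw [ContinuousLinearMap.isPositive_iff_complex]
  intro f
  have h1 : inner ℂ f (toeplitz n φ f) = ((∫ z, (extendZero φ z).re *
      ‖bergmanInclusion d n f z‖ ^ 2 ∂bergmanMeasure d n : ℝ) : ℂ) := by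
    rw [inner_toeplitz, ← integral_complex_ofReal]
    refine integral_congr_ae ?_
    filter_upwards [ae_mem_ball_bergmanMeasure d n] with z hz
    obtain ⟨r, -, hr⟩ := hφ ⟨z, ball_subset_closedBall hz⟩
    rw [extendZero_apply _ (ball_subset_closedBall hz), hr, Complex.ofReal_re,
      mul_left_comm, Complex.conj_mul']
    push_cast
    rfl
  have h2 : inner ℂ (toeplitz n φ f) f = ((∫ z, (extendZero φ z).re *
      ‖bergmanInclusion d n f z‖ ^ 2 ∂bergmanMeasure d n : ℝ) : ℂ) := by
    rw [← inner_conj_symm, h1, Complex.conj_ofReal]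
  rw [h2]
  refine ⟨by simp, ?_⟩
  simp only [RCLike.re_to_complex, Complex.ofReal_re]
  refine integral_nonneg_of_ae ?_
  filter_upwards [ae_mem_ball_bergmanMeasure d n] with z hz
  obtain ⟨r, hr0, hr⟩ := hφ ⟨z, ball_subset_closedBall hz⟩
  rw [extendZero_apply _ (ball_subset_closedBall hz), hr, Complex.ofReal_re]
  positivity

theorem toeplitz_mem_toeplitzAlgebra {d : ℕ} (n : ℕ)
    (φ : C(closedBall (0 : EuclideanSpace ℂ (Fin d)) 1, ℂ)) :
    toeplitz n φ ∈ toeplitzAlgebra d n :=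
  StarSubalgebra.le_topologicalClosure _ (StarAlgebra.subset_adjoin ℂ _ ⟨φ, rfl⟩)

/-- The radial retraction of `E \ {0}` onto the unit sphere, with the value `x₀` at the origin. -/
noncomputable def sphereRetract {E : Type*} [NormedAddCommGroup E] [NormedSpace ℝ E]
    (x₀ : sphere (0 : E) 1) (z : E) : sphere (0 : E) 1 :=
  open Classical in
  if h : z = 0 then x₀ else ⟨‖z‖⁻¹ • z, by
    rw [mem_sphere_zero_iff_norm, norm_smul, norm_inv, norm_norm,
      inv_mul_cancel₀ (norm_ne_zero_iff.2 h)]⟩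

theorem continuousAt_sphereRetract {E : Type*} [NormedAddCommGroup E] [NormedSpace ℝ E]
    (x₀ : sphere (0 : E) 1) {z : E} (hz : z ≠ 0) : ContinuousAt (sphereRetract x₀) z := by
  rw [Topology.IsInducing.subtypeVal.continuousAt_iff]
  have h1 : ContinuousAt (fun z : E => ‖z‖⁻¹ • z) z :=
    (continuous_norm.continuousAt.inv₀ (norm_ne_zero_iff.2 hz)).smul continuousAt_id
  refine h1.congr ?_
  filter_upwards [isOpen_compl_singleton.mem_nhds hz] with y hy
  have hy' : y ≠ 0 := hy
  simp [sphereRetract, hy']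

/-- The extension `z ↦ ‖z‖ f (z / ‖z‖) + (1 - ‖z‖) f (x₀)` of a continuous function from the sphere
to the closed ball: it is linear and positive in `f`, preserves constants and is continuous at the
origin. -/
noncomputable def sphereExtension {E : Type*} [NormedAddCommGroup E] [NormedSpace ℝ E]
    [ProperSpace E]
    (x₀ : sphere (0 : E) 1) : C(sphere (0 : E) 1, ℂ) →ₗ[ℂ] C(closedBall (0 : E) 1, ℂ) where
  toFun f :=
    ⟨fun z => (‖z.1‖ : ℂ) * f (sphereRetract x₀ z.1) + (1 - (‖z.1‖ : ℂ)) * f x₀, by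
      have hc : Continuous fun z : E => (‖z‖ : ℂ) * (f (sphereRetract x₀ z) - f x₀) + f x₀ := by
        refine Continuous.add ?_ continuous_const
        rw [continuous_iff_continuousAt]
        intro z
        by_cases hz : z = 0
        · subst hz
          have h1 : Tendsto (fun z : E => ‖z‖ * (‖f‖ + ‖f‖)) (𝓝 0) (𝓝 0) := by
            have : Continuous fun z : E => ‖z‖ * (‖f‖ + ‖f‖) := by fun_prop
            simpa using this.tendsto 0
          rw [ContinuousAt, norm_zero, Complex.ofReal_zero, zero_mul]
          refine squeeze_zero_norm (fun z => ?_) h1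
          rw [norm_mul, Complex.norm_real, norm_norm]
          gcongr
          exact (norm_sub_le _ _).trans
            (add_le_add (f.norm_coe_le_norm _) (f.norm_coe_le_norm _))
        · refine ContinuousAt.mul (by fun_prop) (ContinuousAt.sub ?_ continuousAt_const)
          exact f.continuous.continuousAt.comp (continuousAt_sphereRetract x₀ hz)
      refine (hc.comp continuous_subtype_val).congr fun z => ?_
      simp only [Function.comp_apply]
      ring⟩
  map_add' f g := by
    ext z
    simp only [ContinuousMap.coe_mk, ContinuousMap.add_apply]
    ring
  map_smul' c f := by
    ext z
    simp only [ContinuousMap.coe_mk, ContinuousMap.smul_apply, smul_eq_mul, RingHom.id_apply]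
    ring

theorem sphereExtension_apply {E : Type*} [NormedAddCommGroup E] [NormedSpace ℝ E] [ProperSpace E]
    (x₀ : sphere (0 : E) 1) (f : C(sphere (0 : E) 1, ℂ)) (z : closedBall (0 : E) 1) :
    sphereExtension x₀ f z
      = (‖z.1‖ : ℂ) * f (sphereRetract x₀ z.1) + (1 - (‖z.1‖ : ℂ)) * f x₀ := rfl

theorem sphereExtension_apply_sphere {E : Type*} [NormedAddCommGroup E] [NormedSpace ℝ E]
    [ProperSpace E] (x₀ : sphere (0 : E) 1) (f : C(sphere (0 : E) 1, ℂ)) (x : sphere (0 : E) 1) :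
    sphereExtension x₀ f ⟨x, sphere_subset_closedBall x.2⟩ = f x := by
  have hx : ‖x.1‖ = 1 := mem_sphere_zero_iff_norm.1 x.2
  have hx0 : x.1 ≠ 0 := by
    intro h
    rw [h, norm_zero] at hx
    exact zero_ne_one hx
  have h1 : sphereRetract x₀ x.1 = x := by
    apply Subtype.ext
    simp [sphereRetract, hx0, hx]
  rw [sphereExtension_apply, h1, hx]
  simp

/-- The Toeplitz operators of the positive extensions of symbols form a positive unital splitting of
the symbol map. -/
theorem exists_isPositiveUnitalSplitting {d : ℕ} (n : ℕ) (hd : 1 ≤ d) :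
    ∃ σ : C(sphere (0 : EuclideanSpace ℂ (Fin d)) 1, ℂ) →ₗ[ℂ] toeplitzAlgebra d n,
      IsPositiveUnitalSplitting σ := by
  have x₀ : sphere (0 : EuclideanSpace ℂ (Fin d)) 1 :=
    ⟨EuclideanSpace.single ⟨0, hd⟩ 1, by simp⟩
  let σ : C(sphere (0 : EuclideanSpace ℂ (Fin d)) 1, ℂ) →ₗ[ℂ] toeplitzAlgebra d n :=
    { toFun := fun f => ⟨toeplitz n (sphereExtension x₀ f), toeplitz_mem_toeplitzAlgebra n _⟩
      map_add' := fun f g => Subtype.ext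
        ((congrArg (toeplitz n) (map_add (sphereExtension x₀) f g)).trans (toeplitz_add n _ _))
      map_smul' := fun c f => Subtype.ext
        ((congrArg (toeplitz n) (map_smul (sphereExtension x₀) c f)).trans
          (toeplitz_smul n c _)) }
  refine ⟨σ, ⟨Subtype.ext ?_, fun f hf => toeplitz_isPositive n fun z => ?_, fun f => ?_⟩⟩
  · have h1 : sphereExtension x₀ 1 = 1 := by
      ext z
      simp [sphereExtension_apply]
    change toeplitz n (sphereExtension x₀ 1) = 1
    rw [h1, toeplitz_one]
  · have hz : ‖z.1‖ ≤ 1 := mem_closedBall_zero_iff.1 z.2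
    refine ⟨‖z.1‖ * f (sphereRetract x₀ z.1) + (1 - ‖z.1‖) * f x₀, ?_, ?_⟩
    · have h1 := hf (sphereRetract x₀ z.1)
      have h2 := hf x₀
      have h3 : 0 ≤ 1 - ‖z.1‖ := sub_nonneg.2 hz
      positivity
    · rw [sphereExtension_apply]
      push_cast
      rfl
  · refine ⟨sphereExtension x₀ f, sphereExtension_apply_sphere x₀ f, ?_⟩
    change IsCompactOperator (toeplitz n (sphereExtension x₀ f) - toeplitz n (sphereExtension x₀ f) :
      BergmanSpace d n →L[ℂ] BergmanSpace d n)
    rw [sub_self]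
    exact isCompactOperator_zero

/-! ### Rank-one operators in the Toeplitz algebra -/

/-- The multiplier `1 - ‖z‖ ^ 2` on the closed ball. -/
noncomputable def radialSymbol (d : ℕ) : C(closedBall (0 : EuclideanSpace ℂ (Fin d)) 1, ℂ) :=
  ⟨fun z => ((1 - ‖z.1‖ ^ 2 : ℝ) : ℂ), by fun_prop⟩

/-- `T_{1 - ‖z‖²}` is diagonal in the monomial basis. -/
theorem toeplitz_radialSymbol_bergmanMonomial {d n : ℕ} (hd : 1 ≤ d) (hn : d ≤ n)
    (k : Fin d → ℕ) :
    toeplitz n (radialSymbol d) (bergmanMonomial d n k)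
      = (((n - d : ℕ) + 1 : ℂ) / ((∑ i, k i : ℕ) + n + 1)) • bergmanMonomial d n k := by
  refine (monomialBasis hd hn).ext_inner fun l => ?_
  rw [coe_monomialBasis, inner_smul_right,
    orthonormal_iff_ite.1 (orthonormal_bergmanMonomial hd hn), inner_toeplitz]
  have h1 : (∫ z, (starRingEnd ℂ) (bergmanInclusion d n (bergmanMonomial d n l) z) *
      (extendZero (radialSymbol d) z * bergmanInclusion d n (bergmanMonomial d n k) z)
        ∂bergmanMeasure d n)
      = ∫ z, (starRingEnd ℂ) (monomialFun d n l z) * monomialFun d n k z *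
        ((1 - ‖z‖ ^ 2 : ℝ) : ℂ) ∂bergmanMeasure d n := by
    refine integral_congr_ae ?_
    filter_upwards [coeFn_bergmanMonomial d n k, coeFn_bergmanMonomial d n l,
      ae_mem_ball_bergmanMeasure d n] with z h1 h2 h3
    rw [h1, h2, extendZero_apply _ (ball_subset_closedBall h3)]
    simp only [radialSymbol, ContinuousMap.coe_mk]
    ring
  rw [h1]
  split_ifs with h
  · subst h
    have h2 := integral_norm_monomialFun_sq_mul hd hn l 1
    have h3 : ∀ z, (starRingEnd ℂ) (monomialFun d n l z) * monomialFun d n l z *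
        ((1 - ‖z‖ ^ 2 : ℝ) : ℂ) = ((‖monomialFun d n l z‖ ^ 2 * (1 - ‖z‖ ^ 2) ^ 1 : ℝ) : ℂ) := by
      intro z
      rw [Complex.conj_mul']
      push_cast
      ring
    simp_rw [h3]
    rw [integral_complex_ofReal, h2, Nat.factorial_succ, Nat.factorial_succ]
    have a1 : (((n - d).factorial : ℕ) : ℂ) ≠ 0 := by exact_mod_cast Nat.factorial_ne_zero _
    have a2 : ((((∑ i, l i) + n).factorial : ℕ) : ℂ) ≠ 0 := by
      exact_mod_cast Nat.factorial_ne_zero _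
    have a3 := Nat.cast_add_one_ne_zero (R := ℂ) ((∑ i, l i) + n)
    push_cast at a2 a3 ⊢
    field_simp
  · rw [mul_zero]
    exact integral_conj_monomialFun_mul_of_ne h (fun r => ((1 - r ^ 2 : ℝ) : ℂ))

/-- The projection onto the constants lies in the Toeplitz algebra: it is the limit of the powers of
a multiple of `T_{1 - ‖z‖²}`, a diagonal operator whose largest eigenvalue is attained only at the
constants. -/
theorem rankOne_zero_mem_toeplitzAlgebra {d n : ℕ} (hd : 1 ≤ d) (hn : d ≤ n) :
    InnerProductSpace.rankOne ℂ (bergmanMonomial d n 0) (bergmanMonomial d n 0)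
      ∈ toeplitzAlgebra d n := by
  set b := monomialBasis hd hn with hb
  set B : BergmanSpace d n →L[ℂ] BergmanSpace d n :=
    (((n : ℂ) + 1) / ((n - d : ℕ) + 1)) • toeplitz n (radialSymbol d) with hB
  set μ : (Fin d → ℕ) → ℂ := fun k => ((n : ℂ) + 1) / ((∑ i, k i : ℕ) + n + 1) with hμ
  have hBk : ∀ k, B (bergmanMonomial d n k) = μ k • bergmanMonomial d n k := by
    intro k
    rw [hB, smul_apply, toeplitz_radialSymbol_bergmanMonomial hd hn, smul_smul]
    congr 1
    have a1 : ((n - d : ℕ) : ℂ) + 1 ≠ 0 := Nat.cast_add_one_ne_zero _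
    simp only [hμ]
    field_simp
  have hBm : ∀ m : ℕ, ∀ k, (B ^ m) (bergmanMonomial d n k) = μ k ^ m • bergmanMonomial d n k := by
    intro m k
    induction m with
    | zero => simp
    | succ m ih =>
      rw [pow_succ', show (B * B ^ m) (bergmanMonomial d n k) = B ((B ^ m) (bergmanMonomial d n k))
        from rfl, ih, map_smul, hBk, smul_smul, pow_succ]
  have hμ0 : μ 0 = 1 := by
    have a1 : (n : ℂ) + 1 ≠ 0 := Nat.cast_add_one_ne_zero _
    simp [hμ, div_self a1]
  have hμk : ∀ k, k ≠ 0 → ‖μ k‖ ≤ ((n : ℝ) + 1) / (n + 2) := by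
    intro k hk
    obtain ⟨i, hi⟩ := Function.ne_iff.1 hk
    have h1 : 1 ≤ ∑ i, k i :=
      (Nat.one_le_iff_ne_zero.2 hi).trans (Finset.single_le_sum (f := k) (by simp) (Finset.mem_univ i))
    have h2 : (1 : ℝ) ≤ (∑ i, k i : ℕ) := by exact_mod_cast h1
    have h3 : μ k = ((((n : ℝ) + 1) / ((∑ i, k i : ℕ) + n + 1) : ℝ) : ℂ) := by
      simp only [hμ]
      push_cast
      rfl
    rw [h3, Complex.norm_real, Real.norm_eq_abs, abs_of_nonneg (by positivity)]
    exact div_le_div_of_nonneg_left (by positivity) (by positivity) (by linarith)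
  have hr1 : ((n : ℝ) + 1) / (n + 2) < 1 := by
    rw [div_lt_one (by positivity)]
    linarith
  have hnorm : ∀ m : ℕ, ‖B ^ m - InnerProductSpace.rankOne ℂ (bergmanMonomial d n 0)
      (bergmanMonomial d n 0)‖ ≤ (((n : ℝ) + 1) / (n + 2)) ^ m := by
    intro m
    refine b.norm_le_of_diagonal (a := fun k => if k = 0 then 0 else μ k ^ m) (by positivity)
      (fun k => ?_) (fun k => ?_)
    · rw [hb, coe_monomialBasis, sub_apply, hBm, InnerProductSpace.rankOne_apply,
        orthonormal_iff_ite.1 (orthonormal_bergmanMonomial hd hn)]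
      by_cases hk : k = 0
      · subst hk
        simp [hμ0]
      · simp [hk, Ne.symm hk]
    · by_cases hk : k = 0
      · simp only [hk, if_true, norm_zero]
        positivity
      · simp only [hk, if_false, norm_pow]
        gcongr
        exact hμk k hk
  have hlim : Tendsto (fun m => B ^ m) atTop (𝓝 (InnerProductSpace.rankOne ℂ
      (bergmanMonomial d n 0) (bergmanMonomial d n 0))) := by
    rw [tendsto_iff_norm_sub_tendsto_zero]
    exact squeeze_zero (fun _ => norm_nonneg _) hnorm
      (tendsto_pow_atTop_nhds_zero_of_lt_one (by positivity) hr1)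
  have hcl : IsClosed (toeplitzAlgebra d n : Set (BergmanSpace d n →L[ℂ] BergmanSpace d n)) :=
    StarSubalgebra.isClosed_topologicalClosure _
  refine hcl.mem_of_tendsto hlim (Eventually.of_forall fun m => ?_)
  exact pow_mem (SMulMemClass.smul_mem _ (toeplitz_mem_toeplitzAlgebra n _)) m

theorem monomialFun_zero (d n : ℕ) (z : EuclideanSpace ℂ (Fin d)) : monomialFun d n 0 z = 1 := by
  have : (n.factorial : ℝ) ≠ 0 := by exact_mod_cast n.factorial_ne_zero
  simp [monomialFun, div_self this]

/-- Holomorphic symbols act by multiplication, so `T_{e_k}` maps the constant `1` to `e_k` and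
`e_k ⊗ e_l = T_{e_k} (1 ⊗ 1) T_{e_l}^*`. -/
theorem rankOne_mem_toeplitzAlgebra {d n : ℕ} (hd : 1 ≤ d) (hn : d ≤ n) (k l : Fin d → ℕ) :
    InnerProductSpace.rankOne ℂ (bergmanMonomial d n k) (bergmanMonomial d n l)
      ∈ toeplitzAlgebra d n := by
  let φ : (Fin d → ℕ) → C(closedBall (0 : EuclideanSpace ℂ (Fin d)) 1, ℂ) := fun k =>
    ⟨fun z => monomialFun d n k z.1,
      (differentiable_monomialFun d n k).continuous.comp continuous_subtype_val⟩
  have hφ : ∀ k, toeplitz n (φ k) (bergmanMonomial d n 0) = bergmanMonomial d n k := by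
    intro k
    refine bergmanInclusion_toeplitz_of_mem _ _ _ ?_
    filter_upwards [coeFn_bergmanMonomial d n k, coeFn_bergmanMonomial d n 0,
      ae_mem_ball_bergmanMeasure d n] with z h1 h2 h3
    rw [h1, h2, extendZero_apply _ (ball_subset_closedBall h3), monomialFun_zero, mul_one]
    rfl
  have h : InnerProductSpace.rankOne ℂ (bergmanMonomial d n k) (bergmanMonomial d n l)
      = toeplitz n (φ k) * InnerProductSpace.rankOne ℂ (bergmanMonomial d n 0)
        (bergmanMonomial d n 0) * star (toeplitz n (φ l)) := by
    rw [← hφ k, ← hφ l]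
    ext1 x
    simp [ContinuousLinearMap.star_eq_adjoint, ContinuousLinearMap.adjoint_inner_right]
  rw [h]
  exact mul_mem (mul_mem (toeplitz_mem_toeplitzAlgebra n _)
    (rankOne_zero_mem_toeplitzAlgebra hd hn)) (star_mem (toeplitz_mem_toeplitzAlgebra n _))

/-! ### Compact Toeplitz operators have zero boundary symbol -/

theorem memLp_of_continuous {d n : ℕ} {g : EuclideanSpace ℂ (Fin d) → ℂ} (hg : Continuous g) :
    MemLp g 2 (bergmanMeasure d n) := by
  obtain ⟨C, hC⟩ :=
    (isCompact_closedBall (0 : EuclideanSpace ℂ (Fin d)) 1).exists_bound_of_continuousOn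
      hg.continuousOn
  refine MemLp.of_bound hg.aestronglyMeasurable C ?_
  filter_upwards [ae_mem_ball_bergmanMeasure d n] with z hz
  exact hC z (ball_subset_closedBall hz)

/-- A holomorphic function on the whole space as an element of the Bergman space. -/
noncomputable def bergmanOfDifferentiable (d n : ℕ) {g : EuclideanSpace ℂ (Fin d) → ℂ}
    (hg : Differentiable ℂ g) : BergmanSpace d n :=
  ⟨(memLp_of_continuous hg.continuous).toLp, g, hg.differentiableOn, MemLp.coeFn_toLp _⟩

theorem coeFn_bergmanOfDifferentiable (d n : ℕ) {g : EuclideanSpace ℂ (Fin d) → ℂ}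
    (hg : Differentiable ℂ g) :
    bergmanInclusion d n (bergmanOfDifferentiable d n hg) =ᵐ[bergmanMeasure d n] g :=
  (memLp_of_continuous hg.continuous).coeFn_toLp

theorem continuousOn_extendZero {d : ℕ}
    (φ : C(closedBall (0 : EuclideanSpace ℂ (Fin d)) 1, ℂ)) :
    ContinuousOn (extendZero φ) (closedBall 0 1) := by
  rw [continuousOn_iff_continuous_domRestrict]
  exact φ.continuous.congr fun z => (extendZero_apply φ z.2).symm

/-- The function `(1 + ⟨z, ζ⟩) / 2`, which peaks at the boundary point `ζ`. -/
noncomputable def peakFun {d : ℕ} (ζ z : EuclideanSpace ℂ (Fin d)) : ℂ :=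
  (1 + inner ℂ ζ z) / 2

theorem differentiable_peakFun {d : ℕ} (ζ : EuclideanSpace ℂ (Fin d)) :
    Differentiable ℂ (peakFun ζ) := by
  have h : Differentiable ℂ fun z : EuclideanSpace ℂ (Fin d) => inner ℂ ζ z :=
    (innerSL ℂ ζ).differentiable
  unfold peakFun
  fun_prop

theorem norm_peakFun_sq_le {d : ℕ} {ζ z : EuclideanSpace ℂ (Fin d)} (hζ : ‖ζ‖ = 1)
    (hz : ‖z‖ ≤ 1) : ‖peakFun ζ z‖ ^ 2 ≤ 1 - ‖z - ζ‖ ^ 2 / 4 := by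
  have h1 : ‖(inner ℂ ζ z : ℂ)‖ ≤ 1 := by
    have := norm_inner_le_norm (𝕜 := ℂ) ζ z
    rw [hζ, one_mul] at this
    exact this.trans hz
  have h2 : ‖z - ζ‖ ^ 2 = ‖z‖ ^ 2 - 2 * (inner ℂ ζ z : ℂ).re + 1 := by
    rw [norm_sub_sq (𝕜 := ℂ), hζ, ← inner_conj_symm z ζ, RCLike.conj_re]
    simp
  have h3 : ‖peakFun ζ z‖ ^ 2
      = (1 + 2 * (inner ℂ ζ z : ℂ).re + ‖(inner ℂ ζ z : ℂ)‖ ^ 2) / 4 := by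
    rw [peakFun]
    generalize (inner ℂ ζ z : ℂ) = w
    rw [norm_div, div_pow]
    simp only [Complex.sq_norm, Complex.normSq_add]
    simp
    ring
  rw [h2, h3]
  nlinarith [norm_nonneg (inner ℂ ζ z : ℂ), norm_nonneg z]

theorem peakFun_self {d : ℕ} {ζ : EuclideanSpace ℂ (Fin d)} (hζ : ‖ζ‖ = 1) : peakFun ζ ζ = 1 := by
  rw [peakFun, inner_self_eq_norm_sq_to_K, hζ]
  norm_num

/-- Boundary points of the ball lie in the support of `dV_n`. -/
theorem bergmanMeasure_pos_of_mem_sphere {d : ℕ} (n : ℕ) {ζ : EuclideanSpace ℂ (Fin d)}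
    (hζ : ‖ζ‖ = 1) {u : Set (EuclideanSpace ℂ (Fin d))} (hu : IsOpen u) (hζu : ζ ∈ u) :
    0 < bergmanMeasure d n (u ∩ closedBall 0 1) := by
  rw [pos_iff_ne_zero]
  intro h
  have h1 : ∀ᵐ z ∂bergmanMeasure d n, z ∉ u ∩ closedBall 0 1 := measure_eq_zero_iff_ae_notMem.1 h
  have h2 := ae_restrict_of_ae_bergmanMeasure h1
  have h3 : volume (u ∩ ball (0 : EuclideanSpace ℂ (Fin d)) 1) = 0 := by
    rw [ae_restrict_iff' measurableSet_ball] at h2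
    refine measure_mono_null ?_ (ae_iff.1 h2)
    rintro z ⟨hz1, hz2⟩ hz3
    exact hz3 hz2 ⟨hz1, ball_subset_closedBall hz2⟩
  have hcl : ζ ∈ closure (ball (0 : EuclideanSpace ℂ (Fin d)) 1) := by
    rw [closure_ball _ one_ne_zero]
    simp [hζ]
  exact (hu.inter isOpen_ball).measure_pos volume (mem_closure_iff.1 hcl u hu hζu) |>.ne' h3

/-- The squared moduli of the powers of the peak function, normalized, concentrate at `ζ`. -/
theorem tendsto_integral_peakFun {d : ℕ} (n : ℕ) {ζ : EuclideanSpace ℂ (Fin d)} (hζ : ‖ζ‖ = 1)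
    {E : Type*} [NormedAddCommGroup E] [NormedSpace ℝ E] [CompleteSpace E]
    {g : EuclideanSpace ℂ (Fin d) → E} (hg : ContinuousOn g (closedBall 0 1)) :
    Tendsto (fun m : ℕ => (∫ z, (‖peakFun ζ z‖ ^ 2) ^ m ∂bergmanMeasure d n)⁻¹ •
      ∫ z, (‖peakFun ζ z‖ ^ 2) ^ m • g z ∂bergmanMeasure d n) atTop (𝓝 (g ζ)) := by
  have hr : (bergmanMeasure d n).restrict (closedBall 0 1) = bergmanMeasure d n := by
    refine Measure.restrict_eq_self_of_ae_mem ?_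
    filter_upwards [ae_mem_ball_bergmanMeasure d n] with z hz using ball_subset_closedBall hz
  have hζ1 : ζ ∈ closedBall (0 : EuclideanSpace ℂ (Fin d)) 1 := by simp [hζ]
  have h := tendsto_setIntegral_pow_smul_of_unique_maximum_of_isCompact_of_measure_nhdsWithin_pos
    (μ := bergmanMeasure d n) (isCompact_closedBall (0 : EuclideanSpace ℂ (Fin d)) 1)
    (fun u hu hζu => bergmanMeasure_pos_of_mem_sphere n hζ hu hζu)
    (c := fun z => ‖peakFun ζ z‖ ^ 2)
    ((differentiable_peakFun ζ).continuous.norm.pow 2).continuousOn ?_ (fun _ _ => by positivity)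
    (by simp [peakFun_self hζ]) hζ1 (hg.integrableOn_compact (isCompact_closedBall _ _)) (hg ζ hζ1)
  · simpa only [hr] using h
  · intro z hz hne
    have h1 := norm_peakFun_sq_le hζ (mem_closedBall_zero_iff.1 hz)
    have h2 : 0 < ‖z - ζ‖ := norm_pos_iff.2 (sub_ne_zero.2 hne)
    simp only [peakFun_self hζ, norm_one, one_pow]
    nlinarith

theorem integrable_of_continuous {d n : ℕ} {g : EuclideanSpace ℂ (Fin d) → ℝ} (hg : Continuous g) :
    Integrable g (bergmanMeasure d n) := by
  have h1 := (memLp_of_continuous (n := n) (Complex.continuous_ofReal.comp hg)).integrable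
    (by norm_num)
  simpa using h1.re

/-- The squared norm of the `m`-th power of the peak function at `ζ`. -/
noncomputable def peakMass {d : ℕ} (n : ℕ) (ζ : EuclideanSpace ℂ (Fin d)) (m : ℕ) : ℝ :=
  ∫ z, (‖peakFun ζ z‖ ^ 2) ^ m ∂bergmanMeasure d n

theorem continuous_norm_peakFun {d : ℕ} (ζ : EuclideanSpace ℂ (Fin d)) :
    Continuous fun z => ‖peakFun ζ z‖ :=
  (differentiable_peakFun ζ).continuous.norm

theorem peakMass_pos {d : ℕ} (n : ℕ) {ζ : EuclideanSpace ℂ (Fin d)} (hζ : ‖ζ‖ = 1) (m : ℕ) :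
    0 < peakMass n ζ m := by
  have hpc := continuous_norm_peakFun ζ
  refine (integral_pos_iff_support_of_nonneg (fun z => pow_nonneg (sq_nonneg _) _)
    (integrable_of_continuous ((hpc.pow 2).pow m))).2 ?_
  refine (bergmanMeasure_pos_of_mem_sphere n hζ
    (isOpen_ne_fun hpc continuous_const : IsOpen {z | ‖peakFun ζ z‖ ≠ 0}) ?_).trans_le
    (measure_mono ?_)
  · simp [peakFun_self hζ]
  · rintro z ⟨hz, -⟩
    have hz' : ‖peakFun ζ z‖ ≠ 0 := hz
    exact pow_ne_zero _ (pow_ne_zero _ hz')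

/-- For every positive weight `w`, the inequality `C s ≤ w s² + C² / (4 w)` bounds the integral of a
normalized power of the peak function. -/
theorem peakMass_integral_le {d : ℕ} (n : ℕ) {ζ : EuclideanSpace ℂ (Fin d)} (hζ : ‖ζ‖ = 1) (C : ℝ)
    {w : EuclideanSpace ℂ (Fin d) → ℝ} (hw : Continuous w) (hw0 : ∀ z, 0 < w z) (m : ℕ) :
    ∫ z, C * ((Real.sqrt (peakMass n ζ m))⁻¹ * ‖peakFun ζ z‖ ^ m) ∂bergmanMeasure d n
      ≤ (peakMass n ζ m)⁻¹ * (∫ z, (‖peakFun ζ z‖ ^ 2) ^ m * w z ∂bergmanMeasure d n)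
        + ∫ z, C ^ 2 / (4 * w z) ∂bergmanMeasure d n := by
  have hpc := continuous_norm_peakFun ζ
  have hN := peakMass_pos n hζ m
  have hw4 : ∀ z, 4 * w z ≠ 0 := fun z => mul_ne_zero four_ne_zero (hw0 z).ne'
  rw [← integral_const_mul, ← integral_add]
  · refine integral_mono ?_ ?_ fun z => ?_
    · exact integrable_of_continuous (by fun_prop)
    · exact integrable_of_continuous (by fun_prop (disch := exact hw4 _))
    · set s : ℝ := (Real.sqrt (peakMass n ζ m))⁻¹ * ‖peakFun ζ z‖ ^ m with hs
      have hss : s ^ 2 = (peakMass n ζ m)⁻¹ * (‖peakFun ζ z‖ ^ 2) ^ m := by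
        rw [hs, mul_pow, inv_pow, Real.sq_sqrt hN.le, ← pow_mul, ← pow_mul, mul_comm m 2]
      have hwz := hw0 z
      have h3 : s ^ 2 * w z + C ^ 2 / (4 * w z) - C * s = (2 * w z * s - C) ^ 2 / (4 * w z) := by
        field_simp
        ring
      have h4 : 0 ≤ (2 * w z * s - C) ^ 2 / (4 * w z) := by positivity
      have h5 : C * s ≤ s ^ 2 * w z + C ^ 2 / (4 * w z) := by linarith
      rw [hss, mul_assoc] at h5
      exact h5
  · exact integrable_of_continuous (by fun_prop)
  · exact integrable_of_continuous (by fun_prop (disch := exact hw4 _))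

/-- The normalized powers of the peak function tend to zero in `L¹`: the weight
`w = K ‖z - ζ‖ + ε / 3` is small at `ζ`, where the squares concentrate, while `∫ 1 / w` is small for
large `K`. -/
theorem tendsto_integral_normalized_peakFun {d : ℕ} (n : ℕ) {ζ : EuclideanSpace ℂ (Fin d)}
    (hζ : ‖ζ‖ = 1) (C : ℝ) (hC : 0 ≤ C) :
    Tendsto (fun m => ∫ z, C * ((Real.sqrt (peakMass n ζ m))⁻¹ * ‖peakFun ζ z‖ ^ m)
      ∂bergmanMeasure d n) atTop (𝓝 0) := by
  rw [Metric.tendsto_nhds]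
  intro ε hε
  have hη : 0 < ε / 3 := by positivity
  have hwpos : ∀ (K : ℕ) (z : EuclideanSpace ℂ (Fin d)), 0 < K * ‖z - ζ‖ + ε / 3 :=
    fun K z => by positivity
  have hdom : Tendsto (fun K : ℕ => ∫ z, C ^ 2 / (4 * (K * ‖z - ζ‖ + ε / 3)) ∂bergmanMeasure d n)
      atTop (𝓝 (∫ _, (0 : ℝ) ∂bergmanMeasure d n)) := by
    refine tendsto_integral_of_dominated_convergence (fun _ => C ^ 2 / (4 * (ε / 3)))
      (fun K => ?_) (integrable_const _) (fun K => ?_) ?_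
    · exact (continuous_const.div (by fun_prop : Continuous fun z : EuclideanSpace ℂ (Fin d) =>
        4 * (K * ‖z - ζ‖ + ε / 3)) fun z =>
        mul_ne_zero four_ne_zero (hwpos K z).ne').aestronglyMeasurable
    · refine Eventually.of_forall fun z => ?_
      rw [Real.norm_eq_abs, abs_of_nonneg (by have := hwpos K z; positivity)]
      gcongr
      have : 0 ≤ K * ‖z - ζ‖ := by positivity
      linarith
    · filter_upwards [ae_mem_ball_bergmanMeasure d n] with z hz
      have hne : 0 < ‖z - ζ‖ := by
        rw [norm_pos_iff, sub_ne_zero]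
        rintro rfl
        rw [mem_ball_zero_iff, hζ] at hz
        exact lt_irrefl _ hz
      refine Tendsto.const_div_atTop ?_ _
      refine Tendsto.const_mul_atTop four_pos ?_
      exact tendsto_atTop_add_const_right _ _
        (tendsto_natCast_atTop_atTop.atTop_mul_const hne)
  rw [integral_zero] at hdom
  obtain ⟨K, hK⟩ := (hdom.eventually (gt_mem_nhds hη)).exists
  have hwc : Continuous fun z : EuclideanSpace ℂ (Fin d) => (K : ℝ) * ‖z - ζ‖ + ε / 3 := by
    fun_prop
  have hpeak := tendsto_integral_peakFun n hζ hwc.continuousOn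
  rw [sub_self, norm_zero, mul_zero, zero_add] at hpeak
  filter_upwards [hpeak.eventually (gt_mem_nhds (by linarith : ε / 3 < ε / 3 + ε / 3))] with m hm
  simp only [smul_eq_mul] at hm
  have h1 := peakMass_integral_le n hζ C hwc (hwpos K) m
  have h2 : 0 ≤ ∫ z, C * ((Real.sqrt (peakMass n ζ m))⁻¹ * ‖peakFun ζ z‖ ^ m)
      ∂bergmanMeasure d n := integral_nonneg fun z => by positivity
  rw [dist_zero_right, Real.norm_eq_abs, abs_of_nonneg h2]
  rw [peakMass] at h1
  rw [peakMass]
  linarith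

/-- The powers of the peak function at `ζ` in the Bergman space, normalized. -/
noncomputable def peakVector {d : ℕ} (n : ℕ) (ζ : EuclideanSpace ℂ (Fin d)) (m : ℕ) :
    BergmanSpace d n :=
  (((Real.sqrt (peakMass n ζ m))⁻¹ : ℝ) : ℂ) •
    bergmanOfDifferentiable d n ((differentiable_peakFun ζ).pow m)

theorem inner_peakVector_toeplitz {d : ℕ} (n : ℕ) {ζ : EuclideanSpace ℂ (Fin d)} (hζ : ‖ζ‖ = 1)
    (φ : C(closedBall (0 : EuclideanSpace ℂ (Fin d)) 1, ℂ)) (m : ℕ) :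
    inner ℂ (peakVector n ζ m) (toeplitz n φ (peakVector n ζ m)) = (peakMass n ζ m)⁻¹ •
      ∫ z, (‖peakFun ζ z‖ ^ 2) ^ m • extendZero φ z ∂bergmanMeasure d n := by
  have hN := peakMass_pos n hζ m
  simp only [peakVector, map_smul, inner_smul_left, inner_smul_right, Complex.conj_ofReal]
  rw [← mul_assoc, ← Complex.ofReal_mul, ← mul_inv, Real.mul_self_sqrt hN.le,
    inner_toeplitz, Complex.real_smul]
  congr 1
  refine integral_congr_ae ?_
  filter_upwards [coeFn_bergmanOfDifferentiable d n ((differentiable_peakFun ζ).pow m)] with z hz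
  rw [hz, mul_left_comm]
  simp only [Pi.pow_apply]
  rw [Complex.conj_mul', norm_pow, ← Complex.ofReal_pow, ← pow_mul, mul_comm m 2, pow_mul,
    Complex.real_smul, mul_comm]

theorem norm_peakVector {d : ℕ} (n : ℕ) {ζ : EuclideanSpace ℂ (Fin d)} (hζ : ‖ζ‖ = 1) (m : ℕ) :
    ‖peakVector n ζ m‖ = 1 := by
  have hN := peakMass_pos n hζ m
  have h := inner_peakVector_toeplitz n hζ 1 m
  have h1 : (∫ z, (‖peakFun ζ z‖ ^ 2) ^ m • extendZero 1 z ∂bergmanMeasure d n)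
      = ((peakMass n ζ m : ℝ) : ℂ) := by
    rw [peakMass, ← integral_complex_ofReal]
    refine integral_congr_ae ?_
    filter_upwards [ae_mem_ball_bergmanMeasure d n] with z hz
    rw [extendZero_apply _ (ball_subset_closedBall hz), ContinuousMap.one_apply, Complex.real_smul,
      mul_one]
  rw [toeplitz_one, one_apply_eq_self, h1, Complex.real_smul, ← Complex.ofReal_mul,
    inv_mul_cancel₀ hN.ne'] at h
  rw [norm_eq_sqrt_re_inner (𝕜 := ℂ), h]
  simp

theorem tendsto_inner_bergmanMonomial_peakVector {d : ℕ} (n : ℕ) {ζ : EuclideanSpace ℂ (Fin d)}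
    (hζ : ‖ζ‖ = 1) (k : Fin d → ℕ) :
    Tendsto (fun m => inner ℂ (bergmanMonomial d n k) (peakVector n ζ m)) atTop (𝓝 0) := by
  obtain ⟨C, hC⟩ :=
    (isCompact_closedBall (0 : EuclideanSpace ℂ (Fin d)) 1).exists_bound_of_continuousOn
      (differentiable_monomialFun d n k).continuous.continuousOn
  have hC0 : 0 ≤ C := (norm_nonneg _).trans (hC 0 (by simp))
  have hpc := continuous_norm_peakFun ζ
  refine squeeze_zero_norm (fun m => ?_) (tendsto_integral_normalized_peakFun n hζ C hC0)
  have hN := Real.sqrt_pos.2 (peakMass_pos n hζ m)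
  rw [peakVector, inner_smul_right, inner_bergmanSpace, ← integral_const_mul]
  refine norm_integral_le_of_norm_le (integrable_of_continuous (by fun_prop)) ?_
  filter_upwards [ae_mem_ball_bergmanMeasure d n, coeFn_bergmanMonomial d n k,
    coeFn_bergmanOfDifferentiable d n ((differentiable_peakFun ζ).pow m)] with z hz h1 h2
  rw [h1, h2, norm_mul, norm_mul, RCLike.norm_conj, Pi.pow_apply, norm_pow, Complex.norm_real,
    Real.norm_eq_abs, abs_of_pos (inv_pos.2 hN), mul_left_comm]
  gcongr
  exact hC z (ball_subset_closedBall hz)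

/-- A compact Toeplitz operator has vanishing boundary symbol. -/
theorem eq_zero_of_isCompactOperator_toeplitz {d n : ℕ} (hd : 1 ≤ d) (hn : d ≤ n)
    {φ : C(closedBall (0 : EuclideanSpace ℂ (Fin d)) 1, ℂ)}
    (hφ : IsCompactOperator (toeplitz n φ)) (ζ : sphere (0 : EuclideanSpace ℂ (Fin d)) 1) :
    φ ⟨ζ, sphere_subset_closedBall ζ.2⟩ = 0 := by
  have hζ : ‖ζ.1‖ = 1 := mem_sphere_zero_iff_norm.1 ζ.2
  have h0 := (monomialBasis hd hn).tendsto_inner_compact hφ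
    (fun m => (norm_peakVector n hζ m).le) (fun k => by
      rw [coe_monomialBasis]
      exact tendsto_inner_bergmanMonomial_peakVector n hζ k)
  simp_rw [inner_peakVector_toeplitz n hζ] at h0
  rw [← extendZero_apply φ (sphere_subset_closedBall ζ.2)]
  exact tendsto_nhds_unique (tendsto_integral_peakFun n hζ (continuousOn_extendZero φ)) h0

/-! ### Order-unit spaces and Lip-norms -/

/-- States map elements between `-ε e` and `ε e` into `[-ε, ε]`. -/
theorem StateSpace.abs_le {A : Type*} [AddCommGroup A] [Module ℝ A] [PartialOrder A] {e : A}
    (μ : StateSpace A e) {c : A} {ε : ℝ} (h1 : 0 ≤ ε • e - c) (h2 : 0 ≤ ε • e + c) :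
    |μ.1 c| ≤ ε := by
  have h3 := μ.2.1 _ h1
  have h4 := μ.2.1 _ h2
  rw [map_sub, map_smul, μ.2.2, smul_eq_mul, mul_one] at h3
  rw [map_add, map_smul, μ.2.2, smul_eq_mul, mul_one] at h4
  exact _root_.abs_le.2 ⟨by linarith, by linarith⟩

/-- The constant `L a + 1` rather than `L a` covers the elements on which `L` vanishes. -/
theorem ofReal_abs_sub_le_stateDist {A : Type*} [AddCommGroup A] [Module ℝ A] [PartialOrder A]
    {e : A} (L : Seminorm ℝ A) (a : A) (μ ν : StateSpace A e) :
    ENNReal.ofReal |μ.1 a - ν.1 a| ≤ ENNReal.ofReal (L a + 1) * stateDist L μ ν := by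
  have h0 : 0 < L a + 1 := add_pos_of_nonneg_of_pos (apply_nonneg L a) one_pos
  have h1 : L ((L a + 1)⁻¹ • a) ≤ 1 := by
    rw [map_smul_eq_mul, Real.norm_of_nonneg (inv_nonneg.2 h0.le), inv_mul_le_one₀ h0]
    linarith
  have h2 : |μ.1 a - ν.1 a| = (L a + 1) * |μ.1 ((L a + 1)⁻¹ • a) - ν.1 ((L a + 1)⁻¹ • a)| := by
    rw [map_smul, map_smul, ← smul_sub, smul_eq_mul, abs_mul, abs_of_pos (inv_pos.2 h0),
      mul_inv_cancel_left₀ h0.ne']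
  rw [h2, ENNReal.ofReal_mul h0.le]
  gcongr
  exact le_iSup₂_of_le (f := fun (a : A) (_ : L a ≤ 1) => ENNReal.ofReal |μ.1 a - ν.1 a|)
    _ h1 le_rfl

/-- Rieffel's criterion: if the unit ball of `L` is totally bounded modulo the multiples of the
order unit, then the metric of `L` on the state space induces the weak-* topology. -/
theorem stateMetric_topology_eq {A : Type*} [AddCommGroup A] [Module ℝ A] [PartialOrder A] {e : A}
    (L : Seminorm ℝ A)
    (hL : ∀ ε : ℝ, 0 < ε → ∃ F : Set A, F.Finite ∧ ∀ a, L a ≤ 1 → ∃ b ∈ F, ∃ t : ℝ,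
      0 ≤ ε • e - (a - b - t • e) ∧ 0 ≤ ε • e + (a - b - t • e)) :
    (stateMetric e L).toUniformSpace.toTopologicalSpace = weakStarTopology A e := by
  refine le_antisymm ?_ ?_
  -- evaluation at `a` is Lipschitz for `ρ_L`, with constant `L a + 1`
  · let := stateMetric e L
    refine continuous_iff_le_induced.1 (continuous_pi fun a => ?_)
    refine LipschitzWith.continuous (K := Real.toNNReal (L a + 1)) fun μ ν => ?_
    rw [edist_dist, Real.dist_eq]
    exact ofReal_abs_sub_le_stateDist L a μ ν
  · refine le_of_nhds_le_nhds fun μ => ?_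
    refine ((@Metric.nhds_basis_eball _ (stateMetric e L) μ).ge_iff).2 fun δ hδ => ?_
    obtain ⟨ε, hε0, hεδ⟩ : ∃ ε : ℝ, 0 < ε ∧ ENNReal.ofReal ε < δ := by
      obtain ⟨r, hr0, hr1⟩ := ENNReal.lt_iff_exists_nnreal_btwn.1 hδ
      exact ⟨r, by exact_mod_cast hr0, by simpa using hr1⟩
    obtain ⟨F, hF, hF'⟩ := hL (ε / 4) (by positivity)
    let := weakStarTopology A e
    have hcont : ∀ a : A, Continuous fun ν : StateSpace A e => ν.1 a := fun a =>
      (continuous_apply a).comp (continuous_induced_dom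
        (f := fun (μ : StateSpace A e) (a : A) => μ.1 a))
    have hev : ∀ᶠ ν in 𝓝 μ, ∀ b ∈ F, |ν.1 b - μ.1 b| < ε / 4 := by
      rw [hF.eventually_all]
      intro b _
      have h1 := (hcont b).tendsto μ
      exact (Metric.tendsto_nhds.1 h1) (ε / 4) (by positivity)
    filter_upwards [hev] with ν hν
    refine lt_of_le_of_lt ?_ hεδ
    refine iSup₂_le fun a ha => ENNReal.ofReal_le_ofReal ?_
    obtain ⟨b, hb, t, h1, h2⟩ := hF' a ha
    have h3 := ν.abs_le h1 h2
    have h4 := μ.abs_le h1 h2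
    have h5 := hν b hb
    rw [map_sub, map_sub, map_smul, ν.2.2, smul_eq_mul, mul_one] at h3
    rw [map_sub, map_sub, map_smul, μ.2.2, smul_eq_mul, mul_one] at h4
    rw [abs_le] at h3 h4 ⊢
    rw [abs_lt] at h5
    constructor <;> linarith

/-- The Archimedean property: the operator order is norm closed. -/
theorem le_zero_of_forall_le_smul_one {H : Type*} [NormedAddCommGroup H] [InnerProductSpace ℂ H]
    [CompleteSpace H] {T : H →L[ℂ] H} (h : ∀ r : ℝ, 0 < r → T ≤ r • 1) : T ≤ 0 := by
  have h2 : Tendsto (fun r : ℝ => r • (1 : H →L[ℂ] H)) (𝓝[>] 0) (𝓝 ((0 : ℝ) • 1)) :=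
    ((continuous_id.smul continuous_const).tendsto (0 : ℝ)).mono_left nhdsWithin_le_nhds
  rw [zero_smul] at h2
  have h3 : ∀ᶠ r : ℝ in 𝓝[>] 0, T ≤ r • 1 := eventually_mem_nhdsWithin.mono fun r hr => h r hr
  exact ge_of_tendsto h2 h3

/-- A real subspace of the bounded self-adjoint operators containing the identity is an order-unit
space in the operator order. -/
theorem isOrderUnitSpace_of_isSelfAdjoint {H : Type*} [NormedAddCommGroup H]
    [InnerProductSpace ℂ H] [CompleteSpace H] (A : Submodule ℝ (H →L[ℂ] H))
    (h1 : (1 : H →L[ℂ] H) ∈ A) (hA : ∀ T ∈ A, IsSelfAdjoint T) :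
    IsOrderUnitSpace A ⟨1, h1⟩ where
  add_le_add a b c hab := by
    have h : (a : H →L[ℂ] H) ≤ b := hab
    change (a : H →L[ℂ] H) + c ≤ b + c
    rw [ContinuousLinearMap.le_def] at h ⊢
    rwa [add_sub_add_right_eq_sub]
  smul_nonneg r a hr ha := by
    have h : (0 : H →L[ℂ] H) ≤ a := ha
    change (0 : H →L[ℂ] H) ≤ r • (a : H →L[ℂ] H)
    exact _root_.smul_nonneg hr h
  exists_le_smul a := by
    refine ⟨‖(a : H →L[ℂ] H)‖, ?_⟩
    change (a : H →L[ℂ] H) ≤ ‖(a : H →L[ℂ] H)‖ • 1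
    rw [← Algebra.algebraMap_eq_smul_one]
    exact (hA _ a.2).le_algebraMap_norm_self
  archimedean a ha := by
    have h : ∀ r : ℝ, 0 < r → (a : H →L[ℂ] H) ≤ r • 1 := ha
    exact le_zero_of_forall_le_smul_one h

/-! ### Compact operators with rapidly decaying matrix entries -/

theorem matrixCoeff_add {d n : ℕ} (ν : ℕ ≃ (Fin d → ℕ))
    (S T : BergmanSpace d n →L[ℂ] BergmanSpace d n) (i j : ℕ) :
    matrixCoeff ν (S + T) i j = matrixCoeff ν S i j + matrixCoeff ν T i j := by
  simp [matrixCoeff]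

theorem matrixCoeff_sub {d n : ℕ} (ν : ℕ ≃ (Fin d → ℕ))
    (S T : BergmanSpace d n →L[ℂ] BergmanSpace d n) (i j : ℕ) :
    matrixCoeff ν (S - T) i j = matrixCoeff ν S i j - matrixCoeff ν T i j := by
  simp [matrixCoeff]

theorem matrixCoeff_real_smul {d n : ℕ} (ν : ℕ ≃ (Fin d → ℕ)) (c : ℝ)
    (T : BergmanSpace d n →L[ℂ] BergmanSpace d n) (i j : ℕ) :
    matrixCoeff ν (c • T) i j = (c : ℂ) * matrixCoeff ν T i j := by
  have : c • T = (c : ℂ) • T := rfl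
  rw [this]
  simp [matrixCoeff]

theorem weightedCoeff_nonneg {d n : ℕ} (ν : ℕ ≃ (Fin d → ℕ))
    (T : BergmanSpace d n →L[ℂ] BergmanSpace d n) (p : ℕ × ℕ) : 0 ≤ weightedCoeff ν T p := by
  unfold weightedCoeff
  positivity

theorem lipNormCompacts_add_le {d n : ℕ} {ν : ℕ ≃ (Fin d → ℕ)}
    {S T : BergmanSpace d n →L[ℂ] BergmanSpace d n} (hS : S ∈ lipCompacts n ν)
    (hT : T ∈ lipCompacts n ν) :
    lipNormCompacts ν (S + T) ≤ lipNormCompacts ν S + lipNormCompacts ν T := by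
  refine ciSup_le fun p => ?_
  refine le_trans ?_ (add_le_add (le_ciSup hS.2.2.2 p) (le_ciSup hT.2.2.2 p))
  simp only [weightedCoeff, matrixCoeff_add]
  rw [← mul_add]
  gcongr
  exact norm_add_le _ _

theorem lipNormCompacts_smul {d n : ℕ} (ν : ℕ ≃ (Fin d → ℕ)) (c : ℝ)
    (T : BergmanSpace d n →L[ℂ] BergmanSpace d n) :
    lipNormCompacts ν (c • T) = |c| * lipNormCompacts ν T := by
  rw [lipNormCompacts, lipNormCompacts, Real.mul_iSup_of_nonneg (abs_nonneg c)]
  refine iSup_congr fun p => ?_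
  rw [weightedCoeff, weightedCoeff, matrixCoeff_real_smul, norm_mul, Complex.norm_real,
    Real.norm_eq_abs]
  ring

theorem lipNormCompacts_nonneg {d n : ℕ} (ν : ℕ ≃ (Fin d → ℕ))
    (T : BergmanSpace d n →L[ℂ] BergmanSpace d n) : 0 ≤ lipNormCompacts ν T :=
  Real.iSup_nonneg (weightedCoeff_nonneg ν T)

/-- The weights `(i + j)^{-(n + 2)}` are summable because `(i + j)³ ≥ i^{3/2} j^{3/2}`. -/
theorem summable_inv_add_pow {n : ℕ} (hn : 1 ≤ n) :
    Summable fun p : ℕ × ℕ => (((((p.1 + 1) + (p.2 + 1) : ℕ) : ℝ)) ^ (n + 2))⁻¹ := by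
  have h1 : Summable fun i : ℕ => (((i + 1 : ℕ) : ℝ) ^ (3 / 2 : ℝ))⁻¹ :=
    (summable_nat_add_iff 1).2 (Real.summable_nat_rpow_inv.2 (by norm_num))
  refine Summable.of_nonneg_of_le (fun p => by positivity) (fun p => ?_)
    (h1.mul_of_nonneg h1 (fun i => by positivity) fun i => by positivity)
  rw [← mul_inv]
  refine inv_anti₀ (by positivity) ?_
  have h2 : ∀ x y : ℝ, 1 ≤ x → 1 ≤ y → x ^ (3 / 2 : ℝ) * y ^ (3 / 2 : ℝ) ≤ (x + y) ^ (n + 2) := by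
    intro x y hx hy
    calc x ^ (3 / 2 : ℝ) * y ^ (3 / 2 : ℝ) ≤ (x + y) ^ (3 / 2 : ℝ) * (x + y) ^ (3 / 2 : ℝ) := by
          gcongr <;> linarith
      _ = (x + y) ^ 3 := by
          rw [← Real.rpow_add (by linarith), ← Real.rpow_natCast]
          norm_num
      _ ≤ (x + y) ^ (n + 2) := pow_le_pow_right₀ (by linarith) (by omega)
  rw [Nat.cast_add (p.1 + 1)]
  exact h2 _ _ (Nat.one_le_cast.2 p.1.succ_pos) (Nat.one_le_cast.2 p.2.succ_pos)

theorem norm_matrixCoeff_le {d n : ℕ} {ν : ℕ ≃ (Fin d → ℕ)}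
    {T : BergmanSpace d n →L[ℂ] BergmanSpace d n} (hT : T ∈ lipCompacts n ν) (p : ℕ × ℕ) :
    ‖matrixCoeff ν T p.1 p.2‖
      ≤ lipNormCompacts ν T * (((((p.1 + 1) + (p.2 + 1) : ℕ) : ℝ)) ^ (n + 2))⁻¹ := by
  have h1 : weightedCoeff ν T p ≤ lipNormCompacts ν T := le_ciSup hT.2.2.2 p
  rw [weightedCoeff] at h1
  rw [le_mul_inv_iff₀ (by positivity), mul_comm]
  exact h1

theorem summable_norm_matrixCoeff {d n : ℕ} (hn : 1 ≤ n) {ν : ℕ ≃ (Fin d → ℕ)}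
    {T : BergmanSpace d n →L[ℂ] BergmanSpace d n} (hT : T ∈ lipCompacts n ν) :
    Summable fun p : ℕ × ℕ => ‖matrixCoeff ν T p.1 p.2‖ :=
  Summable.of_nonneg_of_le (fun _ => norm_nonneg _) (norm_matrixCoeff_le hT)
    ((summable_inv_add_pow hn).mul_left _)

theorem summable_norm_inner_monomialBasis {d n : ℕ} (hd : 1 ≤ d) (hn : d ≤ n)
    {ν : ℕ ≃ (Fin d → ℕ)} {T : BergmanSpace d n →L[ℂ] BergmanSpace d n}
    (hT : T ∈ lipCompacts n ν) :
    Summable fun p : (Fin d → ℕ) × (Fin d → ℕ) =>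
      ‖inner ℂ (monomialBasis hd hn p.2) (T (monomialBasis hd hn p.1))‖ := by
  rw [coe_monomialBasis, ← (ν.prodCongr ν).summable_iff]
  exact summable_norm_matrixCoeff (hd.trans hn) hT

theorem norm_le_tsum_matrixCoeff {d n : ℕ} (hd : 1 ≤ d) (hn : d ≤ n) {ν : ℕ ≃ (Fin d → ℕ)}
    {T : BergmanSpace d n →L[ℂ] BergmanSpace d n} (hT : T ∈ lipCompacts n ν) :
    ‖T‖ ≤ ∑' p : ℕ × ℕ, ‖matrixCoeff ν T p.1 p.2‖ := by
  have h := (monomialBasis hd hn).norm_le_tsum_matrix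
    (summable_norm_inner_monomialBasis hd hn hT)
  rw [coe_monomialBasis, ← (ν.prodCongr ν).tsum_eq] at h
  exact h

/-- An operator with absolutely summable matrix is the norm-convergent sum of multiples of the
rank-one operators `e_k ⊗ e_l`, which lie in the Toeplitz algebra. -/
theorem mem_toeplitzAlgebra_of_mem_lipCompacts {d n : ℕ} (hd : 1 ≤ d) (hn : d ≤ n)
    {ν : ℕ ≃ (Fin d → ℕ)} {T : BergmanSpace d n →L[ℂ] BergmanSpace d n}
    (hT : T ∈ lipCompacts n ν) : T ∈ toeplitzAlgebra d n := by
  have h := (monomialBasis hd hn).hasSum_matrix_smul_rankOne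
    (summable_norm_inner_monomialBasis hd hn hT)
  rw [coe_monomialBasis] at h
  refine (StarSubalgebra.isClosed_topologicalClosure _).mem_of_tendsto h
    (Eventually.of_forall fun s => ?_)
  exact sum_mem fun p _ => (toeplitzAlgebra d n).smul_mem (rankOne_mem_toeplitzAlgebra hd hn _ _) _

/-- The unit ball of `L̃_n` is totally bounded in the operator norm: up to a uniformly small error
only finitely many matrix entries matter, and these are bounded. -/
theorem exists_finite_net_lipCompacts {d n : ℕ} (hd : 1 ≤ d) (hn : d ≤ n) (ν : ℕ ≃ (Fin d → ℕ))
    {ε : ℝ} (hε : 0 < ε) :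
    ∃ F : Set (BergmanSpace d n →L[ℂ] BergmanSpace d n), F.Finite ∧
      (∀ K ∈ F, K ∈ lipCompacts n ν) ∧
      ∀ K ∈ lipCompacts n ν, lipNormCompacts ν K ≤ 1 → ∃ K' ∈ F, ‖K - K'‖ ≤ ε := by
  set w : ℕ × ℕ → ℝ := fun p => (((((p.1 + 1) + (p.2 + 1) : ℕ) : ℝ)) ^ (n + 2))⁻¹ with hw
  have hwpos : ∀ p, 0 < w p := fun p => by positivity
  have hws : Summable w := summable_inv_add_pow (hd.trans hn)
  set X : Set (BergmanSpace d n →L[ℂ] BergmanSpace d n) :=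
    {K | K ∈ lipCompacts n ν ∧ lipNormCompacts ν K ≤ 1} with hX
  have hXw : ∀ K ∈ X, ∀ p, ‖matrixCoeff ν K p.1 p.2‖ ≤ w p := fun K hK p =>
    (norm_matrixCoeff_le hK.1 p).trans (mul_le_of_le_one_left (hwpos p).le hK.2)
  obtain ⟨s, hs⟩ := ((tendsto_order.1 (tendsto_tsum_compl_atTop_zero w)).2 (ε / 4)
    (by positivity)).exists
  set Φ : (BergmanSpace d n →L[ℂ] BergmanSpace d n) → (s → ℂ) :=
    fun K p => matrixCoeff ν K p.1.1 p.1.2 with hΦ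
  have hΦX : TotallyBounded (Φ '' X) := by
    refine (isCompact_univ_pi fun p : s =>
      isCompact_closedBall (0 : ℂ) (w p.1)).totallyBounded.subset ?_
    rintro _ ⟨K, hK, rfl⟩ p -
    exact mem_closedBall_zero_iff.2 (hXw K hK p.1)
  -- `s.card * δ ≤ ε / 2`, the entries outside `s` contributing at most the other half
  set δ : ℝ := ε / (2 * (s.card + 1)) with hδ
  have hδ0 : 0 < δ := by positivity
  obtain ⟨t, htX, htf, ht⟩ := Metric.finite_approx_of_totallyBounded hΦX δ hδ0
  obtain ⟨F₀, hFX, hFt⟩ := Set.subset_image_iff.1 htX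
  obtain ⟨F, hFX, hFf, hFt⟩ : ∃ F ⊆ X, F.Finite ∧ Φ '' F = t := by
    obtain ⟨G, hG⟩ := Set.exists_subset_bijOn F₀ Φ
    refine ⟨G, hG.1.trans hFX, ?_, ?_⟩
    · exact Set.Finite.of_finite_image (by rw [hG.2.image_eq, hFt]; exact htf) hG.2.injOn
    · rw [hG.2.image_eq, hFt]
  refine ⟨F, hFf, fun K hK => (hFX hK).1, fun K hK hK1 => ?_⟩
  have hKX : K ∈ X := ⟨hK, hK1⟩
  obtain ⟨_, hy, hKy⟩ := Set.mem_iUnion₂.1 (ht ⟨K, hKX, rfl⟩)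
  rw [← hFt] at hy
  obtain ⟨K', hK', rfl⟩ := hy
  refine ⟨K', hK', ?_⟩
  have hsub : K - K' ∈ lipCompacts n ν := Submodule.sub_mem _ hK (hFX hK').1
  have hsum := summable_norm_matrixCoeff (hd.trans hn) hsub
  have h1 : ∑ p ∈ s, ‖matrixCoeff ν (K - K') p.1 p.2‖ ≤ s.card • δ := by
    refine Finset.sum_le_card_nsmul _ _ _ fun p hp => ?_
    have h2 : dist (Φ K ⟨p, hp⟩) (Φ K' ⟨p, hp⟩) < δ :=
      (dist_le_pi_dist _ _ _).trans_lt hKy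
    rw [dist_eq_norm] at h2
    rw [matrixCoeff_sub]
    exact h2.le
  have h3 : ∑' p : {p // p ∉ s}, ‖matrixCoeff ν (K - K') p.1.1 p.1.2‖
      ≤ ∑' p : {p // p ∉ s}, 2 * w p.1 := by
    refine Summable.tsum_le_tsum (fun p => ?_) (hsum.subtype _) ((hws.mul_left 2).subtype _)
    rw [matrixCoeff_sub, two_mul]
    exact (norm_sub_le _ _).trans (add_le_add (hXw K hKX p.1) (hXw K' (hFX hK') p.1))
  rw [tsum_mul_left] at h3
  have h4 : s.card • δ ≤ ε / 2 := by
    rw [nsmul_eq_mul, hδ, mul_div_assoc', div_le_div_iff₀ (by positivity) two_pos]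
    nlinarith
  have h5 := norm_le_tsum_matrixCoeff hd hn hsub
  rw [← hsum.sum_add_tsum_subtype_compl s] at h5
  linarith

/-! ### Lipschitz functions on the sphere -/

theorem lipConstant_nonneg {d : ℕ} (f : C(sphere (0 : EuclideanSpace ℂ (Fin d)) 1, ℝ)) :
    0 ≤ lipConstant f :=
  Real.iSup_nonneg fun _ => div_nonneg (abs_nonneg _) dist_nonneg

theorem bddAbove_of_mem_lipFunctions {d : ℕ} {f : C(sphere (0 : EuclideanSpace ℂ (Fin d)) 1, ℝ)}
    (hf : f ∈ lipFunctions d) :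
    BddAbove (Set.range fun p : sphere (0 : EuclideanSpace ℂ (Fin d)) 1 ×
      sphere (0 : EuclideanSpace ℂ (Fin d)) 1 => |f p.1 - f p.2| / dist p.1 p.2) := by
  obtain ⟨C, hC⟩ := hf
  refine ⟨C, ?_⟩
  rintro _ ⟨p, rfl⟩
  exact div_le_of_le_mul₀ dist_nonneg C.2 (hC.dist_le_mul p.1 p.2)

theorem abs_sub_le_lipConstant_mul {d : ℕ} {f : C(sphere (0 : EuclideanSpace ℂ (Fin d)) 1, ℝ)}
    (hf : f ∈ lipFunctions d) (x y : sphere (0 : EuclideanSpace ℂ (Fin d)) 1) :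
    |f x - f y| ≤ lipConstant f * dist x y := by
  rcases eq_or_ne x y with rfl | hxy
  · simp
  · rw [← div_le_iff₀ (dist_pos.2 hxy)]
    exact le_ciSup (bddAbove_of_mem_lipFunctions hf) (x, y)

theorem lipConstant_add_le {d : ℕ} {f g : C(sphere (0 : EuclideanSpace ℂ (Fin d)) 1, ℝ)}
    (hf : f ∈ lipFunctions d) (hg : g ∈ lipFunctions d) :
    lipConstant (f + g) ≤ lipConstant f + lipConstant g := by
  have h0 := add_nonneg (lipConstant_nonneg f) (lipConstant_nonneg g)
  refine Real.iSup_le (fun p => ?_) h0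
  refine div_le_of_le_mul₀ dist_nonneg h0 ?_
  rw [ContinuousMap.add_apply, ContinuousMap.add_apply, add_sub_add_comm, add_mul]
  exact (abs_add_le _ _).trans (add_le_add (abs_sub_le_lipConstant_mul hf _ _)
    (abs_sub_le_lipConstant_mul hg _ _))

theorem lipConstant_smul {d : ℕ} (c : ℝ) (f : C(sphere (0 : EuclideanSpace ℂ (Fin d)) 1, ℝ)) :
    lipConstant (c • f) = |c| * lipConstant f := by
  rw [lipConstant, lipConstant, Real.mul_iSup_of_nonneg (abs_nonneg c)]
  refine iSup_congr fun p => ?_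
  rw [ContinuousMap.smul_apply, ContinuousMap.smul_apply, ← smul_sub, smul_eq_mul, abs_mul,
    mul_div_assoc]

theorem one_mem_lipFunctions (d : ℕ) : 1 ∈ lipFunctions d := ⟨0, LipschitzWith.const 1⟩

theorem lipConstant_one (d : ℕ) :
    lipConstant (1 : C(sphere (0 : EuclideanSpace ℂ (Fin d)) 1, ℝ)) = 0 := by
  simp [lipConstant]

/-- The functions with Lipschitz constant at most one are totally bounded in the uniform norm modulo
the constants, by the Arzelà–Ascoli theorem. -/
theorem exists_finite_net_lipFunctions {d : ℕ} (x₀ : sphere (0 : EuclideanSpace ℂ (Fin d)) 1)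
    {ε : ℝ} (hε : 0 < ε) :
    ∃ F : Set C(sphere (0 : EuclideanSpace ℂ (Fin d)) 1, ℝ), F.Finite ∧ F ⊆ lipFunctions d ∧
      ∀ f ∈ lipFunctions d, lipConstant f ≤ 1 → ∃ g ∈ F, ‖f - g - f x₀ • 1‖ ≤ ε := by
  set Y : Set C(sphere (0 : EuclideanSpace ℂ (Fin d)) 1, ℝ) :=
    {f | LipschitzWith 1 f ∧ f x₀ = 0} with hY
  set I := BoundedContinuousFunction.mkOfCompact (α := sphere (0 : EuclideanSpace ℂ (Fin d)) 1)
    (β := ℝ)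
  have hcpt : IsCompact (closure (I '' Y)) := by
    refine BoundedContinuousFunction.arzela_ascoli (closedBall 0 2) (isCompact_closedBall 0 2) _ ?_ ?_
    · rintro _ x ⟨f, ⟨hf, hf0⟩, rfl⟩
      have h1 := hf.dist_le_mul x x₀
      have h2 : dist x x₀ ≤ 2 := by
        have h3 : dist x.1 x₀.1 ≤ dist x.1 0 + dist x₀.1 0 := dist_triangle_right _ _ _
        rw [x.2, x₀.2] at h3
        have h4 : dist x x₀ = dist x.1 x₀.1 := rfl
        linarith
      rw [hf0, NNReal.coe_one, one_mul] at h1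
      exact h1.trans h2
    · refine (LipschitzWith.uniformEquicontinuous _ 1 ?_).equicontinuous
      rintro ⟨_, f, ⟨hf, -⟩, rfl⟩
      exact hf
  obtain ⟨t, htY, htf, ht⟩ := Metric.finite_approx_of_totallyBounded
    (hcpt.totallyBounded.subset subset_closure) ε hε
  refine ⟨BoundedContinuousFunction.toContinuousMap '' t, htf.image _, ?_, fun f hf hf1 => ?_⟩
  · rintro _ ⟨_, hg, rfl⟩
    obtain ⟨g, hgY, rfl⟩ := htY hg
    exact ⟨1, hgY.1⟩
  · have hfY : f - f x₀ • 1 ∈ Y := by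
      refine ⟨LipschitzWith.of_dist_le_mul fun x y => ?_, by simp⟩
      have h1 := abs_sub_le_lipConstant_mul hf x y
      have h2 : lipConstant f * dist x y ≤ 1 * dist x y := by gcongr
      simpa [Real.dist_eq] using h1.trans h2
    obtain ⟨_, hg, hfg⟩ := Set.mem_iUnion₂.1 (ht ⟨_, hfY, rfl⟩)
    obtain ⟨g, hgY, rfl⟩ := htY hg
    refine ⟨g, ⟨_, hg, rfl⟩, ?_⟩
    rw [sub_right_comm, ← dist_eq_norm]
    exact hfg.le

/-! ### The quantum metric on the Lipschitz operators -/

section Splitting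

variable {d n : ℕ} {σ : C(sphere (0 : EuclideanSpace ℂ (Fin d)) 1, ℂ) →ₗ[ℂ] toeplitzAlgebra d n}

theorem realLift_mem_toeplitzAlgebra (f : C(sphere (0 : EuclideanSpace ℂ (Fin d)) 1, ℝ)) :
    realLift σ f ∈ toeplitzAlgebra d n :=
  (σ (complexify d f)).2

theorem realLift_one (hσ : IsPositiveUnitalSplitting σ) : realLift σ 1 = 1 := by
  have h1 : complexify d 1 = 1 := by
    ext x
    simp [complexify]
  change ((σ (complexify d 1) : toeplitzAlgebra d n) :
    BergmanSpace d n →L[ℂ] BergmanSpace d n) = 1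
  rw [h1, hσ.map_one]
  rfl

theorem realLift_nonneg (hσ : IsPositiveUnitalSplitting σ)
    {f : C(sphere (0 : EuclideanSpace ℂ (Fin d)) 1, ℝ)} (hf : ∀ x, 0 ≤ f x) :
    0 ≤ realLift σ f :=
  (ContinuousLinearMap.nonneg_iff_isPositive _).2 (hσ.positive f hf)

/-- If `|f| ≤ ε` then `-ε ≤ σ(f)`. -/
theorem realLift_nonneg_of_norm_le (hσ : IsPositiveUnitalSplitting σ)
    {f : C(sphere (0 : EuclideanSpace ℂ (Fin d)) 1, ℝ)} {ε : ℝ} (hf : ‖f‖ ≤ ε) :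
    0 ≤ ε • (1 : BergmanSpace d n →L[ℂ] BergmanSpace d n) + realLift σ f := by
  have h1 := realLift_nonneg hσ (f := ε • 1 + f) fun x => by
    have h2 := (abs_le.1 ((f.norm_coe_le_norm x).trans hf)).1
    simp only [ContinuousMap.add_apply, ContinuousMap.smul_apply, ContinuousMap.one_apply,
      smul_eq_mul, mul_one]
    linarith
  rwa [map_add, map_smul, realLift_one hσ] at h1

/-- `σ(f)` is the difference of the positive operators `σ(f) + ‖f‖` and `‖f‖`. -/
theorem isSelfAdjoint_realLift (hσ : IsPositiveUnitalSplitting σ)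
    (f : C(sphere (0 : EuclideanSpace ℂ (Fin d)) 1, ℝ)) : IsSelfAdjoint (realLift σ f) := by
  have h1 : IsSelfAdjoint (‖f‖ • (1 : BergmanSpace d n →L[ℂ] BergmanSpace d n)) :=
    (IsSelfAdjoint.all _).smul (.one _)
  have h2 := (IsSelfAdjoint.of_nonneg (realLift_nonneg_of_norm_le hσ (le_refl ‖f‖))).sub h1
  rwa [add_sub_cancel_left] at h2

theorem isSelfAdjoint_of_mem_lipToeplitz (hσ : IsPositiveUnitalSplitting σ)
    {ν : ℕ ≃ (Fin d → ℕ)} {T : BergmanSpace d n →L[ℂ] BergmanSpace d n}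
    (hT : T ∈ lipToeplitz ν σ) : IsSelfAdjoint T := by
  obtain ⟨K, hK, _, ⟨f, -, rfl⟩, rfl⟩ := Submodule.mem_sup.1 hT
  exact hK.2.1.add (isSelfAdjoint_realLift hσ f)

theorem mem_toeplitzAlgebra_of_mem_lipToeplitz (hd : 1 ≤ d) (hn : d ≤ n)
    {ν : ℕ ≃ (Fin d → ℕ)} {T : BergmanSpace d n →L[ℂ] BergmanSpace d n}
    (hT : T ∈ lipToeplitz ν σ) : T ∈ toeplitzAlgebra d n := by
  obtain ⟨K, hK, _, ⟨f, -, rfl⟩, rfl⟩ := Submodule.mem_sup.1 hT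
  exact add_mem (mem_toeplitzAlgebra_of_mem_lipCompacts hd hn hK) (realLift_mem_toeplitzAlgebra f)

/-- A compact Toeplitz operator has zero symbol on the sphere, so the symbol can be recovered from
`σ(f)` modulo the compact operators. -/
theorem eq_zero_of_isCompactOperator_realLift (hd : 1 ≤ d) (hn : d ≤ n)
    (hσ : IsPositiveUnitalSplitting σ) {f : C(sphere (0 : EuclideanSpace ℂ (Fin d)) 1, ℝ)}
    (hf : IsCompactOperator (realLift σ f)) : f = 0 := by
  obtain ⟨φ, hφ, hc⟩ := hσ.hasSymbol (complexify d f)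
  have h1 : IsCompactOperator (toeplitz n φ) := by
    have h2 := IsCompactOperator.sub hf hc
    rw [← FunLike.coe_sub] at h2
    exact (sub_sub_cancel (realLift σ f) (toeplitz n φ)) ▸ h2
  ext x
  have h2 := eq_zero_of_isCompactOperator_toeplitz hd hn h1 x
  rw [hφ] at h2
  exact Complex.ofReal_eq_zero.1 h2

theorem disjoint_lipCompacts_lipSection (hd : 1 ≤ d) (hn : d ≤ n)
    (hσ : IsPositiveUnitalSplitting σ) (ν : ℕ ≃ (Fin d → ℕ)) :
    Disjoint (lipCompacts n ν) (lipSection σ) := by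
  rw [Submodule.disjoint_def]
  rintro _ hK ⟨f, -, rfl⟩
  rw [eq_zero_of_isCompactOperator_realLift hd hn hσ hK.1, map_zero]

/-- The decomposition `σ(f) + K` is unique. -/
theorem realLift_add_inj (hd : 1 ≤ d) (hn : d ≤ n)
    (hσ : IsPositiveUnitalSplitting σ) {ν : ℕ ≃ (Fin d → ℕ)}
    {f g : C(sphere (0 : EuclideanSpace ℂ (Fin d)) 1, ℝ)}
    {K K' : BergmanSpace d n →L[ℂ] BergmanSpace d n} (hK : K ∈ lipCompacts n ν)
    (hK' : K' ∈ lipCompacts n ν) (h : realLift σ f + K = realLift σ g + K') :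
    f = g ∧ K = K' := by
  have h1 : realLift σ (f - g) = K' - K := by
    rw [map_sub, sub_eq_sub_iff_add_eq_add, h, add_comm]
  have h2 := eq_zero_of_isCompactOperator_realLift hd hn hσ (f := f - g)
    (h1 ▸ (Submodule.sub_mem _ hK' hK).1)
  have h3 := sub_eq_zero.1 h2
  subst h3
  exact ⟨rfl, add_left_cancel h⟩

theorem exists_eq_realLift_add {ν : ℕ ≃ (Fin d → ℕ)} (T : lipToeplitz ν σ) :
    ∃ f ∈ lipFunctions d, ∃ K ∈ lipCompacts n ν,
      (T : BergmanSpace d n →L[ℂ] BergmanSpace d n) = realLift σ f + K := by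
  obtain ⟨K, hK, _, ⟨f, hf, rfl⟩, h⟩ := Submodule.mem_sup.1 T.2
  exact ⟨f, hf, K, hK, by rw [← h, add_comm]⟩

theorem realLift_mem_lipToeplitz (ν : ℕ ≃ (Fin d → ℕ))
    {f : C(sphere (0 : EuclideanSpace ℂ (Fin d)) 1, ℝ)} (hf : f ∈ lipFunctions d) :
    realLift σ f ∈ lipToeplitz ν σ :=
  Submodule.mem_sup_right ⟨f, hf, rfl⟩

theorem one_mem_lipToeplitz (hσ : IsPositiveUnitalSplitting σ) (ν : ℕ ≃ (Fin d → ℕ)) :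
    1 ∈ lipToeplitz ν σ :=
  realLift_one hσ ▸ realLift_mem_lipToeplitz ν (one_mem_lipFunctions d)

/-- The map `σ(f) + K ↦ L̃_n(K) + Lip(f)` is a well-defined seminorm, because the decomposition is
unique and linear. -/
theorem exists_lipSeminorm (hd : 1 ≤ d) (hn : d ≤ n) (hσ : IsPositiveUnitalSplitting σ)
    (ν : ℕ ≃ (Fin d → ℕ)) :
    ∃ L : Seminorm ℝ (lipToeplitz ν σ),
      ∀ T : lipToeplitz ν σ, ∀ K ∈ lipCompacts n ν, ∀ f ∈ lipFunctions d,
        (T : BergmanSpace d n →L[ℂ] BergmanSpace d n) = realLift σ f + K →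
          L T = lipNormCompacts ν K + lipConstant f := by
  choose f hf K hK hT using exists_eq_realLift_add (ν := ν) (σ := σ)
  have huniq : ∀ (T : lipToeplitz ν σ) (K' : BergmanSpace d n →L[ℂ] BergmanSpace d n)
      (g : C(sphere (0 : EuclideanSpace ℂ (Fin d)) 1, ℝ)), K' ∈ lipCompacts n ν →
      (T : BergmanSpace d n →L[ℂ] BergmanSpace d n) = realLift σ g + K' →
      f T = g ∧ K T = K' := fun T K' g hK' h =>
    realLift_add_inj hd hn hσ (hK T) hK' ((hT T).symm.trans h)
  refine ⟨Seminorm.of (fun T => lipNormCompacts ν (K T) + lipConstant (f T)) ?_ ?_, ?_⟩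
  · intro S T
    obtain ⟨h1, h2⟩ := huniq (S + T) (K S + K T) (f S + f T)
      (Submodule.add_mem _ (hK S) (hK T)) (by
        rw [Submodule.coe_add, hT S, hT T, map_add, add_add_add_comm])
    rw [h1, h2]
    have h3 := lipNormCompacts_add_le (hK S) (hK T)
    have h4 := lipConstant_add_le (hf S) (hf T)
    linarith
  · intro c T
    obtain ⟨h1, h2⟩ := huniq (c • T) (c • K T) (c • f T) (Submodule.smul_mem _ c (hK T)) (by
      rw [Submodule.coe_smul, hT T, map_smul, smul_add])
    rw [h1, h2, lipNormCompacts_smul, lipConstant_smul, Real.norm_eq_abs, mul_add]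
  · intro T K' hK' g _ h
    obtain ⟨h1, h2⟩ := huniq T K' g hK' h
    change lipNormCompacts ν (K T) + lipConstant (f T) = _
    rw [h1, h2]

/-- A self-adjoint operator of norm at most `ε` is at least `-ε`. -/
theorem nonneg_smul_one_add {H : Type*} [NormedAddCommGroup H] [InnerProductSpace ℂ H]
    [CompleteSpace H] {T : H →L[ℂ] H} (hT : IsSelfAdjoint T) {ε : ℝ} (h : ‖T‖ ≤ ε) :
    0 ≤ ε • (1 : H →L[ℂ] H) + T := by
  have h1 : -T ≤ algebraMap ℝ (H →L[ℂ] H) ‖-T‖ := hT.neg.le_algebraMap_norm_self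
  have h2 : algebraMap ℝ (H →L[ℂ] H) ‖-T‖ ≤ algebraMap ℝ (H →L[ℂ] H) ε :=
    algebraMap_mono _ (by rwa [norm_neg])
  have h3 := sub_nonneg.2 (h1.trans h2)
  rwa [sub_neg_eq_add, Algebra.algebraMap_eq_smul_one] at h3

/-- The unit ball of the Lip-norm is totally bounded modulo scalars: this combines the nets in its
two summands. -/
theorem exists_finite_net_lipToeplitz (hd : 1 ≤ d) (hn : d ≤ n)
    (hσ : IsPositiveUnitalSplitting σ) (ν : ℕ ≃ (Fin d → ℕ)) {ε : ℝ} (hε : 0 < ε) :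
    ∃ F : Set (lipToeplitz ν σ), F.Finite ∧
      ∀ f ∈ lipFunctions d, lipConstant f ≤ 1 → ∀ K ∈ lipCompacts n ν, lipNormCompacts ν K ≤ 1 →
        ∃ b ∈ F, ∃ t : ℝ,
          0 ≤ ε • (1 : BergmanSpace d n →L[ℂ] BergmanSpace d n) - (realLift σ f + K - b - t • 1) ∧
          0 ≤ ε • (1 : BergmanSpace d n →L[ℂ] BergmanSpace d n)
            + (realLift σ f + K - b - t • 1) := by
  have x₀ : sphere (0 : EuclideanSpace ℂ (Fin d)) 1 :=
    ⟨EuclideanSpace.single ⟨0, hd⟩ 1, by simp⟩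
  obtain ⟨F₁, hF₁, hF₁l, h₁⟩ := exists_finite_net_lipFunctions x₀ (half_pos hε)
  obtain ⟨F₂, hF₂, hF₂l, h₂⟩ := exists_finite_net_lipCompacts hd hn ν (half_pos hε)
  refine ⟨Subtype.val ⁻¹' ((fun p : C(sphere (0 : EuclideanSpace ℂ (Fin d)) 1, ℝ) ×
    (BergmanSpace d n →L[ℂ] BergmanSpace d n) => realLift σ p.1 + p.2) '' (F₁ ×ˢ F₂)),
    ((hF₁.prod hF₂).image _).preimage Subtype.val_injective.injOn, fun f hf hf1 K hK hK1 => ?_⟩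
  obtain ⟨g, hg, hfg⟩ := h₁ f hf hf1
  obtain ⟨K', hK', hKK'⟩ := h₂ K hK hK1
  refine ⟨⟨realLift σ g + K', Submodule.add_mem _ (realLift_mem_lipToeplitz ν (hF₁l hg))
    (Submodule.mem_sup_left (hF₂l K' hK'))⟩, ⟨(g, K'), ⟨hg, hK'⟩, rfl⟩, f x₀, ?_⟩
  have h3 : realLift σ f + K - (realLift σ g + K') - f x₀ • 1
      = realLift σ (f - g - f x₀ • 1) + (K - K') := by
    rw [map_sub, map_sub, map_smul, realLift_one hσ]
    abel
  have hsa : IsSelfAdjoint (K - K') := (Submodule.sub_mem _ hK (hF₂l K' hK')).2.1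
  have hε2 : ε • (1 : BergmanSpace d n →L[ℂ] BergmanSpace d n) = (ε / 2) • 1 + (ε / 2) • 1 := by
    rw [← add_smul, add_halves]
  have h4 := realLift_nonneg_of_norm_le hσ hfg
  have h5 := realLift_nonneg_of_norm_le hσ (by rwa [norm_neg] : ‖-(f - g - f x₀ • 1)‖ ≤ ε / 2)
  have h6 := nonneg_smul_one_add hsa hKK'
  have h7 := nonneg_smul_one_add hsa.neg (by rwa [norm_neg] : ‖-(K - K')‖ ≤ ε / 2)
  rw [map_neg] at h5
  change 0 ≤ ε • (1 : BergmanSpace d n →L[ℂ] BergmanSpace d n)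
      - (realLift σ f + K - (realLift σ g + K') - f x₀ • 1) ∧
    0 ≤ ε • (1 : BergmanSpace d n →L[ℂ] BergmanSpace d n)
      + (realLift σ f + K - (realLift σ g + K') - f x₀ • 1)
  rw [h3, hε2]
  constructor
  · refine (add_nonneg h5 h7).trans_eq ?_
    abel
  · refine (add_nonneg h4 h6).trans_eq ?_
    abel

end Splitting

theorem theorem2p2 (d n : ℕ) (hd : 1 ≤ d) (hn : d ≤ n) :
    (∃ σ : C(Metric.sphere (0 : EuclideanSpace ℂ (Fin d)) 1, ℂ) →ₗ[ℂ] toeplitzAlgebra d n,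
      IsPositiveUnitalSplitting σ) ∧
    ∀ (ν : ℕ ≃ (Fin d → ℕ))
      (σ : C(Metric.sphere (0 : EuclideanSpace ℂ (Fin d)) 1, ℂ) →ₗ[ℂ] toeplitzAlgebra d n),
      IsPositiveUnitalSplitting σ →
      (∀ T ∈ lipToeplitz ν σ, T ∈ toeplitzAlgebra d n ∧ IsSelfAdjoint T) ∧
      Disjoint (lipCompacts n ν) (lipSection σ) ∧
      ∃ (h1 : (1 : BergmanSpace d n →L[ℂ] BergmanSpace d n) ∈ lipToeplitz ν σ)
        (L : Seminorm ℝ (lipToeplitz ν σ)),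
        (∀ T : lipToeplitz ν σ, ∀ K ∈ lipCompacts n ν, ∀ f ∈ lipFunctions d,
          (T : BergmanSpace d n →L[ℂ] BergmanSpace d n) = realLift σ f + K →
            L T = lipNormCompacts ν K + lipConstant f) ∧
        IsCompactQuantumMetricSpace (lipToeplitz ν σ) ⟨1, h1⟩ L := by
  refine ⟨exists_isPositiveUnitalSplitting n hd, fun ν σ hσ => ⟨fun T hT =>
    ⟨mem_toeplitzAlgebra_of_mem_lipToeplitz hd hn hT, isSelfAdjoint_of_mem_lipToeplitz hσ hT⟩,
    disjoint_lipCompacts_lipSection hd hn hσ ν, one_mem_lipToeplitz hσ ν, ?_⟩⟩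
  obtain ⟨L, hL⟩ := exists_lipSeminorm hd hn hσ ν
  refine ⟨L, hL, isOrderUnitSpace_of_isSelfAdjoint _ _ fun T hT =>
    isSelfAdjoint_of_mem_lipToeplitz hσ hT, ?_, stateMetric_topology_eq L fun ε hε => ?_⟩
  · rw [hL _ 0 (Submodule.zero_mem _) 1 (one_mem_lipFunctions d)
      (by rw [realLift_one hσ, add_zero]), lipConstant_one, add_zero]
    simpa using lipNormCompacts_smul ν 0 (0 : BergmanSpace d n →L[ℂ] BergmanSpace d n)
  · obtain ⟨F, hF, h⟩ := exists_finite_net_lipToeplitz hd hn hσ ν hε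
    refine ⟨F, hF, fun a ha => ?_⟩
    obtain ⟨f, hf, K, hK, hT⟩ := exists_eq_realLift_add a
    have h2 := hL a K hK f hf hT
    have h3 := lipNormCompacts_nonneg ν K
    have h4 := lipConstant_nonneg f
    obtain ⟨b, hb, t, h5, h6⟩ := h f hf (by linarith) K hK (by linarith)
    rw [← hT] at h5 h6
    exact ⟨b, hb, t, h5, h6⟩
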